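/- A $\mathbb{B}_2$ circuit on $n$ input variables is a circuit (a directed acyclic graph of gates, with unrestricted fan-out) whose gates compute arbitrary Boolean functions of fan-in at most $2$; its size is its number of binary gates. An affine subspace of $\mathbb{F}_2^n$ of dimension $m$ is described by a matrix $A\in\mathbb{F}_2^{n\times m}$ of full column rank and a vector $a\in\mathbb{F}_2^n$, and is the set $\{Ay+a : y\in\mathbb{F}_2^m\}$. Theorem. Let $d:\mathbb{N}\to\mathbb{N}$ be an arbitrary function. (1) There is an affine refuter for dimension $d$ against $\mathbb{B}_2$ circuits of size $3n-4d(n)$: a deterministic polynomial-time algorithm that, given $1^n$ and any $\mathbb{B}_2$ circuit $C$ on $n$ input variables of size strictly less than $3n-4d(n)$, prints a description $(A,a)$ of an affine subspace of $\mathbb{F}_2^n$ of dimension at least $d(n)$ on which $C$ is constant. (2) If the number $d(n)$, written in unary, is supplied together with $1^n$ and $C$, then the dimension can be made exact: there is a deterministic polynomial-time algorithm that, given $1^n$, $1^{d(n)}$ and any $\mathbb{B}_2$ circuit $C$ on $n$ input variables of size strictly less than $3n-4d(n)$, prints a description $(A,a)$ of an affine subspace of $\mathbb{F}_2^n$ of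 dimension exactly $d(n)$ on which $C$ is constant. -/

import Mathlib

open scoped Matrix

namespace AffineRefuter

/-! ### Circuits over the basis of all Boolean functions of fan-in at most two -/

/-- A gate: a constant, an arbitrary unary Boolean function of one wire, or an arbitrary binary
Boolean function of two wires. Bits are elements of the field with two elements. -/
inductive Gate : Type
  | const (b : ZMod 2) : Gate
  | unary (f : ZMod 2 → ZMod 2) (i : ℕ) : Gate
  | binary (f : ZMod 2 → ZMod 2 → ZMod 2) (i j : ℕ) : Gate

namespace Gate

/-- The wires read by a gate. -/
def inputs : Gate → List ℕ
  | const _ => []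
  | unary _ i => [i]
  | binary _ i j => [i, j]

/-- The number of binary gates that a gate counts for: unary gates and constants are free. -/
def cost : Gate → ℕ
  | const _ => 0
  | unary _ _ => 0
  | binary _ _ _ => 1

/-- The value of a gate, given the list of values of the preceding wires. -/
def eval (v : List (ZMod 2)) : Gate → ZMod 2
  | const b => b
  | unary f i => f (v.getD i 0)
  | binary f i j => f (v.getD i 0) (v.getD j 0)

/-- A gate as a block of seven numbers: its fan-in, its truth table (as a function of two bits),
and the wires it reads (padded with zeros). -/
def encode : Gate → List ℕ
  | const b => [0, b.val, b.val, b.val, b.val, 0, 0]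
  | unary f i => [1, (f 0).val, (f 0).val, (f 1).val, (f 1).val, i, 0]
  | binary f i j => [2, (f 0 0).val, (f 0 1).val, (f 1 0).val, (f 1 1).val, i, j]

end Gate

/-- A circuit with `n` input variables: a list of gates in topological order. Wires `0, …, n - 1`
are the variables, wire `n + k` is the gate number `k`; every gate reads variables and earlier
gates only. Fan-out is unrestricted, and the output is any wire. -/
structure Circuit (n : ℕ) where
  gates : List Gate
  output : ℕ
  inputs_lt : ∀ (k : ℕ) (hk : k < gates.length), ∀ i ∈ (gates[k]).inputs, i < n + k
  output_lt : output < n + gates.length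

namespace Circuit

variable {n : ℕ}

/-- The size of a circuit: its number of binary gates. -/
def size (C : Circuit n) : ℕ := (C.gates.map Gate.cost).sum

/-- The values of all wires on the input `x`. -/
def wireValues (C : Circuit n) (x : Fin n → ZMod 2) : List (ZMod 2) :=
  C.gates.foldl (fun v g => v ++ [g.eval v]) (List.ofFn x)

/-- The Boolean function computed by a circuit. -/
def eval (C : Circuit n) (x : Fin n → ZMod 2) : ZMod 2 := (C.wireValues x).getD C.output 0

/-- The circuit is constant on the set `S`. -/
def ConstantOn (C : Circuit n) (S : Set (Fin n → ZMod 2)) : Prop :=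
  ∃ c : ZMod 2, ∀ x ∈ S, C.eval x = c

/-- A circuit as a sequence of numbers: number of gates, output wire, and the gates. -/
def encode (C : Circuit n) : List ℕ :=
  C.gates.length :: C.output :: C.gates.flatMap Gate.encode

end Circuit

/-! ### Descriptions of affine subspaces -/

/-- A description of an affine subspace of `𝔽₂ⁿ` of dimension `dim`: a matrix `A` with `n` rows and
`dim` columns that has full column rank, and an offset vector `a`. -/
structure AffineDescription (n : ℕ) where
  dim : ℕ
  A : Matrix (Fin n) (Fin dim) (ZMod 2)
  a : Fin n → ZMod 2
  fullRank : A.rank = dim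

namespace AffineDescription

variable {n : ℕ}

/-- The affine subspace `{A y + a}` described. -/
def toSet (D : AffineDescription n) : Set (Fin n → ZMod 2) :=
  Set.range fun y : Fin D.dim → ZMod 2 => D.A *ᵥ y + D.a

/-- A description as a sequence of numbers: the dimension, the offset, and the columns of the
matrix one after the other. -/
def encode (D : AffineDescription n) : List ℕ :=
  D.dim :: (List.ofFn fun i => (D.a i).val) ++
    (List.ofFn fun j => List.ofFn fun i => (D.A i j).val).flatten

end AffineDescription

/-! ### Random access machines with a step count -/

/-- Structured programs of a random access machine with registers `0, 1, 2, …` and arrays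
`0, 1, 2, …`, all holding natural numbers. A program mentions finitely many registers and
arrays. There is addition and truncated subtraction but no multiplication. -/
inductive Program : Type
  | skip : Program
  /-- `reg r := c` -/
  | const (r c : ℕ) : Program
  /-- `reg r := reg s` -/
  | copy (r s : ℕ) : Program
  /-- `reg r := reg s + reg t` -/
  | add (r s t : ℕ) : Program
  /-- `reg r := reg s - reg t` (truncated) -/
  | sub (r s t : ℕ) : Program
  /-- `reg r := arr a [reg s]` -/
  | load (r a s : ℕ) : Program
  /-- `arr a [reg r] := reg s` -/
  | store (a r s : ℕ) : Program
  /-- first `p`, then `q` -/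
  | seq (p q : Program) : Program
  /-- if `reg r ≠ 0` then `p` else `q` -/
  | ite (r : ℕ) (p q : Program) : Program
  /-- while `reg r ≠ 0` do `p` -/
  | loop (r : ℕ) (p : Program) : Program

/-- The memory of the machine. -/
structure Memory where
  reg : ℕ → ℕ
  arr : ℕ → ℕ → ℕ

namespace Memory

/-- Set register `r` to `v`. -/
def setReg (m : Memory) (r v : ℕ) : Memory :=
  ⟨Function.update m.reg r v, m.arr⟩

/-- Set cell `i` of array `a` to `v`. -/
def setArr (m : Memory) (a i v : ℕ) : Memory :=
  ⟨m.reg, Function.update m.arr a (Function.update (m.arr a) i v)⟩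

/-- The initial memory on the input `w`: array `0` holds `w`, register `0` holds its length, and
everything else is zero. -/
def init (w : List ℕ) : Memory :=
  ⟨fun r => if r = 0 then w.length else 0, fun a i => if a = 0 then w.getD i 0 else 0⟩

/-- The printed output: the first `reg 1` cells of array `1`. -/
def out (m : Memory) : List ℕ := (List.range (m.reg 1)).map (m.arr 1)

end Memory

/-- `Runs p m m' t`: started in memory `m`, the program `p` halts in memory `m'` after exactly `t`
steps. Every elementary instruction and every test of a condition takes one step. -/
inductive Runs : Program → Memory → Memory → ℕ → Prop
  | skip (m : Memory) : Runs .skip m m 1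
  | const (m : Memory) (r c : ℕ) : Runs (.const r c) m (m.setReg r c) 1
  | copy (m : Memory) (r s : ℕ) : Runs (.copy r s) m (m.setReg r (m.reg s)) 1
  | add (m : Memory) (r s t : ℕ) : Runs (.add r s t) m (m.setReg r (m.reg s + m.reg t)) 1
  | sub (m : Memory) (r s t : ℕ) : Runs (.sub r s t) m (m.setReg r (m.reg s - m.reg t)) 1
  | load (m : Memory) (r a s : ℕ) : Runs (.load r a s) m (m.setReg r (m.arr a (m.reg s))) 1
  | store (m : Memory) (a r s : ℕ) : Runs (.store a r s) m (m.setArr a (m.reg r) (m.reg s)) 1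
  | seq {p q : Program} {m₁ m₂ m₃ : Memory} {t₁ t₂ : ℕ} :
      Runs p m₁ m₂ t₁ → Runs q m₂ m₃ t₂ → Runs (.seq p q) m₁ m₃ (t₁ + t₂)
  | ite_true {r : ℕ} {p q : Program} {m m' : Memory} {t : ℕ} :
      m.reg r ≠ 0 → Runs p m m' t → Runs (.ite r p q) m m' (t + 1)
  | ite_false {r : ℕ} {p q : Program} {m m' : Memory} {t : ℕ} :
      m.reg r = 0 → Runs q m m' t → Runs (.ite r p q) m m' (t + 1)
  | loop_done {r : ℕ} {p : Program} {m : Memory} :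
      m.reg r = 0 → Runs (.loop r p) m m 1
  | loop_step {r : ℕ} {p : Program} {m₁ m₂ m₃ : Memory} {t₁ t₂ : ℕ} :
      m₁.reg r ≠ 0 → Runs p m₁ m₂ t₁ → Runs (.loop r p) m₂ m₃ t₂ →
        Runs (.loop r p) m₁ m₃ (t₁ + t₂ + 1)

/-- On the input `w` the program halts after `t` steps and prints `o`. -/
def Program.Prints (P : Program) (w o : List ℕ) (t : ℕ) : Prop :=
  ∃ m : Memory, Runs P (Memory.init w) m t ∧ m.out = o

/-- The length of an input in bits, each number being written in binary and followed by a
separator. -/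
def bitLength (w : List ℕ) : ℕ := (w.map fun x => Nat.size x + 1).sum

/-! ### Affine refuters -/

/-- The number `k` in unary, followed by a separator. -/
def unary (k : ℕ) : List ℕ := List.replicate k 1 ++ [0]

/-- `P` is a polynomial-time algorithm that takes inputs `1ⁿ` and a circuit `C` with `n` variables
and, if the size of `C` is less than `s n`, prints the description of an affine subspace of
dimension at least `d n` on which `C` is constant. (Here and below, the time of printing the output
counts, and the time is polynomial on all circuits.) -/
def IsAffineRefuter (d : ℕ → ℕ) (s : ℕ → ℤ) (P : Program) : Prop :=
  ∃ q : Polynomial ℕ, ∀ (n : ℕ) (C : Circuit n), ∃ (o : List ℕ) (t : ℕ),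
    P.Prints (unary n ++ C.encode) o t ∧
    t + o.length ≤ q.eval (bitLength (unary n ++ C.encode)) ∧
    ((C.size : ℤ) < s n →
      ∃ D : AffineDescription n, o = D.encode ∧ d n ≤ D.dim ∧ C.ConstantOn D.toSet)

/-- `P` is a polynomial-time algorithm that takes inputs `1ⁿ`, the number `d n` in unary, and a
circuit `C` with `n` variables and, if the size of `C` is less than `s n`, prints the description
of an affine subspace of dimension exactly `d n` on which `C` is constant. -/
def IsExactAffineRefuter (d : ℕ → ℕ) (s : ℕ → ℤ) (P : Program) : Prop :=
  ∃ q : Polynomial ℕ, ∀ (n : ℕ) (C : Circuit n), ∃ (o : List ℕ) (t : ℕ),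
    P.Prints (unary n ++ unary (d n) ++ C.encode) o t ∧
    t + o.length ≤ q.eval (bitLength (unary n ++ unary (d n) ++ C.encode)) ∧
    ((C.size : ℤ) < s n →
      ∃ D : AffineDescription n, o = D.encode ∧ D.dim = d n ∧ C.ConstantOn D.toSet)

end AffineRefuter

/-! The proof is gate elimination by affine substitutions. An affine subspace is kept by writing
every variable as an affine form `A i` in at most `n` coordinates. On it every wire is normalised to
a constant plus a root: gates that have become constant, or a copy or negation of another root,
disappear. A wire that is its own root is either affine (a variable, or a sum of two affine roots)
or live. The measure is the number of roots reached from the output by walking backwards through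
live gates (`Net.used`). An affine gate is a leaf of this walk and counts as a fresh variable, so
sums cost nothing extra. Only variables and binary gates can be their own roots, so the measure is
at most `n + size` at the start (`Circuit.card_used_le`).

Let `a` be the first used live gate. Its arguments are two different affine roots, and `a` is not
their sum, so it is of AND type: either argument can be fixed to a value that makes `a` constant
(`classify_fix`). The right argument is fixed if another used live gate reads it, and the left one
otherwise. This is one affine equation and costs one dimension. If the output does not become
constant, four roots are lost: the fixed root, `a`, a reader of `a`, and either a second reader of
the fixed root or the other argument, which nobody reads any more. If the reader of `a` is also that
second reader, it becomes constant itself, and a gate above it is lost instead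
(`Net.Refines.card_used_of_gate`). If no live gate is used, the output is affine, and fixing it
makes it constant.

Hence `used + 4 * d < 4 * dim` persists until the output is constant; it holds at the start because
`n + size + 4 * d < 4 * n`. It implies `d < dim`, so the last substitution still leaves dimension at
least `d`. Each round before that lowers the dimension, so `n` rounds suffice (`Net.Invariant.next`,
`Net.Invariant.final`).

The count compares two tables, each computed from scratch. `Net.resolve` shows that the table after
a substitution is the old one with its roots resolved further, so every root used afterwards comes
from a surviving old one (`Net.Refines.used_survives`). Soundness of the table is `Net.sound`.

The forms stay reduced: a coordinate that occurs is the variable of the same number. The columns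
therefore contain an identity matrix, which gives full rank, and any of them may be dropped by
setting the coordinate to zero, which gives the exact dimension.

For the running time, the algorithm is written in a language whose only loops run over the length of
the input. A polynomial bound can then be read off the syntax (`Cmd.cost`), and one compiler proof,
`Cmd.prints_compile`, carries everything over to the random access machine. -/

namespace AffineRefuter

/-! ### A language of bounded loops -/

/-- Variables of the bounded-loop language. `len` and `outLen` are the registers that hold the
length of the input and of the output. -/
inductive Var : Type
  | len | outLen | n | dmax | gates | out | wires | base | stage | i | w | j | acc
  | kind | lw | rw | u | v | lc | rc | g00 | g01 | g10 | g11 | root | sign | aff | live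
  | cl | cr | rowU | rowV | rowW | nz | sel | other | fix | val | pivot | dim | k | tmp
  deriving DecidableEq

/-- Arrays of the bounded-loop language. -/
inductive Arr : Type
  | input | output | root | sign | aff | live | form | row | left | right | cl | cr | mark | psi
  deriving DecidableEq

/-- Memories of the bounded-loop language. -/
structure State where
  reg : Var → ℕ
  arr : Arr → ℕ → ℕ

namespace State

/-- Set a variable. -/
def setReg (s : State) (r : Var) (x : ℕ) : State :=
  ⟨fun r' => if r' = r then x else s.reg r', s.arr⟩

/-- Set a cell of an array. -/
def setArr (s : State) (a : Arr) (i x : ℕ) : State :=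
  ⟨s.reg, fun a' i' => if a' = a ∧ i' = i then x else s.arr a' i'⟩

@[simp] theorem setReg_reg (s : State) (r r' : Var) (x : ℕ) :
    (s.setReg r x).reg r' = if r' = r then x else s.reg r' := rfl

@[simp] theorem setReg_arr (s : State) (r : Var) (x : ℕ) : (s.setReg r x).arr = s.arr := rfl

@[simp] theorem setArr_reg (s : State) (a : Arr) (i x : ℕ) : (s.setArr a i x).reg = s.reg := rfl

@[simp] theorem setArr_arr (s : State) (a a' : Arr) (i i' x : ℕ) :
    (s.setArr a i x).arr a' i' = if a' = a ∧ i' = i then x else s.arr a' i' := rfl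

/-- The initial state on the input `w`. -/
def init (w : List ℕ) : State :=
  ⟨fun r => if r = .len then w.length else 0, fun a i => if a = .input then w.getD i 0 else 0⟩

/-- The printed output. -/
def print (s : State) : List ℕ := (List.range (s.reg .outLen)).map (s.arr .output)

end State

/-- Expressions. -/
inductive Exp : Type
  | lit (c : ℕ) : Exp
  | var (r : Var) : Exp
  | add (a b : Exp) : Exp
  | sub (a b : Exp) : Exp
  | get (a : Arr) (i : Exp) : Exp

namespace Exp

instance : Coe Var Exp := ⟨var⟩
instance (c : ℕ) : OfNat Exp c := ⟨lit c⟩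
instance : Add Exp := ⟨add⟩
instance : Sub Exp := ⟨sub⟩

/-- The value of an expression. -/
def eval (s : State) : Exp → ℕ
  | lit c => c
  | var r => s.reg r
  | add a b => a.eval s + b.eval s
  | sub a b => a.eval s - b.eval s
  | get a i => s.arr a (i.eval s)

/-- The sum modulo two of two bits. -/
def xor (a b : Exp) : Exp := (a - b) + (b - a)

@[simp] theorem eval_ofNat (s : State) (c : ℕ) : eval s (ofNat(c) : Exp) = c := rfl
@[simp] theorem eval_var (s : State) (r : Var) : eval s (var r) = s.reg r := rfl
@[simp] theorem eval_add (s : State) (a b : Exp) : eval s (a + b) = eval s a + eval s b := rfl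
@[simp] theorem eval_sub (s : State) (a b : Exp) : eval s (a - b) = eval s a - eval s b := rfl
@[simp] theorem eval_get (s : State) (a : Arr) (i : Exp) :
    eval s (get a i) = s.arr a (eval s i) := rfl
@[simp] theorem eval_xor (s : State) (a b : Exp) :
    eval s (xor a b) = (eval s a - eval s b) + (eval s b - eval s a) := rfl

/-- The number of steps that the evaluation of an expression takes. -/
def cost : Exp → ℕ
  | lit _ => 1
  | var _ => 1
  | add a b => a.cost + (b.cost + 1)
  | sub a b => a.cost + (b.cost + 1)
  | get _ i => i.cost + 1

end Exp

/-- Commands. The command `rep r c` performs `c` with `r = 0, 1, …, L - 1`, where `L` is the length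
of the input. -/
inductive Cmd : Type
  | nop : Cmd
  | set (r : Var) (e : Exp) : Cmd
  | put (a : Arr) (i e : Exp) : Cmd
  | seq (c d : Cmd) : Cmd
  | branch (e : Exp) (c d : Cmd) : Cmd
  | rep (r : Var) (c : Cmd) : Cmd

namespace Cmd

/-- Perform `f` on the numbers below `L` in increasing order. -/
def iter (f : ℕ → State → State) : ℕ → State → State
  | 0, s => s
  | L + 1, s => f L (iter f L s)

/-- The effect of a command, when the length of the input is `L`. -/
def run (L : ℕ) : Cmd → State → State
  | nop, s => s
  | set r e, s => s.setReg r (e.eval s)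
  | put a i e, s => s.setArr a (i.eval s) (e.eval s)
  | seq c d, s => d.run L (c.run L s)
  | branch e c d, s => if e.eval s ≠ 0 then c.run L s else d.run L s
  | rep r c, s => iter (fun i s => c.run L (s.setReg r i)) L s

/-- A block of commands. -/
def block : List Cmd → Cmd
  | [] => nop
  | c :: cs => seq c (block cs)

/-- A conditional without alternative. -/
def when (e : Exp) (c : Cmd) : Cmd := branch e c nop

@[simp] theorem run_nop (L : ℕ) (s : State) : run L nop s = s := rfl
@[simp] theorem run_set (L : ℕ) (r : Var) (e : Exp) (s : State) :
    run L (set r e) s = s.setReg r (e.eval s) := rfl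
@[simp] theorem run_put (L : ℕ) (a : Arr) (i e : Exp) (s : State) :
    run L (put a i e) s = s.setArr a (i.eval s) (e.eval s) := rfl
@[simp] theorem run_seq (L : ℕ) (c d : Cmd) (s : State) :
    run L (seq c d) s = run L d (run L c s) := rfl
@[simp] theorem run_block_nil (L : ℕ) (s : State) : run L (block []) s = s := rfl
@[simp] theorem run_block_cons (L : ℕ) (c : Cmd) (cs : List Cmd) (s : State) :
    run L (block (c :: cs)) s = run L (block cs) (run L c s) := rfl
theorem run_branch (L : ℕ) (e : Exp) (c d : Cmd) (s : State) :
    run L (branch e c d) s = if e.eval s ≠ 0 then c.run L s else d.run L s := rfl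
theorem run_when (L : ℕ) (e : Exp) (c : Cmd) (s : State) :
    run L (when e c) s = if e.eval s ≠ 0 then c.run L s else s := rfl

/-- The invariant rule for loops. -/
theorem run_rep_of_invariant {L : ℕ} {r : Var} {c : Cmd} (P : ℕ → State → Prop) {s : State}
    (h0 : P 0 s) (hs : ∀ i < L, ∀ s, P i s → P (i + 1) (c.run L (s.setReg r i))) :
    P L (run L (rep r c) s) := by
  have : ∀ k ≤ L, P k (iter (fun i s => c.run L (s.setReg r i)) k s) := by
    intro k
    induction k with
    | zero => intro _; exact h0
    | succ k ih => intro hk; exact hs k (by omega) _ (ih (by omega))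
  exact this L le_rfl

/-- The variable `r` is written by the command. -/
def writes (r : Var) : Cmd → Bool
  | nop => false
  | set r' _ => r = r'
  | put _ _ _ => false
  | seq c d => c.writes r || d.writes r
  | branch _ c d => c.writes r || d.writes r
  | rep r' c => r = r' || c.writes r

/-- The array `a` is written by the command. -/
def stores (a : Arr) : Cmd → Bool
  | nop => false
  | set _ _ => false
  | put a' _ _ => a = a'
  | seq c d => c.stores a || d.stores a
  | branch _ c d => c.stores a || d.stores a
  | rep _ c => c.stores a

/-- A syntactic frame rule. Its hypothesis is a Boolean computation, so for concrete commands it is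
settled by `decide`. -/
theorem run_reg_of_not_writes {L : ℕ} {r : Var} {c : Cmd} (h : c.writes r = false) (s : State) :
    (run L c s).reg r = s.reg r := by
  induction c generalizing s with
  | nop => rfl
  | set r' e => simp_all [writes]
  | put a i e => rfl
  | seq c d ihc ihd =>
    simp only [writes, Bool.or_eq_false_iff] at h
    rw [run_seq, ihd h.2, ihc h.1]
  | branch e c d ihc ihd =>
    simp only [writes, Bool.or_eq_false_iff] at h
    rw [run_branch]
    split_ifs
    · exact ihc h.1 s
    · exact ihd h.2 s
  | rep r' c ih =>
    simp only [writes, Bool.or_eq_false_iff, decide_eq_false_iff_not] at h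
    refine run_rep_of_invariant (P := fun _ t => t.reg r = s.reg r) rfl ?_
    intro i _ t ht
    rw [ih h.2, State.setReg_reg, if_neg h.1, ht]

theorem run_arr_of_not_stores {L : ℕ} {a : Arr} {c : Cmd} (h : c.stores a = false) (s : State) :
    (run L c s).arr a = s.arr a := by
  induction c generalizing s with
  | nop => rfl
  | set r' e => rfl
  | put a i e => funext; simp_all [stores]
  | seq c d ihc ihd =>
    simp only [stores, Bool.or_eq_false_iff] at h
    rw [run_seq, ihd h.2, ihc h.1]
  | branch e c d ihc ihd =>
    simp only [stores, Bool.or_eq_false_iff] at h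
    rw [run_branch]
    split_ifs
    · exact ihc h.1 s
    · exact ihd h.2 s
  | rep r' c ih =>
    simp only [stores] at h
    refine run_rep_of_invariant (P := fun _ t => t.arr a = s.arr a) rfl ?_
    intro i _ t ht
    rw [ih h, State.setReg_arr, ht]

end Cmd

/-! ### Compilation to random access machines -/

/-- The number of a variable. -/
def Var.num (r : Var) : ℕ := r.ctorIdx

/-- The number of an array. -/
def Arr.num (a : Arr) : ℕ := a.ctorIdx

theorem Var.num_injective : Function.Injective Var.num := fun a b h => by
  have := congrArg Var.ofNat h
  simpa only [Var.num, Var.ofNat_ctorIdx] using this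

theorem Arr.num_injective : Function.Injective Arr.num := fun a b h => by
  have := congrArg Arr.ofNat h
  simpa only [Arr.num, Arr.ofNat_ctorIdx] using this

/-- The bound 64 is any number above all variable numbers; registers from 64 on are the workspace of
compiled code. -/
theorem Var.num_lt (r : Var) : r.num < 64 := by cases r <;> decide

/-- A memory that represents a state. -/
structure Represents (m : Memory) (s : State) : Prop where
  reg : ∀ r : Var, m.reg r.num = s.reg r
  arr : ∀ a : Arr, m.arr a.num = s.arr a

theorem Represents.setReg {m : Memory} {s : State} (h : Represents m s) (r : Var) (x : ℕ) :
    Represents (m.setReg r.num x) (s.setReg r x) := by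
  refine ⟨fun r' => ?_, h.arr⟩
  by_cases e : r' = r
  · simp [Memory.setReg, e]
  · have := Var.num_injective.ne e
    simp [Memory.setReg, e, this, h.reg]

theorem Represents.setArr {m : Memory} {s : State} (h : Represents m s) (a : Arr) (i x : ℕ) :
    Represents (m.setArr a.num i x) (s.setArr a i x) := by
  refine ⟨h.reg, fun a' => ?_⟩
  funext i'
  by_cases e : a' = a
  · subst e
    by_cases e' : i' = i <;> simp [Memory.setArr, e', h.arr]
  · have := Arr.num_injective.ne e
    simp [Memory.setArr, e, this, h.arr]

theorem Represents.of_eq {m m' : Memory} {s : State} (h : Represents m s) (ha : m'.arr = m.arr)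
    (hr : ∀ r < 64, m'.reg r = m.reg r) : Represents m' s :=
  ⟨fun r => by rw [hr _ r.num_lt, h.reg], fun a => by rw [ha, h.arr]⟩

/-- A program that puts the value of an expression into register `h` and changes no register
below `h`. -/
def Exp.compile : Exp → ℕ → Program
  | lit c, h => .const h c
  | var r, h => .copy h r.num
  | add a b, h => .seq (a.compile h) (.seq (b.compile (h + 1)) (.add h h (h + 1)))
  | sub a b, h => .seq (a.compile h) (.seq (b.compile (h + 1)) (.sub h h (h + 1)))
  | get a i, h => .seq (i.compile h) (.load h a.num h)

/-- The effect of a compiled expression. -/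
def Exp.Computes (e : Exp) (s : State) (h : ℕ) (m m' : Memory) : Prop :=
  Runs (e.compile h) m m' e.cost ∧ m'.arr = m.arr ∧ (∀ r < h, m'.reg r = m.reg r) ∧
    m'.reg h = e.eval s

theorem Exp.Computes.represents {e : Exp} {s : State} {h : ℕ} {m m' : Memory}
    (H : e.Computes s h m m') (hm : Represents m s) (hh : 64 ≤ h) : Represents m' s :=
  hm.of_eq H.2.1 fun r hr => H.2.2.1 r (by omega)

theorem Memory.setReg_reg_of_lt (m : Memory) {r h : ℕ} (x : ℕ) (hr : r < h) :
    (m.setReg h x).reg r = m.reg r := by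
  simp [Memory.setReg, Function.update_of_ne (Nat.ne_of_lt hr)]

theorem Memory.setReg_reg_self (m : Memory) (h x : ℕ) : (m.setReg h x).reg h = x := by
  simp [Memory.setReg]

/-- The registers from `h` on act as a stack. The left operand waits in register `h` while the right
one is computed from `h + 1` on; the frame clause of `Computes` protects it. -/
theorem Exp.exists_computes (e : Exp) {s : State} {m : Memory} (hm : Represents m s) {h : ℕ}
    (hh : 64 ≤ h) : ∃ m', e.Computes s h m m' := by
  induction e generalizing m h with
  | lit c => exact ⟨_, Runs.const m h c, rfl, fun r => m.setReg_reg_of_lt _, m.setReg_reg_self _ _⟩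
  | var r =>
    refine ⟨_, Runs.copy m h r.num, rfl, fun r => m.setReg_reg_of_lt _, ?_⟩
    rw [m.setReg_reg_self, hm.reg]
    rfl
  | add a b iha ihb =>
    obtain ⟨m₁, H₁⟩ := iha hm hh
    obtain ⟨m₂, H₂⟩ := ihb (H₁.represents hm hh) (h := h + 1) (by omega)
    refine ⟨_, .seq H₁.1 (.seq H₂.1 (Runs.add m₂ h h (h + 1))), H₂.2.1.trans H₁.2.1,
      fun r hr => ?_, ?_⟩
    · rw [m₂.setReg_reg_of_lt _ hr, H₂.2.2.1 r (by omega), H₁.2.2.1 r hr]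
    · rw [m₂.setReg_reg_self, H₂.2.2.2, H₂.2.2.1 h (by omega), H₁.2.2.2]
      rfl
  | sub a b iha ihb =>
    obtain ⟨m₁, H₁⟩ := iha hm hh
    obtain ⟨m₂, H₂⟩ := ihb (H₁.represents hm hh) (h := h + 1) (by omega)
    refine ⟨_, .seq H₁.1 (.seq H₂.1 (Runs.sub m₂ h h (h + 1))), H₂.2.1.trans H₁.2.1,
      fun r hr => ?_, ?_⟩
    · rw [m₂.setReg_reg_of_lt _ hr, H₂.2.2.1 r (by omega), H₁.2.2.1 r hr]
    · rw [m₂.setReg_reg_self, H₂.2.2.2, H₂.2.2.1 h (by omega), H₁.2.2.2]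
      rfl
  | get a i ih =>
    obtain ⟨m₁, H₁⟩ := ih hm hh
    refine ⟨_, .seq H₁.1 (Runs.load m₁ h a.num h), H₁.2.1, fun r hr => ?_, ?_⟩
    · rw [m₁.setReg_reg_of_lt _ hr, H₁.2.2.1 r hr]
    · rw [m₁.setReg_reg_self, H₁.2.2.2, (H₁.represents hm hh).arr]
      rfl

namespace Cmd

/-- The program for a command; it uses the registers from `h` on as its workspace. -/
def compile : Cmd → ℕ → Program
  | nop, _ => .skip
  | set r e, h => .seq (e.compile h) (.copy r.num h)
  | put a i e, h => .seq (i.compile h) (.seq (e.compile (h + 1)) (.store a.num h (h + 1)))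
  | seq c d, h => .seq (c.compile h) (d.compile h)
  | branch e c d, h => .seq (e.compile h) (.ite h (c.compile h) (d.compile h))
  | rep r c, h => .seq (.copy h Var.len.num) (.loop h (.seq (.sub r.num Var.len.num h)
      (.seq (c.compile (h + 2)) (.seq (.const (h + 1) 1) (.sub h h (h + 1))))))

/-- A bound for the number of steps, as a polynomial in the length of the input. -/
noncomputable def cost : Cmd → Polynomial ℕ
  | nop => 1
  | set _ e => (e.cost : Polynomial ℕ) + 1
  | put _ i e => (i.cost : Polynomial ℕ) + e.cost + 1
  | seq c d => c.cost + d.cost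
  | branch e c d => (e.cost : Polynomial ℕ) + c.cost + d.cost + 1
  | rep _ c => Polynomial.X * (c.cost + 4) + 2

/-- The last clause, on registers between 64 and `h`, keeps the counters of enclosing loops intact
and is needed for the induction through nested loops. -/
theorem exists_runs (c : Cmd) {L : ℕ} (hc : c.writes .len = false) {s : State} {m : Memory}
    (hm : Represents m s) (hL : s.reg .len = L) {h : ℕ} (hh : 64 ≤ h) :
    ∃ m' t, Runs (c.compile h) m m' t ∧ t ≤ c.cost.eval L ∧ Represents m' (c.run L s) ∧
      ∀ r, 64 ≤ r → r < h → m'.reg r = m.reg r := by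
  induction c generalizing s m h with
  | nop => exact ⟨m, 1, Runs.skip m, by simp [cost], hm, fun _ _ _ => rfl⟩
  | set r e =>
    obtain ⟨m₁, H₁⟩ := e.exists_computes hm hh
    refine ⟨_, _, .seq H₁.1 (.copy m₁ r.num h), by simp [cost], ?_, fun r' h1 h2 => ?_⟩
    · rw [H₁.2.2.2]
      exact (H₁.represents hm hh).setReg r _
    · have : r' ≠ r.num := by have := r.num_lt; omega
      simpa [Memory.setReg, this] using H₁.2.2.1 r' h2
  | put a i e =>
    obtain ⟨m₁, H₁⟩ := i.exists_computes hm hh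
    have hm₁ := H₁.represents hm hh
    obtain ⟨m₂, H₂⟩ := e.exists_computes hm₁ (h := h + 1) (by omega)
    refine ⟨_, _, .seq H₁.1 (.seq H₂.1 (.store m₂ a.num h (h + 1))), by simp [cost]; omega, ?_,
      fun r' h1 h2 => ?_⟩
    · rw [H₂.2.2.2, H₂.2.2.1 h (by omega), H₁.2.2.2]
      exact (H₂.represents hm₁ (by omega)).setArr a _ _
    · exact (H₂.2.2.1 r' (by omega)).trans (H₁.2.2.1 r' h2)
  | seq c d ihc ihd =>
    simp only [writes, Bool.or_eq_false_iff] at hc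
    obtain ⟨m₁, t₁, R₁, T₁, P₁, F₁⟩ := ihc hc.1 hm hL hh
    obtain ⟨m₂, t₂, R₂, T₂, P₂, F₂⟩ := ihd hc.2 P₁ (by rw [run_reg_of_not_writes hc.1, hL]) hh
    refine ⟨m₂, _, .seq R₁ R₂, ?_, P₂, fun r h1 h2 => (F₂ r h1 h2).trans (F₁ r h1 h2)⟩
    simp only [cost, Polynomial.eval_add]
    omega
  | branch e c d ihc ihd =>
    simp only [writes, Bool.or_eq_false_iff] at hc
    obtain ⟨m₁, H₁⟩ := e.exists_computes hm hh
    have hm₁ := H₁.represents hm hh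
    have hcost : (branch e c d).cost.eval L = e.cost + c.cost.eval L + d.cost.eval L + 1 := by
      simp [cost]
    rw [run_branch]
    split_ifs with h0
    · obtain ⟨m₂, t₂, R₂, T₂, P₂, F₂⟩ := ihc hc.1 hm₁ hL hh
      exact ⟨m₂, _, .seq H₁.1 (.ite_true (by rwa [H₁.2.2.2]) R₂), by omega, P₂,
        fun r h1 h2 => (F₂ r h1 h2).trans (H₁.2.2.1 r h2)⟩
    · obtain ⟨m₂, t₂, R₂, T₂, P₂, F₂⟩ := ihd hc.2 hm₁ hL hh
      exact ⟨m₂, _, .seq H₁.1 (.ite_false (by rw [H₁.2.2.2]; simpa using h0) R₂), by omega, P₂,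
        fun r h1 h2 => (F₂ r h1 h2).trans (H₁.2.2.1 r h2)⟩
  | rep r c ih =>
    simp only [writes, Bool.or_eq_false_iff, decide_eq_false_iff_not] at hc
    -- The machine counts down: `k` is the number of iterations left, and the loop variable receives
    -- `L - k`. Each iteration has an overhead of four steps: the test, the subtraction that sets
    -- the variable, and two steps to decrease the counter.
    have key : ∀ k ≤ L, ∀ m : Memory, m.reg h = k →
        Represents m (iter (fun i s => c.run L (s.setReg r i)) (L - k) s) →
        ∃ m' t, Runs (.loop h (.seq (.sub r.num Var.len.num h)
          (.seq (c.compile (h + 2)) (.seq (.const (h + 1) 1) (.sub h h (h + 1)))))) m m' t ∧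
          t ≤ k * (c.cost.eval L + 4) + 1 ∧
          Represents m' (iter (fun i s => c.run L (s.setReg r i)) L s) ∧
          ∀ r, 64 ≤ r → r < h → m'.reg r = m.reg r := by
      intro k
      induction k with
      | zero =>
        intro _ m hk hR
        exact ⟨m, 1, .loop_done hk, by omega, hR, fun _ _ _ => rfl⟩
      | succ k ihk =>
        intro hkL m hk hR
        set S := iter (fun i s => c.run L (s.setReg r i)) (L - (k + 1)) s with hS
        have hlen : S.reg .len = L := by
          have : ∀ K, (iter (fun i s => c.run L (s.setReg r i)) K s).reg .len = L := by
            intro K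
            induction K with
            | zero => exact hL
            | succ K ihK =>
              change (c.run L _).reg .len = L
              rw [run_reg_of_not_writes hc.2, State.setReg_reg, if_neg hc.1, ihK]
          exact this _
        have hrh : ∀ m : Memory, ∀ x r', 64 ≤ r' → (m.setReg r.num x).reg r' = m.reg r' := by
          intro m x r' h1
          have : r' ≠ r.num := by have := r.num_lt; omega
          simp [Memory.setReg, this]
        have hi : m.reg Var.len.num - m.reg h = L - (k + 1) := by rw [hR.reg, hlen, hk]
        have P₁ := hR.setReg r (L - (k + 1))
        obtain ⟨m₂, t₂, R₂, T₂, P₂, F₂⟩ := ih hc.2 P₁ (h := h + 2)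
          (by rw [State.setReg_reg, if_neg hc.1, hlen]) (by omega)
        have hnext : iter (fun i s => c.run L (s.setReg r i)) (L - k) s =
            c.run L (S.setReg r (L - (k + 1))) := by
          rw [show L - k = (L - (k + 1)) + 1 by omega]
          rfl
        set m₃ := (m₂.setReg (h + 1) 1) with hm₃
        set m₄ := m₃.setReg h (m₃.reg h - m₃.reg (h + 1)) with hm₄
        have f₄ : ∀ r < h, m₄.reg r = m₂.reg r := fun r hr => by
          rw [hm₄, m₃.setReg_reg_of_lt _ hr, hm₃, m₂.setReg_reg_of_lt _ (by omega)]
        obtain ⟨m₅, t₅, R₅, T₅, P₅, F₅⟩ := ihk (by omega) m₄ (by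
          rw [hm₄, m₃.setReg_reg_self, hm₃, m₂.setReg_reg_self, m₂.setReg_reg_of_lt _ (by omega),
            F₂ h hh (by omega), hrh m _ h hh, hk]
          rfl) (by
          rw [hnext]
          exact P₂.of_eq rfl fun r hr => f₄ r (by omega))
        refine ⟨m₅, _, .loop_step (by omega) (.seq (.sub m r.num Var.len.num h)
          (.seq (hi ▸ R₂) (.seq (.const m₂ (h + 1) 1) (.sub m₃ h h (h + 1))))) R₅, ?_, P₅,
          fun r' h1 h2 => ?_⟩
        · rw [Nat.add_mul]
          omega
        · rw [F₅ r' h1 h2, f₄ r' h2, F₂ r' h1 (by omega), hrh m _ r' h1]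
    have hlt := Var.num_lt
    obtain ⟨m', t, R, T, P, F⟩ := key L le_rfl (m.setReg h (m.reg Var.len.num))
      (by rw [m.setReg_reg_self, hm.reg, hL])
      (by rw [Nat.sub_self]
          exact hm.of_eq rfl fun r hr => m.setReg_reg_of_lt _ (by omega))
    refine ⟨m', _, .seq (.copy m h _) R, ?_, P, fun r' h1 h2 => ?_⟩
    · simp only [cost, Polynomial.eval_add, Polynomial.eval_mul, Polynomial.eval_X,
        Polynomial.eval_ofNat]
      omega
    · rw [F r' h1 h2, m.setReg_reg_of_lt _ h2]

/-- This depends on the order of the constructors: `len` and `input` come first, so they are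
register 0 and array 0. -/
theorem represents_init (w : List ℕ) : Represents (Memory.init w) (State.init w) := by
  refine ⟨fun r => ?_, fun a => ?_⟩
  · cases r <;> rfl
  · cases a <;> rfl

/-- The program for a command prints what the command prints, in polynomial time. -/
theorem prints_compile (c : Cmd) (hc : c.writes .len = false) (w : List ℕ) :
    ∃ t, (c.compile 64).Prints w (c.run w.length (State.init w)).print t ∧
      t ≤ c.cost.eval w.length := by
  obtain ⟨m, t, R, T, P, -⟩ := c.exists_runs (L := w.length) hc (represents_init w) rfl le_rfl
  refine ⟨t, ⟨m, R, ?_⟩, T⟩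
  -- `outLen` and `output` are the second constructors, so they have number 1, where the machine
  -- expects its output.
  have h1 : m.reg 1 = _ := P.reg .outLen
  have h2 : m.arr 1 = _ := P.arr .output
  rw [Memory.out, State.print, h1, h2]

end Cmd

theorem length_le_bitLength (w : List ℕ) : w.length ≤ bitLength w := by
  induction w with
  | nil => exact le_rfl
  | cons a w ih =>
    simp only [bitLength, List.map_cons, List.sum_cons, List.length_cons] at ih ⊢
    omega

theorem eval_mono_of_nat (q : Polynomial ℕ) {a b : ℕ} (h : a ≤ b) : q.eval a ≤ q.eval b := by
  simp only [Polynomial.eval_eq_sum, Polynomial.sum]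
  gcongr


/-! ### Affine forms and the reduction of a gate -/

theorem ZMod.two_cases (a : ZMod 2) : a = 0 ∨ a = 1 := by
  revert a; decide

/-- The linear part of an affine form in `n` variables is zero. The entry `n` of a form is its
constant term. -/
def LinZero (n : ℕ) (φ : ℕ → ZMod 2) : Prop := ∀ j < n, φ j = 0

instance (n : ℕ) (φ : ℕ → ZMod 2) : Decidable (LinZero n φ) :=
  inferInstanceAs (Decidable (∀ j < n, φ j = 0))

/-- What a gate `g` becomes when its arguments are the roots `u` and `v` (`0` for the constant zero,
`r + 1` for the wire `r`): `(0, ρ)` if it is, up to a constant, the root `ρ`, then `(1, 0)` if it is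
a sum of two affine roots, and `(2, 0)` otherwise. -/
def classify (g : ZMod 2 → ZMod 2 → ZMod 2) (u v : ℕ) (b : Bool) : ℕ × ℕ :=
  if u = v then (0, if g 0 0 = g 1 1 then 0 else u)
  else if v = 0 ∨ (g 0 0 = g 0 1 ∧ g 1 0 = g 1 1) then (0, if g 0 0 = g 1 0 then 0 else u)
  else if u = 0 ∨ (g 0 0 = g 1 0 ∧ g 0 1 = g 1 1) then (0, if g 0 0 = g 0 1 then 0 else v)
  else if b = true ∧ g 0 0 = g 1 1 ∧ g 0 1 = g 1 0 then (1, 0) else (2, 0)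

/-- A degenerate gate stays degenerate when its arguments are resolved further: if it was constant
it remains so, and if it followed one argument it follows the new root of that argument. Here `u'`,
`v'` are the new roots and `δ`, `ε` the constants picked up. This is a finite check over truth
tables, used for evaluation in `Net.sound` and for substitution in `Net.resolve`. -/
theorem classify_mono {g : ZMod 2 → ZMod 2 → ZMod 2} {u v u' v' : ℕ} {b : Bool} (b' : Bool)
    {δ ε : ZMod 2} (hu : u = 0 → u' = 0 ∧ δ = 0) (hv : v = 0 → v' = 0 ∧ ε = 0)
    (huv : u = v → u' = v' ∧ δ = ε) (h : (classify g u v b).1 = 0) :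
    (classify (fun s t => g (s + δ) (t + ε)) u' v' b').1 = 0 ∧
    ((classify g u v b).2 = 0 → (classify (fun s t => g (s + δ) (t + ε)) u' v' b').2 = 0 ∧
      g δ ε = g 0 0) ∧
    ((classify g u v b).2 ≠ 0 →
      ((classify g u v b).2 = u ∧
        (classify (fun s t => g (s + δ) (t + ε)) u' v' b').2 = u' ∧ g δ ε + g 0 0 = δ) ∨
      ((classify g u v b).2 = v ∧
        (classify (fun s t => g (s + δ) (t + ε)) u' v' b').2 = v' ∧ g δ ε + g 0 0 = ε)) := by
  have h11 : (1 : ZMod 2) + 1 = 0 := by decide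
  have h01 : (0 : ZMod 2) ≠ 1 := by decide
  rcases ZMod.two_cases δ with rfl | rfl <;> rcases ZMod.two_cases ε with rfl | rfl <;>
  rcases ZMod.two_cases (g 0 0) with h1 | h1 <;> rcases ZMod.two_cases (g 0 1) with h2 | h2 <;>
  rcases ZMod.two_cases (g 1 0) with h3 | h3 <;> rcases ZMod.two_cases (g 1 1) with h4 | h4 <;>
  simp only [classify, h1, h2, h3, h4, h11, add_zero, zero_add] at h hu hv huv ⊢ <;>
  grind


theorem classify_gate {g : ZMod 2 → ZMod 2 → ZMod 2} {u v : ℕ} {b : Bool}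
    (h : (classify g u v b).1 ≠ 0) :
    u ≠ 0 ∧ v ≠ 0 ∧ u ≠ v ∧ ¬(g 0 0 = g 0 1 ∧ g 1 0 = g 1 1) ∧
      ¬(g 0 0 = g 1 0 ∧ g 0 1 = g 1 1) ∧
      ((classify g u v b).1 = 1 ∧ b = true ∧ g 0 0 = g 1 1 ∧ g 0 1 = g 1 0 ∨
        (classify g u v b).1 = 2 ∧ ¬(b = true ∧ g 0 0 = g 1 1 ∧ g 0 1 = g 1 0)) := by
  unfold classify at h ⊢
  split_ifs at h ⊢ <;> grind

theorem classify_snd {g : ZMod 2 → ZMod 2 → ZMod 2} {u v : ℕ} {b : Bool} :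
    (classify g u v b).2 = 0 ∨ (classify g u v b).2 = u ∨ (classify g u v b).2 = v := by
  unfold classify
  grind

/-- Given the two symmetries, dependence on the second argument forces `g 0 1 ≠ g 0 0`, which leaves
only the sum and its negation. -/
theorem eq_add_of_sum {g : ZMod 2 → ZMod 2 → ZMod 2} (h : ¬(g 0 0 = g 0 1 ∧ g 1 0 = g 1 1))
    (h1 : g 0 0 = g 1 1) (h2 : g 0 1 = g 1 0) (s t : ZMod 2) : g s t = s + t + g 0 0 := by
  have h11 : (1 : ZMod 2) + 1 = 0 := by decide
  have h01 : (0 : ZMod 2) ≠ 1 := by decide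
  rcases ZMod.two_cases s with rfl | rfl <;> rcases ZMod.two_cases t with rfl | rfl <;>
  rcases ZMod.two_cases (g 0 0) with a | a <;> rcases ZMod.two_cases (g 0 1) with b | b <;>
  grind

/-- A sum of two affine roots after a substitution. -/
theorem classify_sum {g : ZMod 2 → ZMod 2 → ZMod 2} {c : ZMod 2} (hg : ∀ s t, g s t = s + t + c)
    (u v : ℕ) (b : Bool) :
    classify g u v b = if u = v then (0, 0) else if v = 0 then (0, u) else if u = 0 then (0, v)
      else if b then (1, 0) else (2, 0) := by
  have h11 : (1 : ZMod 2) + 1 = 0 := by decide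
  have h01 : (0 : ZMod 2) ≠ 1 := by decide
  have e1 : g 0 0 = c := by simp [hg]
  have e2 : g 0 1 = 1 + c := by simp [hg]
  have e3 : g 1 0 = 1 + c := by simp [hg]
  have e4 : g 1 1 = c := by simp [hg, h11]
  have e5 : c ≠ 1 + c := by rcases ZMod.two_cases c with rfl | rfl <;> decide
  unfold classify
  rw [e1, e2, e3, e4]
  grind

/-- An argument of a gate that is neither constant nor a sum can be fixed so that the gate becomes
constant. -/
theorem classify_fix {g : ZMod 2 → ZMod 2 → ZMod 2}
    (hl : ¬(g 0 0 = g 0 1 ∧ g 1 0 = g 1 1)) (hr : ¬(g 0 0 = g 1 0 ∧ g 0 1 = g 1 1))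
    (h : ¬(g 0 0 = g 1 1 ∧ g 0 1 = g 1 0)) :
    (∀ t, g (g 0 0 + g 0 1) t = g (g 0 0 + g 0 1) 0) ∧
      ∀ s, g s (g 0 0 + g 1 0) = g 0 (g 0 0 + g 1 0) := by
  -- Exactly one row of the truth table is constant: row 0 if `g 0 0 = g 0 1`, and row 1 otherwise.
  -- Its number is therefore `g 0 0 + g 0 1`; the same holds for columns.
  have h11 : (1 : ZMod 2) + 1 = 0 := by decide
  have h01 : (0 : ZMod 2) ≠ 1 := by decide
  rcases ZMod.two_cases (g 0 0) with a | a <;> rcases ZMod.two_cases (g 0 1) with b | b <;>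
  rcases ZMod.two_cases (g 1 0) with c | c <;> rcases ZMod.two_cases (g 1 1) with d | d <;>
  (constructor <;> intro t <;> rcases ZMod.two_cases t with rfl | rfl <;> simp_all)

theorem classify_left_const {g : ZMod 2 → ZMod 2 → ZMod 2} (h : ∀ t, g 0 t = g 0 0) (v : ℕ)
    (b : Bool) : (classify g 0 v b).1 = 0 ∧ (classify g 0 v b).2 = 0 := by
  have := h 1
  unfold classify
  grind

theorem classify_right_const {g : ZMod 2 → ZMod 2 → ZMod 2} (h : ∀ t, g t 0 = g 0 0) (u : ℕ)
    (b : Bool) : (classify g u 0 b).1 = 0 ∧ (classify g u 0 b).2 = 0 := by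
  have := h 1
  unfold classify
  grind

/-! ### Tables of a network -/

/-- A network of binary gates. The wires below `n` are variables, the others are gates. -/
structure Net where
  n : ℕ
  wires : ℕ
  out : ℕ
  fn : ℕ → ZMod 2 → ZMod 2 → ZMod 2
  l : ℕ → ℕ
  r : ℕ → ℕ
  out_lt : out < wires
  l_lt : ∀ w, n ≤ w → l w < w
  r_lt : ∀ w, n ≤ w → r w < w

/-- What is known about a wire on an affine subspace: the wire is the sum of the constant `sign`
and of the root (`0` for the constant zero, `r + 1` for the wire `r` taken without its sign). If the
wire is its own root, then it is either affine, with the given form, or live. The other fields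
describe a gate in terms of the roots `u` and `v` of its arguments; fixing the left one to `cl`, or
the right one to `cr`, makes a live gate with affine arguments constant. -/
structure Entry where
  root : ℕ
  sign : ZMod 2
  aff : Bool
  live : Bool
  u : ℕ
  v : ℕ
  cl : ZMod 2
  cr : ZMod 2
  form : ℕ → ZMod 2

namespace Net

/-- The entry of the wire `w`, from the classification of its gate. -/
def finish (n w kind ρ : ℕ) (c : ZMod 2) (φ : ℕ → ZMod 2) (u v : ℕ) (cl cr : ZMod 2) : Entry where
  root := if kind = 0 then ρ else if kind = 1 ∧ LinZero n φ then 0 else w + 1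
  sign := if kind = 1 ∧ LinZero n φ then c + φ n else c
  aff := kind = 1 ∧ ¬LinZero n φ
  live := kind = 2
  u := u
  v := v
  cl := cl
  cr := cr
  form := φ

/-- The gate `w` as a function of the roots of its arguments. -/
def gate (N : Net) (E : ℕ → Entry) (w : ℕ) (s t : ZMod 2) : ZMod 2 :=
  N.fn w (s + (E (N.l w)).sign) (t + (E (N.r w)).sign)

/-- The entry of the wire `w`, given the entries of the preceding wires. -/
def step (N : Net) (A : ℕ → ℕ → ZMod 2) (E : ℕ → Entry) (w : ℕ) : Entry :=
  if w < N.n then finish N.n w 1 0 0 (A w) 0 0 0 0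
  else
    let u := (E (N.l w)).root
    let v := (E (N.r w)).root
    let g := N.gate E w
    let c := classify g u v ((E (u - 1)).aff && (E (v - 1)).aff)
    finish N.n w c.1 c.2 (g 0 0) (fun j => (E (u - 1)).form j + (E (v - 1)).form j) u v
      (g 0 0 + g 0 1) (g 0 0 + g 1 0)

/-- The table with the entries of the first `k` wires. -/
def build (N : Net) (A : ℕ → ℕ → ZMod 2) : ℕ → ℕ → Entry
  | 0 => fun _ => finish 0 0 0 0 0 0 0 0 0 0
  | k + 1 => Function.update (build N A k) k (N.step A (build N A k) k)

/-- The table of all wires on the affine subspace in which the variable `i` has the form `A i`. -/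
def tab (N : Net) (A : ℕ → ℕ → ZMod 2) (w : ℕ) : Entry := N.build A (w + 1) w

variable {N : Net} {A : ℕ → ℕ → ZMod 2}

theorem build_of_lt {k w : ℕ} (h : w < k) : N.build A k w = N.tab A w := by
  induction k with
  | zero => omega
  | succ k ih =>
    rcases Nat.lt_succ_iff_lt_or_eq.mp h with h' | rfl
    · rw [build, Function.update_of_ne (by omega), ih h']
    · rfl

/-- A step looks only at the arguments of the gate and at their roots, all of which come before `w`.
-/
theorem step_congr {E E' : ℕ → Entry} {w : ℕ} (h : ∀ j < w, E j = E' j)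
    (hr : ∀ j < w, (E j).root ≤ j + 1) : N.step A E w = N.step A E' w := by
  unfold step
  split_ifs with hw
  · rfl
  · have hl := N.l_lt w (by omega)
    have hr' := N.r_lt w (by omega)
    have h1 := hr _ hl
    have h2 := hr _ hr'
    have e1 := h _ hl
    have e2 := h _ hr'
    have e3 := h ((E (N.l w)).root - 1) (by omega)
    have e4 := h ((E (N.r w)).root - 1) (by omega)
    rw [e1] at e3
    rw [e2] at e4
    have e5 : N.gate E w = N.gate E' w := by
      funext s t
      simp only [gate, e1, e2]
    simp only [e1, e2, e3, e4, e5]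

theorem tab_eq_build (w : ℕ) : N.tab A w = N.step A (N.build A w) w := by
  rw [tab, build, Function.update_self]

theorem root_le (w : ℕ) : (N.tab A w).root ≤ w + 1 := by
  induction w using Nat.strong_induction_on with
  | _ w ih =>
    rw [tab_eq_build, step]
    split_ifs with hw
    · simp only [finish]
      split_ifs <;> omega
    · have hl := N.l_lt w (by omega)
      have hr := N.r_lt w (by omega)
      have h1 := ih _ hl
      have h2 := ih _ hr
      simp only [finish, build_of_lt hl, build_of_lt hr]
      set c := classify _ _ _ _ with hc
      have : c.2 = 0 ∨ c.2 = (N.tab A (N.l w)).root ∨ c.2 = (N.tab A (N.r w)).root := classify_snd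
      split_ifs <;> omega

/-- The recursion equation that replaces the stagewise construction `build` in all later arguments.
-/
theorem tab_eq (w : ℕ) : N.tab A w = N.step A (N.tab A) w := by
  rw [tab_eq_build]
  refine step_congr (fun j hj => build_of_lt hj) fun j hj => ?_
  rw [build_of_lt hj]
  exact root_le j

end Net


/-! ### Structure of the table entries and their soundness. -/

namespace Net

variable {N : Net} {A : ℕ → ℕ → ZMod 2}

/-- The classification of the gate `w`. -/
def cls (N : Net) (A : ℕ → ℕ → ZMod 2) (w : ℕ) : ℕ × ℕ :=
  classify (N.gate (N.tab A) w) (N.tab A (N.l w)).root (N.tab A (N.r w)).root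
    ((N.tab A ((N.tab A (N.l w)).root - 1)).aff && (N.tab A ((N.tab A (N.r w)).root - 1)).aff)

theorem tab_var {w : ℕ} (hw : w < N.n) : N.tab A w = finish N.n w 1 0 0 (A w) 0 0 0 0 := by
  rw [tab_eq, step, if_pos hw]

theorem tab_gate {w : ℕ} (hw : N.n ≤ w) :
    N.tab A w = finish N.n w (N.cls A w).1 (N.cls A w).2 (N.gate (N.tab A) w 0 0)
      (fun j => (N.tab A ((N.tab A (N.l w)).root - 1)).form j +
        (N.tab A ((N.tab A (N.r w)).root - 1)).form j)
      (N.tab A (N.l w)).root (N.tab A (N.r w)).root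
      (N.gate (N.tab A) w 0 0 + N.gate (N.tab A) w 0 1)
      (N.gate (N.tab A) w 0 0 + N.gate (N.tab A) w 1 0) := by
  rw [tab_eq, step, if_neg (by omega)]
  rfl

theorem cls_snd (w : ℕ) : (N.cls A w).2 = 0 ∨ (N.cls A w).2 = (N.tab A (N.l w)).root ∨
    (N.cls A w).2 = (N.tab A (N.r w)).root :=
  classify_snd

theorem root_gate_cases {w : ℕ} (hw : N.n ≤ w) :
    (N.tab A w).root = 0 ∨ (N.tab A w).root = w + 1 ∨
      (N.tab A w).root = (N.tab A (N.l w)).root ∨ (N.tab A w).root = (N.tab A (N.r w)).root := by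
  have h := N.cls_snd (A := A) w
  rw [tab_gate hw]
  simp only [finish]
  split_ifs <;> omega

/-- A wire that is not its own root inherits the root of an argument, and this descent can end in `r
+ 1` only at the wire `r` itself. -/
theorem root_root {w r : ℕ} (h : (N.tab A w).root = r + 1) : (N.tab A r).root = r + 1 := by
  induction w using Nat.strong_induction_on with
  | _ w ih =>
    rcases lt_or_ge w N.n with hw | hw
    · have : (N.tab A w).root = 0 ∨ (N.tab A w).root = w + 1 := by
        rw [tab_var hw]
        simp only [finish]
        split_ifs <;> omega
      obtain rfl : w = r := by omega
      exact h
    · rcases root_gate_cases (A := A) hw with h' | h' | h' | h'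
      · omega
      · obtain rfl : w = r := by omega
        exact h
      · exact ih _ (N.l_lt w hw) (h' ▸ h)
      · exact ih _ (N.r_lt w hw) (h' ▸ h)

/-- A degenerate gate has root zero or that of an argument, and the root of an argument is at most
`w` in this numbering. -/
theorem cls_of_own {w : ℕ} (hw : N.n ≤ w) (h : (N.tab A w).root = w + 1) :
    (N.cls A w).1 ≠ 0 := by
  intro h0
  have h1 := N.cls_snd (A := A) w
  have h2 := root_le (N := N) (A := A) (N.l w)
  have h3 := root_le (N := N) (A := A) (N.r w)
  have h4 := N.l_lt w hw
  have h5 := N.r_lt w hw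
  rw [tab_gate hw] at h
  simp only [finish, h0, if_true] at h
  omega

theorem aff_iff {w : ℕ} : (N.tab A w).aff = true ↔
    (w < N.n ∨ (N.cls A w).1 = 1) ∧ ¬LinZero N.n (N.tab A w).form := by
  rcases lt_or_ge w N.n with hw | hw
  · rw [tab_var hw]
    simp [finish, hw]
  · rw [tab_gate hw]
    simp [finish, not_lt.mpr hw]

theorem live_iff {w : ℕ} : (N.tab A w).live = true ↔ N.n ≤ w ∧ (N.cls A w).1 = 2 := by
  rcases lt_or_ge w N.n with hw | hw
  · rw [tab_var hw]
    simp [finish, hw]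
  · rw [tab_gate hw]
    simp [finish, hw]

theorem root_of_live {w : ℕ} (h : (N.tab A w).live = true) : (N.tab A w).root = w + 1 := by
  obtain ⟨hw, h2⟩ := live_iff.mp h
  rw [tab_gate hw]
  simp [finish, h2]

theorem aff_or_live {w : ℕ} (h : (N.tab A w).root = w + 1) :
    (N.tab A w).aff = true ∨ (N.tab A w).live = true := by
  rcases lt_or_ge w N.n with hw | hw
  · rw [tab_var hw] at h ⊢
    simp_all [finish]
  · have h0 := cls_of_own hw h
    have h1 : (N.cls A w).1 = 1 ∨ (N.cls A w).1 = 2 := by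
      rcases (classify_gate h0).2.2.2.2.2 with h | h
      · exact .inl h.1
      · exact .inr h.1
    rw [tab_gate hw] at h ⊢
    rcases h1 with h1 | h1 <;> simp_all [finish]

theorem not_live_of_aff {w : ℕ} (h : (N.tab A w).aff = true) : ¬(N.tab A w).live = true := by
  intro h'
  have h1 := aff_iff.mp h
  have h2 := live_iff.mp h'
  omega

/-- The arguments of a gate that is its own root have distinct nonconstant roots, and the gate
depends on both. -/
theorem own_gate {w : ℕ} (hw : N.n ≤ w) (h : (N.tab A w).root = w + 1) :
    ∃ x y, (N.tab A (N.l w)).root = x + 1 ∧ (N.tab A (N.r w)).root = y + 1 ∧ x ≠ y ∧ x < w ∧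
      y < w := by
  obtain ⟨hu, hv, huv, -⟩ := classify_gate (cls_of_own hw h)
  obtain ⟨x, hx⟩ := Nat.exists_eq_succ_of_ne_zero hu
  obtain ⟨y, hy⟩ := Nat.exists_eq_succ_of_ne_zero hv
  have h2 := root_le (N := N) (A := A) (N.l w)
  have h3 := root_le (N := N) (A := A) (N.r w)
  have h4 := N.l_lt w hw
  have h5 := N.r_lt w hw
  exact ⟨x, y, hx, hy, by omega, by omega, by omega⟩

/-- What `own_gate` says about a gate that is affine. -/
theorem sum_gate {w : ℕ} (h : (N.cls A w).1 = 1) :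
    ∃ x y, (N.tab A (N.l w)).root = x + 1 ∧ (N.tab A (N.r w)).root = y + 1 ∧ x ≠ y ∧
      (N.tab A x).aff = true ∧ (N.tab A y).aff = true ∧
      ∀ s t, N.gate (N.tab A) w s t = s + t + N.gate (N.tab A) w 0 0 := by
  obtain ⟨hu, hv, huv, hg, -, ⟨-, hb, h1, h2⟩ | ⟨h', -⟩⟩ :=
    classify_gate (show (N.cls A w).1 ≠ 0 by omega)
  · obtain ⟨x, hx⟩ := Nat.exists_eq_succ_of_ne_zero hu
    obtain ⟨y, hy⟩ := Nat.exists_eq_succ_of_ne_zero hv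
    rw [hx, hy, Bool.and_eq_true] at hb
    exact ⟨x, y, hx, hy, by omega, hb.1, hb.2, eq_add_of_sum hg h1 h2⟩
  · exact absurd h' (by rw [show classify _ _ _ _ = N.cls A w from rfl, h]; decide)

theorem var_const {w : ℕ} (hw : w < N.n) (hz : LinZero N.n (A w)) :
    (N.tab A w).root = 0 ∧ (N.tab A w).sign = A w N.n ∧ (N.tab A w).aff = false := by
  rw [tab_var hw]
  simp [finish, hz]

theorem var_own {w : ℕ} (hw : w < N.n) (hz : ¬LinZero N.n (A w)) :
    (N.tab A w).root = w + 1 ∧ (N.tab A w).sign = 0 ∧ (N.tab A w).form = A w := by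
  rw [tab_var hw]
  simp [finish, hz]

theorem gate_degenerate {w : ℕ} (hw : N.n ≤ w) (hk : (N.cls A w).1 = 0) :
    (N.tab A w).root = (N.cls A w).2 ∧ (N.tab A w).sign = N.gate (N.tab A) w 0 0 ∧
      (N.tab A w).aff = false := by
  rw [tab_gate hw]
  simp [finish, hk]

theorem sum_const {w : ℕ} (hw : N.n ≤ w) (hk : (N.cls A w).1 = 1)
    (hz : LinZero N.n (N.tab A w).form) :
    (N.tab A w).root = 0 ∧ (N.tab A w).aff = false ∧
      (N.tab A w).sign = N.gate (N.tab A) w 0 0 + (N.tab A w).form N.n := by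
  rw [tab_gate hw] at hz ⊢
  simp only [finish] at hz ⊢
  simp [hk, hz]

theorem sum_own {w : ℕ} (hw : N.n ≤ w) (hk : (N.cls A w).1 = 1)
    (hz : ¬LinZero N.n (N.tab A w).form) :
    (N.tab A w).root = w + 1 ∧ (N.tab A w).sign = N.gate (N.tab A) w 0 0 := by
  rw [tab_gate hw] at hz ⊢
  simp only [finish] at hz ⊢
  simp [hk, hz]

theorem form_gate {w x y : ℕ} (hw : N.n ≤ w) (hx : (N.tab A (N.l w)).root = x + 1)
    (hy : (N.tab A (N.r w)).root = y + 1) :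
    (N.tab A w).form = fun j => (N.tab A x).form j + (N.tab A y).form j := by
  rw [tab_gate hw]
  simp only [finish, hx, hy, Nat.add_sub_cancel]

/-! ### Soundness -/

/-- The value of an affine form. -/
def value (n : ℕ) (φ y : ℕ → ZMod 2) : ZMod 2 := ∑ j ∈ Finset.range n, φ j * y j + φ n

theorem value_add (n : ℕ) (φ ψ y : ℕ → ZMod 2) :
    value n (fun j => φ j + ψ j) y = value n φ y + value n ψ y := by
  simp only [value, add_mul, Finset.sum_add_distrib]
  ring

theorem value_of_linZero {n : ℕ} {φ : ℕ → ZMod 2} (h : LinZero n φ) (y : ℕ → ZMod 2) :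
    value n φ y = φ n := by
  rw [value, Finset.sum_eq_zero, zero_add]
  intro j hj
  rw [h j (Finset.mem_range.mp hj), zero_mul]

/-- The link between the table and the circuit: `W` lists wire values at the point with coordinates
`y`. The value of the root `r` without its sign is `W r + sign r`, and the three clauses are proved
together along the topological order. -/
theorem sound {W y : ℕ → ZMod 2} (hvar : ∀ i < N.n, W i = value N.n (A i) y)
    (hgate : ∀ w, N.n ≤ w → w < N.wires → W w = N.fn w (W (N.l w)) (W (N.r w))) {w : ℕ}
    (hw : w < N.wires) :
    ((N.tab A w).root = 0 → W w = (N.tab A w).sign) ∧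
    (∀ r, (N.tab A w).root = r + 1 →
      W w + (N.tab A w).sign = W r + (N.tab A r).sign) ∧
    ((N.tab A w).aff = true → W w + (N.tab A w).sign = value N.n (N.tab A w).form y) := by
  have two : ∀ a : ZMod 2, a + a = 0 := by decide
  have cancel : ∀ a b : ZMod 2, a + b + b = a := by decide
  induction w using Nat.strong_induction_on with
  | _ w ih =>
    have own : ∀ c r, (N.tab A w).root = c → c = 0 ∨ c = w + 1 → c = r + 1 →
        W w + (N.tab A w).sign = W r + (N.tab A r).sign := by
      intro c r h1 h2 h3
      obtain rfl : w = r := by omega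
      rfl
    rcases lt_or_ge w N.n with hwn | hwn
    · have hv := hvar w hwn
      by_cases hz : LinZero N.n (A w)
      · have e := var_const hwn hz
        rw [value_of_linZero hz] at hv
        refine ⟨fun _ => by rw [hv, e.2.1], fun r hr => by omega, fun h => ?_⟩
        rw [e.2.2] at h
        cases h
      · have e := var_own hwn hz
        exact ⟨fun h => by omega, fun r hr => own _ r rfl (by omega) hr,
          fun _ => by rw [e.2.1, e.2.2, hv, add_zero]⟩
    · have hl := N.l_lt w hwn
      have hr := N.r_lt w hwn
      obtain ⟨l0, l1, -⟩ := ih _ hl (by omega)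
      obtain ⟨r0, r1, -⟩ := ih _ hr (by omega)
      set δ := W (N.l w) + (N.tab A (N.l w)).sign with hδ
      set ε := W (N.r w) + (N.tab A (N.r w)).sign with hε
      have hW : W w = N.gate (N.tab A) w δ ε := by
        rw [hgate w hwn hw, gate, hδ, hε, cancel, cancel]
      by_cases hk : (N.cls A w).1 = 0
      · have e := gate_degenerate hwn hk
        -- Evaluation is treated as a substitution that turns both roots into constants; `δ` and `ε`
        -- are then the values of the roots.
        obtain ⟨-, c0, c1⟩ := classify_mono (u' := 0) (v' := 0) false (δ := δ) (ε := ε)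
          (fun h => ⟨rfl, by rw [hδ, l0 h, two]⟩) (fun h => ⟨rfl, by rw [hε, r0 h, two]⟩)
          (fun h => ⟨rfl, by
            rcases Nat.eq_zero_or_pos (N.tab A (N.l w)).root with h0 | h0
            · rw [hδ, hε, l0 h0, r0 (h ▸ h0), two, two]
            · obtain ⟨k, hk⟩ := Nat.exists_eq_succ_of_ne_zero h0.ne'
              rw [l1 k hk, r1 k (h ▸ hk)]⟩) hk
        rw [show classify _ _ _ _ = N.cls A w from rfl] at c0 c1
        rw [e.1, e.2.1, e.2.2, hW]
        refine ⟨fun h => (c0 h).2, fun r hr => ?_, fun h => by cases h⟩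
        rcases c1 (by omega) with ⟨h1, -, h2⟩ | ⟨h1, -, h2⟩
        · rw [h2, l1 r (by omega)]
        · rw [h2, r1 r (by omega)]
      · by_cases hk1 : (N.cls A w).1 = 1
        · obtain ⟨x, y', hx, hy, hxy, ax, ay, hsum⟩ := sum_gate hk1
          have hxw := root_le (N := N) (A := A) (N.l w)
          have hyw := root_le (N := N) (A := A) (N.r w)
          have vx := (ih x (by omega) (by omega)).2.2 ax
          have vy := (ih y' (by omega) (by omega)).2.2 ay
          rw [← l1 x hx] at vx
          rw [← r1 y' hy] at vy
          have hWw : W w + N.gate (N.tab A) w 0 0 =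
              value N.n (fun j => (N.tab A x).form j + (N.tab A y').form j) y := by
            rw [hW, hsum, value_add, vx, vy, cancel]
          rw [← form_gate hwn hx hy] at hWw
          by_cases hz : LinZero N.n (N.tab A w).form
          · have e := sum_const hwn hk1 hz
            rw [value_of_linZero hz] at hWw
            refine ⟨fun _ => ?_, fun r hr => by omega, fun h => ?_⟩
            · rw [e.2.2, ← hWw, add_comm (W w), ← add_assoc, two, zero_add]
            · rw [e.2.1] at h
              cases h
          · have e := sum_own hwn hk1 hz
            exact ⟨fun h => by omega, fun r hr => own _ r rfl (by omega) hr,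
              fun _ => by rw [e.2, hWw]⟩
        · have e : (N.tab A w).root = w + 1 := by
            rw [tab_gate hwn]
            simp [finish, hk, hk1]
          refine ⟨fun h => by omega, fun r hr => own _ r rfl (by omega) hr, fun h => ?_⟩
          have := (aff_iff.mp h).1
          omega

end Net


/-! ### The effect of an affine substitution on the table. -/

namespace Net

variable {N : Net} {A A' : ℕ → ℕ → ZMod 2}

/-- The substitution that eliminates the coordinate `p` by means of the equation `ψ = 0`. -/
def elim (p : ℕ) (ψ φ : ℕ → ZMod 2) (j : ℕ) : ZMod 2 := φ j + φ p * ψ j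

/-- The form `φ` is the sum of the root `ρ` and of the constant `δ`. -/
def Represented (N : Net) (A : ℕ → ℕ → ZMod 2) (φ : ℕ → ZMod 2) (ρ : ℕ) (δ : ZMod 2) : Prop :=
  (ρ = 0 ∧ LinZero N.n φ ∧ φ N.n = δ) ∨
    ∃ r, ρ = r + 1 ∧ (N.tab A r).aff = true ∧ (∀ j < N.n, φ j = (N.tab A r).form j) ∧
      φ N.n = (N.tab A r).form N.n + δ

theorem Represented.congr {φ χ : ℕ → ZMod 2} {ρ : ℕ} {δ : ZMod 2} (h : N.Represented A φ ρ δ)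
    (e : ∀ j ≤ N.n, φ j = χ j) : N.Represented A χ ρ δ := by
  rcases h with ⟨h1, h2, h3⟩ | ⟨r, h1, h2, h3, h4⟩
  · exact .inl ⟨h1, fun j hj => by rw [← e j hj.le, h2 j hj], by rw [← e _ le_rfl, h3]⟩
  · exact .inr ⟨r, h1, h2, fun j hj => by rw [← e j hj.le, h3 j hj], by rw [← e _ le_rfl, h4]⟩

/-- A represented form with zero linear part is represented by a constant. -/
theorem Represented.of_linZero {φ : ℕ → ZMod 2} {ρ : ℕ} {δ : ZMod 2}
    (h : N.Represented A φ ρ δ) (hφ : LinZero N.n φ) : ρ = 0 ∧ φ N.n = δ := by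
  rcases h with ⟨h1, h2, h3⟩ | ⟨r, h1, h2, h3, h4⟩
  · exact ⟨h1, h3⟩
  · exact absurd (fun j hj => by rw [← h3 j hj, hφ j hj]) (aff_iff.mp h2).2

/-- The cases follow `classify_sum`: two constants, one constant on either side, equal roots, which
cancel, and distinct affine roots, which give a new affine root unless the linear parts of their
forms cancel. The constant `c` of the gate before the substitution is kept apart from the shifts `δ`
and `ε`, as `resolve` needs it. -/
theorem represented_sum {w : ℕ} (hw : N.n ≤ w) {φ χ : ℕ → ZMod 2} {δ ε c : ZMod 2}
    (hφ : N.Represented A φ (N.tab A (N.l w)).root δ)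
    (hχ : N.Represented A χ (N.tab A (N.r w)).root ε)
    (hg : ∀ s t, N.gate (N.tab A) w s t = s + t + (c + δ + ε)) :
    N.Represented A (fun j => φ j + χ j) (N.tab A w).root ((N.tab A w).sign + c) := by
  have two : ∀ a : ZMod 2, a + a = 0 := by decide
  have e1 : ∀ a b c : ZMod 2, a + b = c + a + b + c := by decide
  have e2 : ∀ a b c f : ZMod 2, f + a + b = f + (c + a + b + c) := by decide
  have e3 : ∀ a b c f : ZMod 2, a + (f + b) = f + (c + a + b + c) := by decide
  have e4 : ∀ a b c f : ZMod 2, f + a + (f + b) = c + a + b + c := by decide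
  have e5 : ∀ a b c f f' : ZMod 2, f + a + (f' + b) = c + a + b + (f + f') + c := by decide
  have e6 : ∀ a b c f f' : ZMod 2, f + a + (f' + b) = f + f' + (c + a + b + c) := by decide
  have hg0 : N.gate (N.tab A) w 0 0 = c + δ + ε := by rw [hg, add_zero, zero_add]
  have hcls := classify_sum hg (N.tab A (N.l w)).root (N.tab A (N.r w)).root
    ((N.tab A ((N.tab A (N.l w)).root - 1)).aff && (N.tab A ((N.tab A (N.r w)).root - 1)).aff)
  change N.cls A w = _ at hcls
  have deg : ∀ ρ, N.cls A w = (0, ρ) →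
      (N.tab A w).root = ρ ∧ (N.tab A w).sign = c + δ + ε := by
    intro ρ h
    have := gate_degenerate hw (A := A) (by rw [h])
    rw [this.1, this.2.1, h, hg0]
    exact ⟨rfl, rfl⟩
  rcases hφ with ⟨u1, u2, u3⟩ | ⟨r, u1, u2, u3, u4⟩ <;>
  rcases hχ with ⟨v1, v2, v3⟩ | ⟨s, v1, v2, v3, v4⟩ <;> rw [u1, v1] at hcls
  · obtain ⟨h1, h2⟩ := deg 0 (by simpa using hcls)
    exact .inl ⟨h1, fun j hj => by simp only [u2 j hj, v2 j hj, add_zero],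
      by simp only [h2, u3, v3]; exact e1 _ _ _⟩
  · obtain ⟨h1, h2⟩ := deg (s + 1) (by simpa using hcls)
    exact .inr ⟨s, h1, v2, fun j hj => by simp only [u2 j hj, v3 j hj, zero_add],
      by simp only [h2, u3, v4]; exact e3 _ _ _ _⟩
  · obtain ⟨h1, h2⟩ := deg (r + 1) (by simpa using hcls)
    exact .inr ⟨r, h1, u2, fun j hj => by simp only [v2 j hj, u3 j hj, add_zero],
      by simp only [h2, v3, u4]; exact e2 _ _ _ _⟩
  · by_cases hrs : r = s
    · subst hrs
      obtain ⟨h1, h2⟩ := deg 0 (by simpa using hcls)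
      exact .inl ⟨h1, fun j hj => by simp only [u3 j hj, v3 j hj, two],
        by simp only [h2, u4, v4]; exact e4 _ _ _ _⟩
    · have hk : (N.cls A w).1 = 1 := by
        rw [hcls]
        simp [hrs, u2, v2]
      have hf := form_gate hw u1 v1
      by_cases hz : LinZero N.n (N.tab A w).form
      · obtain ⟨h1, -, h2⟩ := sum_const hw hk hz
        rw [hf] at h2 hz
        exact .inl ⟨h1, fun j hj => by simpa only [u3 j hj, v3 j hj] using hz j hj,
          by simp only [h2, u4, v4, hg0]; exact e5 _ _ _ _ _⟩
      · obtain ⟨h1, h2⟩ := sum_own hw hk hz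
        exact .inr ⟨w, h1, aff_iff.mpr ⟨.inr hk, hz⟩,
          fun j hj => by simp only [hf, u3 j hj, v3 j hj],
          by simp only [h2, hf, u4, v4, hg0]; exact e6 _ _ _ _ _⟩

/-- The table after a substitution arises from the table before it by resolving the roots. -/
theorem resolve {p : ℕ} {ψ : ℕ → ZMod 2} (hp : p < N.n)
    (hA : ∀ i < N.n, ∀ j ≤ N.n, A' i j = elim p ψ (A i) j) (w : ℕ) :
    ((N.tab A w).root = 0 → (N.tab A' w).root = 0 ∧ (N.tab A' w).sign + (N.tab A w).sign = 0) ∧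
    (∀ r, (N.tab A w).root = r + 1 → (N.tab A' w).root = (N.tab A' r).root ∧
      (N.tab A' w).sign + (N.tab A w).sign = (N.tab A' r).sign + (N.tab A r).sign) ∧
    ((N.tab A w).aff = true → N.Represented A' (elim p ψ (N.tab A w).form) (N.tab A' w).root
      ((N.tab A' w).sign + (N.tab A w).sign)) := by
  have two : ∀ a : ZMod 2, a + a = 0 := by decide
  have e1 : ∀ s a b : ZMod 2, s + a = s + (a + b) + b := by decide
  induction w using Nat.strong_induction_on with
  | _ w ih =>
    have own : (N.tab A w).root = w + 1 → ∀ r, (N.tab A w).root = r + 1 →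
        (N.tab A' w).root = (N.tab A' r).root ∧
        (N.tab A' w).sign + (N.tab A w).sign = (N.tab A' r).sign + (N.tab A r).sign := by
      intro h1 r h2
      obtain rfl : w = r := by omega
      exact ⟨rfl, rfl⟩
    have elim_zero : ∀ φ, LinZero N.n φ → ∀ j, elim p ψ φ j = φ j := by
      intro φ h j
      rw [elim, h p hp, zero_mul, add_zero]
    rcases lt_or_ge w N.n with hwn | hwn
    · by_cases hz : LinZero N.n (A w)
      · have e := var_const hwn hz
        have hz' : LinZero N.n (A' w) := fun j hj => by
          rw [hA w hwn j hj.le, elim_zero _ hz, hz j hj]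
        have e' := var_const hwn hz'
        refine ⟨fun _ => ⟨e'.1, ?_⟩, fun r hr => by omega, fun h => ?_⟩
        · rw [e.2.1, e'.2.1, hA w hwn _ le_rfl, elim_zero _ hz, two]
        · rw [e.2.2] at h
          cases h
      · have e := var_own hwn hz
        refine ⟨fun h => by omega, own e.1, fun _ => ?_⟩
        rw [e.2.1, e.2.2]
        by_cases hz' : LinZero N.n (A' w)
        · have e' := var_const hwn hz'
          exact .inl ⟨e'.1, fun j hj => by rw [← hA w hwn j hj.le, hz' j hj],
            by rw [← hA w hwn _ le_rfl, e'.2.1, add_zero]⟩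
        · have e' := var_own hwn hz'
          exact .inr ⟨w, e'.1, aff_iff.mpr ⟨.inl hwn, by rwa [e'.2.2]⟩,
            fun j hj => by rw [e'.2.2, hA w hwn j hj.le],
            by rw [e'.2.2, hA w hwn _ le_rfl, e'.2.1, add_zero, add_zero]⟩
    · have hl := N.l_lt w hwn
      have hr := N.r_lt w hwn
      obtain ⟨l0, l1, -⟩ := ih _ hl
      obtain ⟨r0, r1, -⟩ := ih _ hr
      set δ := (N.tab A' (N.l w)).sign + (N.tab A (N.l w)).sign with hδ
      set ε := (N.tab A' (N.r w)).sign + (N.tab A (N.r w)).sign with hε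
      -- The circuit itself does not change, so the normalised gate changes only through the signs
      -- of its arguments.
      have hgate : N.gate (N.tab A') w = fun s t => N.gate (N.tab A) w (s + δ) (t + ε) := by
        funext s t
        rw [gate, gate, hδ, hε, ← e1, ← e1]
      have hcls : N.cls A' w = classify (fun s t => N.gate (N.tab A) w (s + δ) (t + ε))
          (N.tab A' (N.l w)).root (N.tab A' (N.r w)).root
          ((N.tab A' ((N.tab A' (N.l w)).root - 1)).aff &&
            (N.tab A' ((N.tab A' (N.r w)).root - 1)).aff) := by
        rw [cls, hgate]
      by_cases hk : (N.cls A w).1 = 0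
      · have e := gate_degenerate hwn hk
        obtain ⟨k0, c0, c1⟩ := classify_mono
          ((N.tab A' ((N.tab A' (N.l w)).root - 1)).aff &&
            (N.tab A' ((N.tab A' (N.r w)).root - 1)).aff) (δ := δ) (ε := ε) l0 r0
          (fun h => by
            rcases Nat.eq_zero_or_pos (N.tab A (N.l w)).root with h0 | h0
            · rw [(l0 h0).1, (l0 h0).2, (r0 (h ▸ h0)).1, (r0 (h ▸ h0)).2]
              exact ⟨rfl, rfl⟩
            · obtain ⟨k, hk⟩ := Nat.exists_eq_succ_of_ne_zero h0.ne'
              rw [(l1 k hk).1, (l1 k hk).2, (r1 k (h ▸ hk)).1, (r1 k (h ▸ hk)).2]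
              exact ⟨rfl, rfl⟩) hk
        rw [← hcls] at k0 c0 c1
        rw [show classify _ _ _ _ = N.cls A w from rfl] at c0 c1
        have e' := gate_degenerate hwn k0
        rw [e.1, e.2.1, e.2.2, e'.1, e'.2.1]
        simp only [hgate, zero_add]
        refine ⟨fun h => ⟨(c0 h).1, by rw [(c0 h).2, two]⟩, fun r hr => ?_, fun h => by cases h⟩
        rcases c1 (by omega) with ⟨h1, h2, h3⟩ | ⟨h1, h2, h3⟩
        · rw [h2, h3]
          exact l1 r (by omega)
        · rw [h2, h3]
          exact r1 r (by omega)
      · by_cases hk1 : (N.cls A w).1 = 1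
        · obtain ⟨x, y, hx, hy, hxy, ax, ay, hsum⟩ := sum_gate hk1
          have hxw := root_le (N := N) (A := A) (N.l w)
          have hyw := root_le (N := N) (A := A) (N.r w)
          have vx := (ih x (by omega)).2.2 ax
          have vy := (ih y (by omega)).2.2 ay
          rw [← (l1 x hx).1, ← (l1 x hx).2] at vx
          rw [← (r1 y hy).1, ← (r1 y hy).2] at vy
          have hR := represented_sum hwn vx vy (c := N.gate (N.tab A) w 0 0) (fun s t => by
            rw [hgate]
            simp only
            rw [hsum]
            ring)
          -- Substitution is additive in the form, so the sum of the two substituted forms is the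
          -- substituted form of `w`.
          replace hR : N.Represented A' (elim p ψ (N.tab A w).form) (N.tab A' w).root
              ((N.tab A' w).sign + N.gate (N.tab A) w 0 0) :=
            hR.congr fun j _ => by
              rw [form_gate hwn hx hy]
              simp only [elim]
              ring
          by_cases hz : LinZero N.n (N.tab A w).form
          · have e := sum_const hwn hk1 hz
            obtain ⟨h1, h2⟩ := (hR.congr fun j _ => elim_zero _ hz j).of_linZero hz
            refine ⟨fun _ => ⟨h1, ?_⟩, fun r hr => by omega, fun h => ?_⟩
            · rw [e.2.2, ← add_assoc, ← h2, two]
            · rw [e.2.1] at h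
              cases h
          · have e := sum_own hwn hk1 hz
            exact ⟨fun h => by omega, own e.1, fun _ => by rwa [e.2]⟩
        · have e : (N.tab A w).root = w + 1 := by
            rw [tab_gate hwn]
            simp [finish, hk, hk1]
          refine ⟨fun h => by omega, own e, fun h => ?_⟩
          have := (aff_iff.mp h).1
          omega

end Net


/-! ### Used roots and how many of them a substitution saves. -/

namespace Net

variable {N : Net} {A A' : ℕ → ℕ → ZMod 2}

/-- The live gate `w` reads the root `c`. -/
def Reads (N : Net) (A : ℕ → ℕ → ZMod 2) (w c : ℕ) : Prop :=
  (N.tab A w).live = true ∧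
    ((N.tab A (N.l w)).root = c + 1 ∨ (N.tab A (N.r w)).root = c + 1)

/-- The roots on which the output depends. -/
inductive Used (N : Net) (A : ℕ → ℕ → ZMod 2) : ℕ → Prop
  | out {c : ℕ} : (N.tab A N.out).root = c + 1 → Used N A c
  | reads {w c : ℕ} : Used N A w → N.Reads A w c → Used N A c

/-- The set of roots on which the output depends. -/
noncomputable def used (N : Net) (A : ℕ → ℕ → ZMod 2) : Finset ℕ :=
  open Classical in (Finset.range N.wires).filter (N.Used A)

theorem Reads.lt {w c : ℕ} (h : N.Reads A w c) : c < w := by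
  obtain ⟨hw, -⟩ := live_iff.mp h.1
  have h1 := N.l_lt w hw
  have h2 := N.r_lt w hw
  have h3 := root_le (N := N) (A := A) (N.l w)
  have h4 := root_le (N := N) (A := A) (N.r w)
  rcases h.2 with h | h <;> omega

theorem Reads.root {w c : ℕ} (h : N.Reads A w c) : (N.tab A c).root = c + 1 := by
  rcases h.2 with h | h <;> exact root_root h

theorem Used.root {w : ℕ} (h : N.Used A w) : (N.tab A w).root = w + 1 := by
  cases h with
  | out h => exact root_root h
  | reads _ h => exact h.root

theorem Used.le_out {w : ℕ} (h : N.Used A w) : w ≤ N.out := by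
  induction h with
  | out h =>
    have := root_le (N := N) (A := A) N.out
    omega
  | reads _ h ih => exact h.lt.le.trans ih

theorem mem_used {w : ℕ} : w ∈ N.used A ↔ N.Used A w := by
  simp only [used, Finset.mem_filter, Finset.mem_range, and_iff_right_iff_imp]
  exact fun h => h.le_out.trans_lt N.out_lt

/-- A used root is the output or read by a used gate. -/
theorem Used.cases_out {w : ℕ} (h : N.Used A w) :
    (N.tab A N.out).root = w + 1 ∨ ∃ b, N.Used A b ∧ N.Reads A b w := by
  cases h with
  | out h => exact .inl h
  | reads h h' => exact .inr ⟨_, h, h'⟩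

/-- Affine roots read nothing, so the backward walk from an affine output stops at once. -/
theorem Used.eq_of_aff {o w : ℕ} (ho : (N.tab A N.out).root = o + 1)
    (ha : (N.tab A o).aff = true) (h : N.Used A w) : w = o := by
  induction h with
  | out h => omega
  | reads _ h ih => exact absurd h.1 (not_live_of_aff (ih ▸ ha))

/-- A used live gate whose live descendants are exhausted reads two affine roots. -/
theorem Used.aff_of_reads {w c : ℕ} (hw : N.Used A w) (hr : N.Reads A w c)
    (hmin : ∀ b < w, N.Used A b → ¬(N.tab A b).live = true) : (N.tab A c).aff = true :=
  (aff_or_live hr.root).resolve_right (hmin c hr.lt (hw.reads hr))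

theorem Reads.root_cases {w : ℕ} (h : (N.tab A w).live = true) :
    ∃ x y, (N.tab A (N.l w)).root = x + 1 ∧ (N.tab A (N.r w)).root = y + 1 ∧ x ≠ y ∧
      N.Reads A w x ∧ N.Reads A w y := by
  obtain ⟨x, y, hx, hy, hxy, -⟩ := own_gate (live_iff.mp h).1 (root_of_live h)
  exact ⟨x, y, hx, hy, hxy, ⟨h, .inl hx⟩, ⟨h, .inr hy⟩⟩

/-- The table `A'` refines the table `A`: every root of `A` is resolved to a root of `A'`, and
affine roots stay affine. -/
structure Refines (N : Net) (A A' : ℕ → ℕ → ZMod 2) : Prop where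
  zero : ∀ w, (N.tab A w).root = 0 → (N.tab A' w).root = 0
  succ : ∀ w r, (N.tab A w).root = r + 1 → (N.tab A' w).root = (N.tab A' r).root
  aff : ∀ w r, (N.tab A w).aff = true → (N.tab A' w).root = r + 1 → (N.tab A' r).aff = true

/-- Only this combinatorial content of `resolve` enters the counting; signs and forms are forgotten.
-/
theorem Refines.of_elim {p : ℕ} {ψ : ℕ → ZMod 2} (hp : p < N.n)
    (hA : ∀ i < N.n, ∀ j ≤ N.n, A' i j = elim p ψ (A i) j) : N.Refines A A' where
  zero w h := ((resolve hp hA w).1 h).1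
  succ w r h := ((resolve hp hA w).2.1 r h).1
  aff w r h h' := by
    rcases (resolve hp hA w).2.2 h with ⟨h1, -⟩ | ⟨r', h1, h2, -⟩
    · omega
    · obtain rfl : r = r' := by omega
      exact h2

/-- The roots that account for all roots used after a substitution. -/
def Survives (N : Net) (A A' : ℕ → ℕ → ZMod 2) (t : ℕ) : Prop :=
  N.Used A t ∧ (((N.tab A t).live = true ∧ (N.tab A' t).root = t + 1) ∨
    ((N.tab A t).aff = true ∧ (N.tab A' t).root ≠ 0 ∧ ((N.tab A N.out).root = t + 1 ∨
      ∃ b, N.Used A b ∧ N.Reads A b t ∧ (N.tab A' b).root ≠ 0)))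

/-- A live gate is resolved to nothing, to itself or to what one of its arguments is resolved to. -/
theorem Refines.live_cases (H : N.Refines A A') {w : ℕ} (h : (N.tab A w).live = true) :
    (N.tab A' w).root = 0 ∨ (N.tab A' w).root = w + 1 ∨
      ∃ c, N.Reads A w c ∧ (N.tab A' w).root = (N.tab A' c).root := by
  obtain ⟨x, y, hx, hy, -, rx, ry⟩ := Reads.root_cases h
  rcases root_gate_cases (A := A') (live_iff.mp h).1 with h1 | h1 | h1 | h1
  · exact .inl h1
  · exact .inr (.inl h1)
  · exact .inr (.inr ⟨x, rx, h1.trans (H.succ _ _ hx)⟩)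
  · exact .inr (.inr ⟨y, ry, h1.trans (H.succ _ _ hy)⟩)

/-- Descent: a live gate that collapses to a nonconstant takes over the new root of one of its
arguments. The descent ends at a gate that stays its own root or at an affine root. The reader
condition is passed on because each gate left behind has a nonzero new root. -/
theorem Refines.exists_survives (H : N.Refines A A') {w r : ℕ} (hw : N.Used A w)
    (hr : (N.tab A N.out).root = w + 1 ∨
      ∃ b, N.Used A b ∧ N.Reads A b w ∧ (N.tab A' b).root ≠ 0)
    (h : (N.tab A' w).root = r + 1) : ∃ t, N.Survives A A' t ∧ (N.tab A' t).root = r + 1 := by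
  induction w using Nat.strong_induction_on with
  | _ w ih =>
    rcases aff_or_live hw.root with ha | hl
    · exact ⟨w, ⟨hw, .inr ⟨ha, by omega, hr⟩⟩, h⟩
    · rcases H.live_cases hl with h1 | h1 | ⟨c, h1, h2⟩
      · omega
      · exact ⟨w, ⟨hw, .inl ⟨hl, h1⟩⟩, h⟩
      · exact ih c h1.lt (hw.reads h1) (.inr ⟨w, hw, h1, by omega⟩) (h2 ▸ h)

/-- Induction along the backward walk in the new table. A gate that is live there is the new root of
a survivor; affine roots stay affine, so this survivor was live and is the gate itself. Its
arguments are then reached by `exists_survives`. -/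
theorem Refines.used_survives (H : N.Refines A A') {r : ℕ} (h : N.Used A' r) :
    ∃ t, N.Survives A A' t ∧ (N.tab A' t).root = r + 1 := by
  induction h with
  | @out c h =>
    rcases Nat.eq_zero_or_pos (N.tab A N.out).root with h0 | h0
    · have := H.zero _ h0
      omega
    · obtain ⟨o, ho⟩ := Nat.exists_eq_succ_of_ne_zero h0.ne'
      exact H.exists_survives (.out ho) (.inl ho) (by rw [← H.succ _ _ ho, h])
  | @reads b c _ hb ih =>
    obtain ⟨t, ht, htb⟩ := ih
    have hlive : (N.tab A t).live = true := by
      rcases aff_or_live ht.1.root with ha | hl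
      · exact absurd hb.1 (not_live_of_aff (H.aff _ _ ha htb))
      · exact hl
    obtain rfl : t = b := by
      rcases ht.2 with h1 | h1
      · omega
      · exact absurd hlive (not_live_of_aff h1.1)
    obtain ⟨x, y, hx, hy, -, rx, ry⟩ := Reads.root_cases hlive
    rcases hb.2 with h | h
    · exact H.exists_survives (ht.1.reads rx) (.inr ⟨t, ht.1, rx, by omega⟩)
        (by rw [← H.succ _ _ hx, h])
    · exact H.exists_survives (ht.1.reads ry) (.inr ⟨t, ht.1, ry, by omega⟩)
        (by rw [← H.succ _ _ hy, h])

/-- If all roots in `K` are used but do not survive, then their number is saved. -/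
theorem Refines.card_used (H : N.Refines A A') (K : Finset ℕ) (hK : ∀ t ∈ K, N.Used A t)
    (hS : ∀ t ∈ K, ¬N.Survives A A' t) : (N.used A').card + K.card ≤ (N.used A).card := by
  -- Survivors may share a new root; for an upper bound it is enough that they cover the new used
  -- roots.
  have h1 : N.used A' ⊆ (N.used A \ K).image fun t => (N.tab A' t).root - 1 := by
    intro r hr
    obtain ⟨t, ht, htr⟩ := H.used_survives (mem_used.mp hr)
    exact Finset.mem_image.mpr ⟨t, Finset.mem_sdiff.mpr ⟨mem_used.mpr ht.1, fun h => hS t h ht⟩,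
      by omega⟩
  have h2 := (Finset.card_le_card h1).trans Finset.card_image_le
  rw [Finset.card_sdiff_of_subset fun t ht => mem_used.mpr (hK t ht)] at h2
  have h3 := Finset.card_le_card (show K ⊆ N.used A from fun t ht => mem_used.mpr (hK t ht))
  omega

/-- A live gate one of whose arguments becomes constant does not survive. -/
theorem Refines.root_ne_of_reads (H : N.Refines A A') {w c : ℕ} (h : N.Reads A w c)
    (hc : (N.tab A' c).root = 0) : (N.tab A' w).root ≠ w + 1 := by
  intro h'
  obtain ⟨x, y, hx, hy, -⟩ := own_gate (live_iff.mp h.1).1 h'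
  rcases h.2 with h | h
  · have := H.succ _ _ h
    omega
  · have := H.succ _ _ h
    omega

theorem Refines.not_survives_of_reads (H : N.Refines A A') {w c : ℕ} (h : N.Reads A w c)
    (hc : (N.tab A' c).root = 0) : ¬N.Survives A A' w := by
  rintro ⟨-, ⟨-, h2⟩ | ⟨h1, -⟩⟩
  · exact H.root_ne_of_reads h hc h2
  · exact not_live_of_aff h1 h.1

theorem not_survives_of_root {w : ℕ} (h : (N.tab A' w).root = 0) : ¬N.Survives A A' w := by
  rintro ⟨-, ⟨-, h2⟩ | ⟨-, h2, -⟩⟩ <;> omega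

theorem card_four {a b c d : ℕ} (h1 : a ≠ b) (h2 : a ≠ c) (h3 : a ≠ d) (h4 : b ≠ c) (h5 : b ≠ d)
    (h6 : c ≠ d) : ({a, b, c, d} : Finset ℕ).card = 4 := by
  rw [Finset.card_insert_of_notMem (by simp [h1, h2, h3]),
    Finset.card_insert_of_notMem (by simp [h4, h5]), Finset.card_pair h6]

/-- Fixing an argument `x` of a used gate `a` with two affine arguments `x` and `y` so that the gate
becomes constant saves four roots, provided that `x` has another reader or `y` has none. -/
theorem Refines.card_used_of_gate (H : N.Refines A A') {a x y : ℕ} (ha : N.Used A a)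
    (hx : N.Reads A a x) (hy : N.Reads A a y) (hxy : x ≠ y) (ax : (N.tab A x).aff = true)
    (ay : (N.tab A y).aff = true) (hx0 : (N.tab A' x).root = 0) (ha0 : (N.tab A' a).root = 0)
    (hout : (N.tab A' N.out).root ≠ 0)
    (hd : (∃ b, b ≠ a ∧ N.Used A b ∧ N.Reads A b x) ∨
      ∀ b, N.Used A b → N.Reads A b y → b = a) :
    (N.used A').card + 4 ≤ (N.used A).card := by
  have ne_of_live : ∀ {b c}, N.Reads A b c → x ≠ b ∧ y ≠ b := by
    intro b c hb
    exact ⟨fun h => not_live_of_aff ax (h ▸ hb.1), fun h => not_live_of_aff ay (h ▸ hb.1)⟩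
  -- A used root that becomes constant cannot be the root of the output, which stays nonconstant;
  -- hence some used gate reads it.
  have successor : ∀ b, N.Used A b → (N.tab A' b).root = 0 →
      ∃ c, N.Used A c ∧ N.Reads A c b := by
    intro b hb h0
    rcases hb.cases_out with h | h
    · exact absurd ((H.succ _ _ h).trans h0) hout
    · exact h
  obtain ⟨D, hD, hDa⟩ := successor a ha ha0
  have ux := ha.reads hx
  have uy := ha.reads hy
  have save : ∀ c d, x ≠ c → x ≠ d → a ≠ c → a ≠ d → c ≠ d → N.Used A c → N.Used A d →
      ¬N.Survives A A' c → ¬N.Survives A A' d → (N.used A').card + 4 ≤ (N.used A).card := by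
    intro c d h1 h2 h3 h4 h5 uc ud sc sd
    have := H.card_used {x, a, c, d} (by simp [ux, ha, uc, ud])
      (by simp [sc, sd, not_survives_of_root hx0, not_survives_of_root ha0])
    rwa [card_four (ne_of_live hx).1 h1 h2 h3 h4 h5] at this
  by_cases hb : ∃ b, b ≠ a ∧ N.Used A b ∧ N.Reads A b x
  · obtain ⟨b, hba, hb, hbx⟩ := hb
    -- If the reader of `a` is also the second reader of `x`, both its arguments become constant. It
    -- is then constant too, and a further gate `e` that reads it supplies the fourth root.
    by_cases hDb : D = b
    · subst hDb
      have hb0 : (N.tab A' D).root = 0 := by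
        rcases H.live_cases hDa.1 with h | h | ⟨c, hc, h⟩
        · exact h
        · exact absurd h (H.root_ne_of_reads hDa ha0)
        · have : c = x ∨ c = a := by
            have := (ne_of_live hx).1
            rcases hc.2 with h1 | h1 <;> rcases hDa.2 with h2 | h2 <;>
              rcases hbx.2 with h3 | h3 <;> omega
          rcases this with rfl | rfl
          · exact h.trans hx0
          · exact h.trans ha0
      obtain ⟨e, he, heb⟩ := successor D hD hb0
      have h1 := heb.lt
      have h2 := hDa.lt
      exact save D e (ne_of_live hDa).1 (ne_of_live heb).1 (by omega) (by omega) (by omega) hD he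
        (not_survives_of_root hb0) (H.not_survives_of_reads heb hb0)
    · exact save b D (ne_of_live hbx).1 (ne_of_live hDa).1 (Ne.symm hba) (by have := hDa.lt; omega)
        (Ne.symm hDb) hb hD (H.not_survives_of_reads hbx hx0) (H.not_survives_of_reads hDa ha0)
  · have hy1 := hd.resolve_left hb
    -- `y` is not the root of the output, since otherwise `a` would not be used; and its only used
    -- reader, `a`, has become constant.
    have sy : ¬N.Survives A A' y := by
      rintro ⟨-, ⟨h1, -⟩ | ⟨-, -, h | ⟨b, hb, hby, hb0⟩⟩⟩
      · exact not_live_of_aff ay h1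
      · exact (ne_of_live hx).2 (ha.eq_of_aff h ay).symm
      · exact hb0 (hy1 b hb hby ▸ ha0)
    exact save D y (ne_of_live hDa).1 hxy (by have := hDa.lt; omega) (ne_of_live hx).2.symm
      (ne_of_live hDa).2.symm hD uy (H.not_survives_of_reads hDa ha0) sy

/-! ### Fixing a root -/

/-- The equation that fixes the root `x` to `a`. -/
def equation (N : Net) (A : ℕ → ℕ → ZMod 2) (x : ℕ) (a : ZMod 2) (j : ℕ) : ZMod 2 :=
  if j = N.n then (N.tab A x).form j + a else (N.tab A x).form j

/-- The nonzero coefficient at `p` is 1, so the elimination adds to the form of `x` that same form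
plus `a`, and only `a` is left. -/
theorem root_of_fix {p x : ℕ} {a : ZMod 2} (hp : p < N.n) (hx : (N.tab A x).aff = true)
    (hpx : (N.tab A x).form p ≠ 0)
    (hA : ∀ i < N.n, ∀ j ≤ N.n, A' i j = elim p (N.equation A x a) (A i) j) :
    (N.tab A' x).root = 0 ∧ (N.tab A' x).sign + (N.tab A x).sign = a := by
  have two : ∀ a : ZMod 2, a + a = 0 := by decide
  have h1 := (ZMod.two_cases ((N.tab A x).form p)).resolve_left hpx
  have h := ((resolve hp hA x).2.2 hx).of_linZero fun j hj => by
    rw [elim, h1, one_mul, equation, if_neg hj.ne, two]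
  refine ⟨h.1, ?_⟩
  rw [← h.2, elim, h1, one_mul, equation, if_pos rfl, ← add_assoc, two, zero_add]

/-- A live gate with two affine arguments is not a sum, so `classify_fix` applies; `cl` and `cr` are
the values it provides. With the fixed argument equal to such a value, the gate ignores the other
argument. -/
theorem root_of_fix_gate {p w x y : ℕ} (hp : p < N.n) (hw : (N.tab A w).live = true)
    (hx : (N.tab A (N.l w)).root = x + 1) (hy : (N.tab A (N.r w)).root = y + 1)
    (ax : (N.tab A x).aff = true) (ay : (N.tab A y).aff = true) :
    ((N.tab A x).form p ≠ 0 → (∀ i < N.n, ∀ j ≤ N.n,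
        A' i j = elim p (N.equation A x (N.tab A w).cl) (A i) j) → (N.tab A' w).root = 0) ∧
      ((N.tab A y).form p ≠ 0 → (∀ i < N.n, ∀ j ≤ N.n,
        A' i j = elim p (N.equation A y (N.tab A w).cr) (A i) j) → (N.tab A' w).root = 0) := by
  have e1 : ∀ s a b : ZMod 2, s + a = s + (a + b) + b := by decide
  obtain ⟨hwn, hk⟩ := live_iff.mp hw
  obtain ⟨-, -, -, g1, g2, hg⟩ := classify_gate (show (N.cls A w).1 ≠ 0 by omega)
  rw [show classify _ _ _ _ = N.cls A w from rfl, hx, hy] at hg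
  simp only [hk, Nat.add_sub_cancel, ax, ay, Bool.and_self, true_and] at hg
  obtain ⟨f1, f2⟩ := classify_fix g1 g2 (by simpa using hg)
  have ecl : (N.tab A w).cl = N.gate (N.tab A) w 0 0 + N.gate (N.tab A) w 0 1 := by
    rw [tab_gate hwn]
    rfl
  have ecr : (N.tab A w).cr = N.gate (N.tab A) w 0 0 + N.gate (N.tab A) w 1 0 := by
    rw [tab_gate hwn]
    rfl
  have hgate : ∀ s t, N.gate (N.tab A') w s t = N.gate (N.tab A) w
      (s + ((N.tab A' (N.l w)).sign + (N.tab A (N.l w)).sign))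
      (t + ((N.tab A' (N.r w)).sign + (N.tab A (N.r w)).sign)) := by
    intro s t
    rw [gate, gate, ← e1, ← e1]
  rw [← ecl] at f1
  rw [← ecr] at f2
  constructor
  · intro hpx hA
    obtain ⟨h1, h2⟩ := root_of_fix hp ax hpx hA
    have hl := (resolve hp hA (N.l w)).2.1 x hx
    rw [h1, h2] at hl
    have := classify_left_const (g := N.gate (N.tab A') w) (fun t => by
      rw [hgate, hgate, hl.2, zero_add, f1, f1 (0 + _)]) (N.tab A' (N.r w)).root
      ((N.tab A' ((N.tab A' (N.l w)).root - 1)).aff &&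
        (N.tab A' ((N.tab A' (N.r w)).root - 1)).aff)
    have e : N.cls A' w = classify (N.gate (N.tab A') w) 0 (N.tab A' (N.r w)).root
      ((N.tab A' ((N.tab A' (N.l w)).root - 1)).aff &&
        (N.tab A' ((N.tab A' (N.r w)).root - 1)).aff) := by
      rw [cls, hl.1]
    rw [← e] at this
    rw [(gate_degenerate hwn this.1).1, this.2]
  · intro hpy hA
    obtain ⟨h1, h2⟩ := root_of_fix hp ay hpy hA
    have hr := (resolve hp hA (N.r w)).2.1 y hy
    rw [h1, h2] at hr
    have := classify_right_const (g := N.gate (N.tab A') w) (fun t => by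
      rw [hgate, hgate, hr.2, zero_add, f2, f2 (0 + _)]) (N.tab A' (N.l w)).root
      ((N.tab A' ((N.tab A' (N.l w)).root - 1)).aff &&
        (N.tab A' ((N.tab A' (N.r w)).root - 1)).aff)
    have e : N.cls A' w = classify (N.gate (N.tab A') w) (N.tab A' (N.l w)).root 0
      ((N.tab A' ((N.tab A' (N.l w)).root - 1)).aff &&
        (N.tab A' ((N.tab A' (N.r w)).root - 1)).aff) := by
      rw [cls, hr.1]
    rw [← e] at this
    rw [(gate_degenerate hwn this.1).1, this.2]

end Net


namespace Net

variable {N : Net} {A A' : ℕ → ℕ → ZMod 2}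

/-! ### The choice of the root to be fixed -/

/-- The root `x` is to be fixed to `c`: this is the output if no live gate is used; otherwise it is
an argument of the first used live gate `a`. -/
def Choice (N : Net) (A : ℕ → ℕ → ZMod 2) (x : ℕ) (c : ZMod 2) : Prop :=
  ((∀ b, N.Used A b → ¬(N.tab A b).live = true) ∧ (N.tab A N.out).root = x + 1 ∧ c = 0) ∨
  ∃ a, N.Used A a ∧ (N.tab A a).live = true ∧
    (∀ b < a, N.Used A b → ¬(N.tab A b).live = true) ∧
    (((∃ b, b ≠ a ∧ N.Used A b ∧ N.Reads A b x) ∧ (N.tab A a).v = x + 1 ∧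
        c = (N.tab A a).cr) ∨
      ((∀ b y, N.Used A b → (N.tab A a).v = y + 1 → N.Reads A b y → b = a) ∧
        (N.tab A a).u = x + 1 ∧ c = (N.tab A a).cl))

theorem u_gate {w : ℕ} (hw : N.n ≤ w) : (N.tab A w).u = (N.tab A (N.l w)).root := by
  rw [tab_gate hw]
  rfl

theorem v_gate {w : ℕ} (hw : N.n ≤ w) : (N.tab A w).v = (N.tab A (N.r w)).root := by
  rw [tab_gate hw]
  rfl

theorem Choice.aff {x : ℕ} {c : ZMod 2} (h : N.Choice A x c) : (N.tab A x).aff = true := by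
  rcases h with ⟨h1, h2, -⟩ | ⟨a, ha, hl, hmin, h⟩
  · exact (aff_or_live (root_root h2)).resolve_right (h1 x (.out h2))
  · have hn := (live_iff.mp hl).1
    rw [u_gate hn, v_gate hn] at h
    rcases h with ⟨-, h, -⟩ | ⟨-, h, -⟩
    · exact ha.aff_of_reads ⟨hl, .inr h⟩ hmin
    · exact ha.aff_of_reads ⟨hl, .inl h⟩ hmin

theorem exists_choice (h : (N.tab A N.out).root ≠ 0) : ∃ x c, N.Choice A x c := by
  classical
  obtain ⟨o, ho⟩ := Nat.exists_eq_succ_of_ne_zero h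
  by_cases hl : ∃ b, N.Used A b ∧ (N.tab A b).live = true
  · obtain ⟨h1, h2⟩ := Nat.find_spec hl
    have hmin : ∀ b < Nat.find hl, N.Used A b → ¬(N.tab A b).live = true :=
      fun b hb h3 h4 => Nat.find_min hl hb ⟨h3, h4⟩
    set a := Nat.find hl
    have hn := (live_iff.mp h2).1
    obtain ⟨x, y, hx, hy, -⟩ := Reads.root_cases h2
    by_cases hb : ∃ b, b ≠ a ∧ N.Used A b ∧ N.Reads A b y
    · exact ⟨y, _, .inr ⟨a, h1, h2, hmin, .inl ⟨hb, by rw [v_gate hn, hy], rfl⟩⟩⟩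
    · refine ⟨x, _, .inr ⟨a, h1, h2, hmin, .inr ⟨?_, by rw [u_gate hn, hx], rfl⟩⟩⟩
      intro b z h3 h4 h5
      by_contra h6
      rw [v_gate hn] at h4
      obtain rfl : y = z := by omega
      exact hb ⟨b, h6, h3, h5⟩
  · exact ⟨o, 0, .inl ⟨fun b h1 h2 => hl ⟨b, h1, h2⟩, ho, rfl⟩⟩

/-- Fixing the chosen root makes the output constant or saves four roots. -/
theorem Choice.progress {p x : ℕ} {c : ZMod 2} (h : N.Choice A x c) (hp : p < N.n)
    (hpx : (N.tab A x).form p ≠ 0)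
    (hA : ∀ i < N.n, ∀ j ≤ N.n, A' i j = elim p (N.equation A x c) (A i) j) :
    (N.tab A' N.out).root = 0 ∨ (N.used A').card + 4 ≤ (N.used A).card := by
  have H := Refines.of_elim hp hA
  have hx0 := (root_of_fix hp h.aff hpx hA).1
  by_cases hout : (N.tab A' N.out).root = 0
  · exact .inl hout
  rcases h with ⟨-, h2, -⟩ | ⟨a, ha, hl, hmin, h⟩
  · exact .inl ((H.succ _ _ h2).trans hx0)
  · have hn := (live_iff.mp hl).1
    obtain ⟨y, z, hy, hz, hyz, ry, rz⟩ := Reads.root_cases hl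
    have ay := ha.aff_of_reads ry hmin
    have az := ha.aff_of_reads rz hmin
    obtain ⟨g1, g2⟩ := root_of_fix_gate (A' := A') hp hl hy hz ay az
    rw [u_gate hn, v_gate hn] at h
    rcases h with ⟨h1, h2, rfl⟩ | ⟨h1, h2, rfl⟩
    · obtain rfl : x = z := by omega
      exact .inr (H.card_used_of_gate ha rz ry hyz.symm az ay hx0 (g2 hpx hA) hout (.inl h1))
    · obtain rfl : x = y := by omega
      exact .inr (H.card_used_of_gate ha ry rz hyz ay az hx0 (g1 hpx hA) hout
        (.inr fun b hb hr => h1 b z hb hz hr))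

/-! ### Coordinates -/

/-- Every coordinate that occurs is the form of the variable with the same number. -/
def Reduced (n : ℕ) (A : ℕ → ℕ → ZMod 2) : Prop :=
  ∀ p < n, (∃ i < n, A i p ≠ 0) → A p p = 1 ∧ ∀ j ≤ n, j ≠ p → A p j = 0

/-- The number of coordinates that occur. -/
def dim (n : ℕ) (A : ℕ → ℕ → ZMod 2) : ℕ := ((Finset.range n).filter fun p => A p p ≠ 0).card

/-- Gates only add forms, so they never bring in a coordinate that no variable contains. -/
theorem form_eq_zero {j : ℕ} (hj : ∀ i < N.n, A i j = 0) (w : ℕ) : (N.tab A w).form j = 0 := by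
  induction w using Nat.strong_induction_on with
  | _ w ih =>
    rcases lt_or_ge w N.n with hw | hw
    · rw [tab_var hw]
      exact hj w hw
    · have h1 := N.l_lt w hw
      have h2 := N.r_lt w hw
      have h3 := root_le (N := N) (A := A) (N.l w)
      have h4 := root_le (N := N) (A := A) (N.r w)
      rw [tab_gate hw]
      simp only [finish]
      rw [ih _ (by omega), ih _ (by omega), add_zero]

/-- Column `p` is cleared because `ψ p = 1`. The row of any other occurring coordinate is a unit row
with zero at `p`, so it does not change. By `hcol` no coordinate reappears, and exactly `p` is lost.
-/
theorem Reduced.elim {n p : ℕ} {ψ : ℕ → ZMod 2} (h : Reduced n A) (hp : p < n) (hψ : ψ p ≠ 0)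
    (hcol : ∀ j < n, ψ j ≠ 0 → ∃ i < n, A i j ≠ 0)
    (hA : ∀ i < n, ∀ j ≤ n, A' i j = Net.elim p ψ (A i) j) :
    Reduced n A' ∧ dim n A' + 1 = dim n A := by
  have two : ∀ a : ZMod 2, a + a = 0 := by decide
  have hψ1 := (ZMod.two_cases (ψ p)).resolve_left hψ
  have hcolp : ∀ i < n, A' i p = 0 := fun i hi => by
    rw [hA i hi p hp.le, Net.elim, hψ1, mul_one, two]
  have hcol' : ∀ j < n, ∀ i < n, A' i j ≠ 0 → ∃ i < n, A i j ≠ 0 := by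
    intro j hj i hi h1
    by_cases h2 : A i j = 0
    · refine hcol j hj fun h3 => h1 ?_
      rw [hA i hi j hj.le, Net.elim, h2, h3, mul_zero, add_zero]
    · exact ⟨i, hi, h2⟩
  have hrow : ∀ q < n, q ≠ p → (∃ i < n, A i q ≠ 0) → ∀ j ≤ n, A' q j = A q j := by
    intro q hq hqp hc j hj
    rw [hA q hq j hj, Net.elim, (h q hq hc).2 p hp.le (Ne.symm hqp), zero_mul, add_zero]
  constructor
  · rintro q hq ⟨i, hi, h1⟩
    have hqp : q ≠ p := fun e => h1 (e ▸ hcolp i hi)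
    have hc := hcol' q hq i hi h1
    obtain ⟨h2, h3⟩ := h q hq hc
    refine ⟨by rw [hrow q hq hqp hc q hq.le, h2], fun j hj hjq => ?_⟩
    rw [hrow q hq hqp hc j hj, h3 j hj hjq]
  · have e : ((Finset.range n).filter fun q => A' q q ≠ 0) =
        ((Finset.range n).filter fun q => A q q ≠ 0).erase p := by
      ext q
      simp only [Finset.mem_filter, Finset.mem_range, Finset.mem_erase]
      constructor
      · rintro ⟨hq, h1⟩
        have hqp : q ≠ p := fun e => h1 (e ▸ hcolp p hp)
        have hc := hcol' q hq q hq h1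
        exact ⟨hqp, hq, by rwa [← hrow q hq hqp hc q hq.le]⟩
      · rintro ⟨hqp, hq, h1⟩
        exact ⟨hq, by rwa [hrow q hq hqp ⟨q, hq, h1⟩ q hq.le]⟩
    have hmem : p ∈ (Finset.range n).filter fun q => A q q ≠ 0 := by
      rw [Finset.mem_filter, Finset.mem_range, (h p hp (hcol p hp hψ)).1]
      exact ⟨hp, one_ne_zero⟩
    rw [dim, dim, e, Finset.card_erase_add_one hmem]

/-- The invariant of the refuter after `k` rounds; `P` says that the circuit is small. -/
structure Invariant (N : Net) (P : Prop) (d k : ℕ) (A : ℕ → ℕ → ZMod 2) : Prop where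
  reduced : Reduced N.n A
  rounds : (N.tab A N.out).root = 0 ∨ dim N.n A + k ≤ N.n
  size : P → ((N.tab A N.out).root = 0 ∧ d ≤ dim N.n A) ∨
    (N.used A).card + 4 * d < 4 * dim N.n A

/-- The strict inequality contains `d < dim`, so a round that makes the output constant may lose one
dimension without saving any root. In every other round the right side drops by four and the left
side by at least four. -/
theorem Invariant.next {P : Prop} {d k p x : ℕ} {c : ZMod 2} (H : N.Invariant P d k A)
    (hout : (N.tab A N.out).root ≠ 0)
    (h : N.Choice A x c) (hp : p < N.n) (hpx : (N.tab A x).form p ≠ 0)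
    (hA : ∀ i < N.n, ∀ j ≤ N.n, A' i j = elim p (N.equation A x c) (A i) j) :
    N.Invariant P d (k + 1) A' := by
  have heq : ∀ j < N.n, N.equation A x c j = (N.tab A x).form j :=
    fun j hj => if_neg hj.ne
  obtain ⟨h1, h2⟩ := H.reduced.elim hp (by rwa [heq p hp]) (fun j hj h1 => by
    by_contra! h2
    exact h1 (by rw [heq j hj, form_eq_zero h2])) hA
  have h3 := H.rounds
  refine ⟨h1, .inr (by omega), fun hP => ?_⟩
  have h4 := (H.size hP).resolve_left fun h => hout h.1
  rcases h.progress hp hpx hA with h5 | h5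
  · exact .inl ⟨h5, by omega⟩
  · exact .inr (by omega)

theorem Invariant.mono {P : Prop} {d k : ℕ} (H : N.Invariant P d k A)
    (hout : (N.tab A N.out).root = 0) (k' : ℕ) : N.Invariant P d k' A :=
  ⟨H.reduced, .inl hout, H.size⟩

theorem Choice.exists_pivot {x : ℕ} {c : ZMod 2} (h : N.Choice A x c) :
    ∃ p < N.n, (N.tab A x).form p ≠ 0 := by
  by_contra! hz
  exact (aff_iff.mp h.aff).2 hz

/-- If the output were still nonconstant, no coordinate would be left and every form would be
constant, yet there would be a root to choose whose form has a nonzero linear part. -/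
theorem Invariant.final {P : Prop} {d k : ℕ} (H : N.Invariant P d k A) (hk : N.n ≤ k) :
    (N.tab A N.out).root = 0 ∧ (P → d ≤ dim N.n A) := by
  have hout : (N.tab A N.out).root = 0 := by
    by_contra hout
    obtain ⟨x, c, h⟩ := exists_choice hout
    obtain ⟨p, hp, hpx⟩ := h.exists_pivot
    have hd : dim N.n A = 0 := by
      have := H.rounds.resolve_left hout
      omega
    refine hpx (form_eq_zero (fun i hi => ?_) x)
    by_contra h1
    have h2 := (H.reduced p hp ⟨i, hi, h1⟩).1
    have : p ∈ (Finset.range N.n).filter fun q => A q q ≠ 0 := by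
      rw [Finset.mem_filter, Finset.mem_range, h2]
      exact ⟨hp, one_ne_zero⟩
    rw [Finset.card_eq_zero.mp hd] at this
    exact absurd this (Finset.notMem_empty p)
  refine ⟨hout, fun hP => ?_⟩
  rcases H.size hP with h | h
  · exact h.2
  · omega

/-- The identity matrix. -/
def start (i j : ℕ) : ZMod 2 := if i = j then 1 else 0

theorem invariant_start {P : Prop} {d : ℕ} (h : P → (N.used start).card + 4 * d < 4 * N.n) :
    N.Invariant P d 0 start := by
  have hd : dim N.n start = N.n := by
    rw [dim, Finset.filter_true_of_mem fun p _ => by simp [start], Finset.card_range]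
  refine ⟨fun p _ _ => ⟨if_pos rfl, fun j _ hj => if_neg (Ne.symm hj)⟩, .inr hd.le, fun hP => ?_⟩
  rw [hd]
  exact .inr (h hP)

end Net


/-! ### The network of a circuit -/

namespace Gate

/-- The function of a gate, as a function of two bits. -/
def fn : Gate → ZMod 2 → ZMod 2 → ZMod 2
  | const b, _, _ => b
  | unary f _, s, _ => f s
  | binary f _ _, s, t => f s t

/-- The first wire read by a gate, or zero. -/
def left : Gate → ℕ
  | const _ => 0
  | unary _ i => i
  | binary _ i _ => i

/-- The second wire read by a gate, or zero. -/
def right : Gate → ℕ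
  | const _ => 0
  | unary _ _ => 0
  | binary _ _ j => j

/-- The number that starts the block of a gate. -/
def tag : Gate → ℕ
  | const _ => 0
  | unary _ _ => 1
  | binary _ _ _ => 2

theorem encode_eq (g : Gate) : g.encode = [g.tag, (g.fn 0 0).val, (g.fn 0 1).val, (g.fn 1 0).val,
    (g.fn 1 1).val, g.left, g.right] := by
  cases g <;> rfl

theorem eval_eq (g : Gate) (v : List (ZMod 2)) :
    g.eval v = g.fn (v.getD g.left 0) (v.getD g.right 0) := by
  cases g <;> rfl

theorem eval_congr {g : Gate} {v v' : List (ZMod 2)}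
    (h : ∀ i ∈ g.inputs, v.getD i 0 = v'.getD i 0) : g.eval v = g.eval v' := by
  cases g <;> simp_all [eval, inputs]

theorem left_lt {g : Gate} {w : ℕ} (hw : 0 < w) (h : ∀ i ∈ g.inputs, i < w) : g.left < w := by
  cases g <;> simp_all [left, inputs]

theorem right_lt {g : Gate} {w : ℕ} (hw : 0 < w) (h : ∀ i ∈ g.inputs, i < w) : g.right < w := by
  cases g <;> simp_all [right, inputs]

end Gate

/-- Appending never changes earlier entries and a gate reads earlier wires only, so the equation
valid when its value is appended stays valid for the final list. -/
theorem foldl_eval (gs : List Gate) (v : List (ZMod 2))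
    (h : ∀ (k : ℕ) (hk : k < gs.length), ∀ i ∈ (gs[k]).inputs, i < v.length + k) :
    (∀ i < v.length, (gs.foldl (fun v g => v ++ [g.eval v]) v).getD i 0 = v.getD i 0) ∧
    ∀ k < gs.length, (gs.foldl (fun v g => v ++ [g.eval v]) v).getD (v.length + k) 0 =
      (gs.getD k (.const 0)).eval (gs.foldl (fun v g => v ++ [g.eval v]) v) := by
  induction gs generalizing v with
  | nil => exact ⟨fun _ _ => rfl, fun k hk => absurd hk (by simp)⟩
  | cons g gs ih =>
    obtain ⟨h1, h2⟩ := ih (v ++ [g.eval v]) (fun k hk i hi => by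
      have := h (k + 1) (by simpa using hk) i hi
      rw [List.length_append, List.length_singleton]
      omega)
    rw [List.length_append, List.length_singleton] at h1 h2
    have h3 : ∀ i < v.length,
        ((g :: gs).foldl (fun v g => v ++ [g.eval v]) v).getD i 0 = v.getD i 0 := by
      intro i hi
      rw [List.foldl_cons, h1 i (by omega), List.getD_append _ _ _ _ hi]
    refine ⟨h3, fun k hk => ?_⟩
    cases k with
    | zero =>
      have h4 : g.eval v = g.eval ((g :: gs).foldl (fun v g => v ++ [g.eval v]) v) :=
        Gate.eval_congr fun i hi => (h3 i (h 0 (by simp) i hi)).symm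
      rw [List.getD_cons_zero, ← h4, List.foldl_cons, h1 _ (by omega), Nat.add_zero,
        List.getD_append_right _ _ _ _ le_rfl, Nat.sub_self, List.getD_cons_zero]
    | succ k =>
      rw [List.getD_cons_succ, List.foldl_cons,
        ← h2 k (by simpa using hk), Nat.add_right_comm, Nat.add_assoc]

variable {n : ℕ}

/-- The gate number `k` of a circuit. -/
def Circuit.gate (C : Circuit n) (k : ℕ) : Gate := C.gates.getD k (.const 0)

theorem Circuit.gate_inputs (C : Circuit n) (k : ℕ) : ∀ i ∈ (C.gate k).inputs, i < n + k := by
  by_cases hk : k < C.gates.length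
  · rw [gate, List.getD_eq_getElem _ _ hk]
    exact C.inputs_lt k hk
  · rw [gate, List.getD_eq_default _ _ (not_lt.mp hk)]
    simp [Gate.inputs]

/-- The network of a circuit. -/
def Circuit.net (C : Circuit n) (hn : 0 < n) : Net where
  n := n
  wires := n + C.gates.length
  out := C.output
  fn w := (C.gate (w - n)).fn
  l w := (C.gate (w - n)).left
  r w := (C.gate (w - n)).right
  out_lt := C.output_lt
  -- Missing arguments of constants and unary gates are taken to be wire 0, which precedes every
  -- gate only if there is at least one variable.
  l_lt w hw := Gate.left_lt (by omega) fun i hi => by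
    have := C.gate_inputs (w - n) i hi
    omega
  r_lt w hw := Gate.right_lt (by omega) fun i hi => by
    have := C.gate_inputs (w - n) i hi
    omega

theorem Circuit.wireValues_var (C : Circuit n) (x : Fin n → ZMod 2) (i : Fin n) :
    (C.wireValues x).getD i 0 = x i := by
  have := (foldl_eval C.gates (List.ofFn x) (by simpa using C.inputs_lt)).1 i (by simp)
  rw [wireValues, this]
  simp

theorem Circuit.wireValues_gate (C : Circuit n) (x : Fin n → ZMod 2) {k : ℕ}
    (hk : k < C.gates.length) :
    (C.wireValues x).getD (n + k) 0 = (C.gate k).eval (C.wireValues x) := by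
  have := (foldl_eval C.gates (List.ofFn x) (by simpa using C.inputs_lt)).2 k hk
  rwa [List.length_ofFn] at this

theorem sum_getD_eq (f : Gate → ℕ) (gs : List Gate) :
    ∑ k ∈ Finset.range gs.length, f (gs.getD k (.const 0)) = (gs.map f).sum := by
  induction gs with
  | nil => rfl
  | cons g gs ih =>
    rw [List.length_cons, Finset.sum_range_succ', List.map_cons, List.sum_cons, ← ih]
    simp [add_comm]

/-- A gate that is its own root depends on its second argument, which constants and unary gates do
not. Hence every used wire is a variable or a binary gate. -/
theorem Circuit.card_used_le (C : Circuit n) (hn : 0 < n) (A : ℕ → ℕ → ZMod 2) :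
    ((C.net hn).used A).card ≤ n + C.size := by
  have h1 : ((C.net hn).used A).card ≤ ∑ w ∈ (C.net hn).used A,
      if w < n then 1 else (C.gate (w - n)).cost := by
    rw [Finset.card_eq_sum_ones]
    refine Finset.sum_le_sum fun w hw => ?_
    split_ifs with hwn
    · exact le_rfl
    · have hw' : (C.net hn).n ≤ w := not_lt.mp hwn
      have hd := (classify_gate (Net.cls_of_own hw' (Net.mem_used.mp hw).root)).2.2.2.1
      have hfn : (C.net hn).fn w = (C.gate (w - n)).fn := rfl
      rw [Net.gate, Net.gate, Net.gate, Net.gate, hfn] at hd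
      cases hg : C.gate (w - n) with
      | const b => simp [hg, Gate.fn] at hd
      | unary f i => simp [hg, Gate.fn] at hd
      | binary f i j => exact le_rfl
  refine h1.trans ((Finset.sum_le_sum_of_subset (t := Finset.range (n + C.gates.length))
    fun w hw => Finset.mem_range.mpr
      ((Net.mem_used.mp hw).le_out.trans_lt (C.net hn).out_lt)).trans ?_)
  rw [Finset.sum_range_add, size, ← sum_getD_eq]
  refine Nat.add_le_add ?_ (Finset.sum_le_sum fun k _ => ?_)
  · rw [Finset.sum_congr rfl fun w hw => if_pos (Finset.mem_range.mp hw)]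
    simp
  · rw [if_neg (by omega), Nat.add_sub_cancel_left]
    exact le_rfl

/-! ### The description of the affine subspace -/

/-- The description by the coordinates `cols`. -/
def describe {A : ℕ → ℕ → ZMod 2} (hA : Net.Reduced n A) (cols : List ℕ) (hnd : cols.Nodup)
    (hc : ∀ p ∈ cols, p < n ∧ A p p ≠ 0) : AffineDescription n where
  dim := cols.length
  A := .of fun i j => A i cols[j]
  a := fun i => A i n
  fullRank := by
    set M : Matrix (Fin n) (Fin cols.length) (ZMod 2) := .of fun i j => A i cols[j] with hM
    have hli : LinearIndependent (ZMod 2) M.col := by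
      rw [← Matrix.mulVec_injective_iff, ← Matrix.coe_mulVecLin, ← LinearMap.ker_eq_bot,
        LinearMap.ker_eq_bot']
      intro y hy
      funext k
      obtain ⟨h1, h2⟩ := hc _ (List.getElem_mem k.2)
      have h3 := hA _ h1 ⟨_, h1, h2⟩
      have h4 := congrFun hy ⟨cols[k], h1⟩
      -- By reducedness the matrix row of the variable `cols[k]` is a unit vector, so this component
      -- of the product is `y k`.
      rw [Matrix.mulVecLin_apply, Matrix.mulVec, dotProduct, Finset.sum_eq_single k] at h4
      · simpa [hM, h3.1] using h4
      · intro j _ hj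
        have h5 : cols[j] ≠ cols[k] := fun h =>
          hj (Fin.ext ((hnd.getElem_inj_iff).mp h))
        have h6 := (hc _ (List.getElem_mem j.2)).1
        have h7 : A cols[k] cols[j] = 0 := h3.2 _ h6.le h5
        simp only [hM, Matrix.of_apply]
        rw [show A (↑(⟨cols[k], h1⟩ : Fin n)) cols[j] = 0 from h7, zero_mul]
      · exact fun h => absurd (Finset.mem_univ k) h
    simpa using hli.rank_matrix

theorem describe_constantOn (C : Circuit n) (hn : 0 < n) {A : ℕ → ℕ → ZMod 2}
    (hA : Net.Reduced n A) (cols : List ℕ) (hnd : cols.Nodup)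
    (hc : ∀ p ∈ cols, p < n ∧ A p p ≠ 0) (hout : ((C.net hn).tab A C.output).root = 0) :
    C.ConstantOn (describe hA cols hnd hc).toSet := by
  refine ⟨((C.net hn).tab A C.output).sign, ?_⟩
  rintro _ ⟨y, rfl⟩
  set x := (describe hA cols hnd hc).A *ᵥ y + (describe hA cols hnd hc).a with hx
  -- Coordinates not listed in `cols` are set to zero; this is how surplus dimensions are dropped.
  let Y : ℕ → ZMod 2 := fun j => ∑ k : Fin cols.length, if cols[k] = j then y k else 0
  have hvar : ∀ i < (C.net hn).n, (C.wireValues x).getD i 0 =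
      Net.value (C.net hn).n (A i) Y := by
    intro i hi
    have hi' : i < n := hi
    rw [C.wireValues_var x ⟨i, hi'⟩, hx, Pi.add_apply, Matrix.mulVec, dotProduct]
    change ∑ k : Fin cols.length, A i cols[k] * y k + A i n = Net.value n (A i) Y
    rw [Net.value]
    simp only [Y, Finset.mul_sum]
    rw [Finset.sum_comm]
    congr 1
    refine Finset.sum_congr rfl fun k _ => ?_
    rw [Finset.sum_eq_single cols[k]]
    · rw [if_pos rfl]
    · intro j _ hj
      rw [if_neg (Ne.symm hj), mul_zero]
    · exact fun h => absurd (Finset.mem_range.mpr (hc _ (List.getElem_mem k.2)).1) h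
  have hgate : ∀ w, (C.net hn).n ≤ w → w < (C.net hn).wires → (C.wireValues x).getD w 0 =
      (C.net hn).fn w ((C.wireValues x).getD ((C.net hn).l w) 0)
        ((C.wireValues x).getD ((C.net hn).r w) 0) := by
    intro w h1 h2
    have h1' : n ≤ w := h1
    have h2' : w < n + C.gates.length := h2
    have := C.wireValues_gate x (k := w - n) (by omega)
    rw [Nat.add_sub_cancel' h1', Gate.eval_eq] at this
    exact this
  exact (Net.sound hvar hgate C.output_lt).1 hout

theorem describe_encode {A : ℕ → ℕ → ZMod 2}
    (hA : Net.Reduced n A) (cols : List ℕ) (hnd : cols.Nodup)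
    (hc : ∀ p ∈ cols, p < n ∧ A p p ≠ 0) : (describe hA cols hnd hc).encode =
      cols.length :: (List.range n).map (fun i => (A i n).val) ++
        cols.flatMap fun p => (List.range n).map fun i => (A i p).val := by
  have h : ∀ f : ℕ → ℕ, (List.ofFn fun i : Fin n => f i) = (List.range n).map f := by
    intro f
    rw [List.ofFn_eq_map, ← List.map_coe_finRange_eq_range, List.map_map]
    rfl
  rw [AffineDescription.encode]
  congr 1
  · congr 1
    exact h fun i => (A i n).val
  · rw [List.flatMap_def]
    congr 1
    refine List.ext_getElem (by simp [describe]) fun j h1 h2 => ?_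
    have hj : j < cols.length := by simpa using h2
    simp only [List.getElem_ofFn, List.getElem_map]
    exact h fun i => (A i cols[j]).val


/-! ### Arrays and loops -/

namespace Cmd

/-- Fill the array `a` from the position in `r` on with `m` values of the expression `e`, which may
depend on the counter `j`. -/
def fill (a : Arr) (r : Var) (m e : Exp) : Cmd :=
  rep .j (when (m - Var.j) (put a (r + Var.j) e))

/-- A state during a filling loop that started in `s` and has filled `k` cells. -/
structure Filling (a : Arr) (b k : ℕ) (s t : State) : Prop where
  reg : ∀ r ≠ Var.j, t.reg r = s.reg r
  counter : t.reg .j = k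
  arr : ∀ a' ≠ a, t.arr a' = s.arr a'
  cell : ∀ c, c < b ∨ b + k ≤ c → t.arr a c = s.arr a c

/-- The value at counter `k` may rely on every cell except the `k` already filled, so a row can be
rewritten in place from its own entries, as elimination does. -/
theorem run_fill {L : ℕ} {a : Arr} {r : Var} {m e : Exp} {s : State} {M : ℕ} (f : ℕ → ℕ)
    (hr : r ≠ .j) (hM : M ≤ L)
    (hm : ∀ k t, Filling a (s.reg r) k s t → m.eval t = M)
    (hf : ∀ k < M, ∀ t, Filling a (s.reg r) k s t → e.eval t = f k) (c : ℕ) :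
    (run L (fill a r m e) s).arr a c =
      if s.reg r ≤ c ∧ c < s.reg r + M then f (c - s.reg r) else s.arr a c := by
  have key := run_rep_of_invariant (L := L) (r := .j) (c := when (m - Var.j) (put a (r + Var.j) e))
    (s := s) (fun k t => (∀ r ≠ Var.j, t.reg r = s.reg r) ∧ (∀ a' ≠ a, t.arr a' = s.arr a') ∧
      ∀ c, t.arr a c = if s.reg r ≤ c ∧ c < s.reg r + min k M then f (c - s.reg r)
        else s.arr a c)
    ⟨fun _ _ => rfl, fun _ _ => rfl, fun c => by rw [if_neg (by omega)]⟩ ?_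
  · rw [fill, key.2.2 c, min_eq_right hM]
  · rintro k - t ⟨h1, h2, h3⟩
    have hF : Filling a (s.reg r) k s (t.setReg .j k) := by
      refine ⟨fun r hr => ?_, by simp, h2, fun c hc => ?_⟩
      · rw [State.setReg_reg, if_neg hr, h1 r hr]
      · rw [State.setReg_arr, h3, if_neg (by omega)]
    rw [run_when, Exp.eval_sub, hm k _ hF, Exp.eval_var, hF.counter]
    split_ifs with hk
    · have hkM : k < M := by omega
      refine ⟨hF.reg, fun a' ha' => ?_, fun c => ?_⟩
      · funext i
        rw [run_put, State.setArr_arr, if_neg fun h => ha' h.1, hF.arr a' ha']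
      · rw [run_put, State.setArr_arr, Exp.eval_add, Exp.eval_var, Exp.eval_var, hF.counter,
          hF.reg r hr, hf k hkM _ hF, State.setReg_arr, h3]
        by_cases hc : c = s.reg r + k
        · subst hc
          rw [if_pos ⟨rfl, rfl⟩, if_pos (by omega), Nat.add_sub_cancel_left]
        · rw [if_neg fun h => hc h.2]
          congr 1
          apply propext
          omega
    · refine ⟨hF.reg, hF.arr, fun c => ?_⟩
      rw [State.setReg_arr, h3]
      congr 1
      apply propext
      omega

end Cmd

theorem val_xor (a b : ZMod 2) : (a.val - b.val) + (b.val - a.val) = (a + b).val := by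
  revert a b; decide

theorem val_eq_zero_iff (a : ZMod 2) : a.val = 0 ↔ a = 0 := by
  revert a; decide

theorem one_sub_val (a : ZMod 2) : 1 - a.val = (1 + a).val := by
  revert a; decide

theorem add_eq_zero_iff' (a b : ZMod 2) : a + b = 0 ↔ a = b := by
  revert a b; decide

/-- The cells `(i, j)` with `j < m` of a matrix that is stored row by row are different. -/
theorem cell_inj {m i j i' j' : ℕ} (hj : j < m) (hj' : j' < m) :
    i * m + j = i' * m + j' ↔ i = i' ∧ j = j' := by
  refine ⟨fun h => ?_, fun h => by rw [h.1, h.2]⟩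
  have hm : 0 < m := by omega
  have h1 : (i * m + j) / m = (i' * m + j') / m := by rw [h]
  rw [mul_comm i, mul_comm i', Nat.mul_add_div hm, Nat.mul_add_div hm, Nat.div_eq_of_lt hj,
    Nat.div_eq_of_lt hj', add_zero, add_zero] at h1
  subst h1
  exact ⟨rfl, by omega⟩

theorem cell_mem_row {m i j i' : ℕ} (hj : j < m) :
    (i' * m ≤ i * m + j ∧ i * m + j < i' * m + m) ↔ i = i' := by
  constructor
  · rintro ⟨h1, h2⟩
    exact ((cell_inj (m := m) (i := i) (i' := i') (j' := i * m + j - i' * m) hj (by omega)).mp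
      (by omega)).1
  · rintro rfl
    omega

/-! ### Representation of tables in memory -/

/-- The parts of the memory that never change after the setup. -/
structure Static (N : Net) (L : ℕ) (s : State) : Prop where
  n_pos : 0 < N.n
  n_lt : N.n < L
  wires_le : N.wires ≤ L
  len : s.reg .len = L
  n : s.reg .n = N.n
  wires : s.reg .wires = N.wires
  out : s.reg .out = N.out
  row : ∀ w < L, s.arr .row w = w * (N.n + 1)
  gate : ∀ w, N.n ≤ w → w < N.wires → ∀ b c : ZMod 2,
    s.arr .input (s.reg .base + 7 * (w - N.n) + 1 + b.val + b.val + c.val) = (N.fn w b c).val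
  left : ∀ w, N.n ≤ w → w < N.wires → s.arr .input (s.reg .base + 7 * (w - N.n) + 5) = N.l w
  right : ∀ w, N.n ≤ w → w < N.wires → s.arr .input (s.reg .base + 7 * (w - N.n) + 6) = N.r w

theorem Static.of_eq {N : Net} {L : ℕ} {s t : State} (h : Static N L s)
    (h1 : t.reg .len = s.reg .len) (h2 : t.reg .n = s.reg .n) (h3 : t.reg .wires = s.reg .wires)
    (h4 : t.reg .out = s.reg .out) (h5 : t.reg .base = s.reg .base)
    (h6 : t.arr .row = s.arr .row) (h7 : t.arr .input = s.arr .input) : Static N L t where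
  n_pos := h.n_pos
  n_lt := h.n_lt
  wires_le := h.wires_le
  len := by rw [h1, h.len]
  n := by rw [h2, h.n]
  wires := by rw [h3, h.wires]
  out := by rw [h4, h.out]
  row w hw := by rw [h6, h.row w hw]
  gate w h8 h9 b c := by rw [h7, h5, h.gate w h8 h9]
  left w h8 h9 := by rw [h7, h5, h.left w h8 h9]
  right w h8 h9 := by rw [h7, h5, h.right w h8 h9]

/-- The command changes none of the parts of the memory that are kept after the setup. -/
def Cmd.KeepsStatic (c : Cmd) : Bool :=
  !(c.writes .len || c.writes .n || c.writes .wires || c.writes .out || c.writes .base ||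
    c.stores .row || c.stores .input)

theorem Static.run {N : Net} {L : ℕ} {s : State} {c : Cmd} (h : Static N L s)
    (hc : c.KeepsStatic = true) : Static N L (c.run L s) := by
  simp only [Cmd.KeepsStatic, Bool.not_eq_true', Bool.or_eq_false_iff] at hc
  obtain ⟨⟨⟨⟨⟨⟨h1, h2⟩, h3⟩, h4⟩, h5⟩, h6⟩, h7⟩ := hc
  exact h.of_eq (Cmd.run_reg_of_not_writes h1 s) (Cmd.run_reg_of_not_writes h2 s)
    (Cmd.run_reg_of_not_writes h3 s) (Cmd.run_reg_of_not_writes h4 s)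
    (Cmd.run_reg_of_not_writes h5 s) (Cmd.run_arr_of_not_stores h6 s)
    (Cmd.run_arr_of_not_stores h7 s)

/-- The forms of the variables are stored in memory. -/
def EncodesRows (n : ℕ) (s : State) (A : ℕ → ℕ → ZMod 2) : Prop :=
  ∀ i < n, ∀ j ≤ n, s.arr .form (i * (n + 1) + j) = (A i j).val

/-- The entry `e` of the wire `w` is stored in memory. -/
structure EncodesEntry (n : ℕ) (s : State) (e : Entry) (w : ℕ) : Prop where
  root : s.arr .root w = e.root
  sign : s.arr .sign w = e.sign.val
  aff : s.arr .aff w = e.aff.toNat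
  live : s.arr .live w = e.live.toNat
  left : s.arr .left w = e.u
  right : s.arr .right w = e.v
  cl : s.arr .cl w = e.cl.val
  cr : s.arr .cr w = e.cr.val
  form : ∀ j ≤ n, s.arr .form (w * (n + 1) + j) = (e.form j).val


namespace Refuter

open Cmd

variable {N : Net} {A : ℕ → ℕ → ZMod 2} {L : ℕ} {s : State}

/-! ### The computation of the table -/

/-- Load the gate `w` and what is known about its arguments. -/
def loadGate : Cmd := block [
  set .acc (Var.w - Var.n),
  set .acc (Var.base +
    (Var.acc + Var.acc + Var.acc + Var.acc + Var.acc + Var.acc + Var.acc)),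
  set .lw (.get .input (Var.acc + 5)),
  set .rw (.get .input (Var.acc + 6)),
  set .u (.get .root Var.lw),
  set .v (.get .root Var.rw),
  set .lc (.get .sign Var.lw),
  set .rc (.get .sign Var.rw),
  set .g00 (.get .input (Var.acc + 1 + Var.lc + Var.lc + Var.rc)),
  set .g01 (.get .input (Var.acc + 1 + Var.lc + Var.lc + (1 - Var.rc))),
  set .g10 (.get .input (Var.acc + 1 + (1 - Var.lc) + (1 - Var.lc) + Var.rc)),
  set .g11 (.get .input (Var.acc + 1 + (1 - Var.lc) + (1 - Var.lc) + (1 - Var.rc))),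
  set .rowU (.get .row (Var.u - 1)),
  set .rowV (.get .row (Var.v - 1))]

/-- Store the sum of the forms of the roots of the arguments. -/
def addForms : Cmd :=
  fill .form .rowW (Var.n + 1)
    (Exp.xor (.get .form (Var.rowU + Var.j)) (.get .form (Var.rowV + Var.j)))

/-- Compute the function `classify`. -/
def classifyGate : Cmd := block [
  set .kind 0,
  set .root 0,
  branch (.xor Var.u Var.v)
    (branch ((1 - Var.v) + (1 - (.xor Var.g00 Var.g01 + .xor Var.g10 Var.g11)))
      (when (.xor Var.g00 Var.g10) (set .root Var.u))
      (branch ((1 - Var.u) + (1 - (.xor Var.g00 Var.g10 + .xor Var.g01 Var.g11)))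
        (when (.xor Var.g00 Var.g01) (set .root Var.v))
        (branch ((1 - Exp.get .aff (Var.u - 1)) + (1 - Exp.get .aff (Var.v - 1)) +
            .xor Var.g00 Var.g11 + .xor Var.g01 Var.g10)
          (set .kind 2)
          (set .kind 1))))
    (when (.xor Var.g00 Var.g11) (set .root Var.u))]

/-- Test whether the linear part of the form of the wire `w` is zero. -/
def testForm : Cmd := block [
  set .nz 0,
  rep .j (when (Var.n - Var.j) (set .nz (Var.nz + .get .form (Var.rowW + Var.j))))]

/-- Compute and store the entry of the wire `w`. -/
def storeEntry : Cmd := block [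
  set .aff 0,
  set .live 0,
  set .sign Var.g00,
  branch Var.kind
    (branch (2 - Var.kind)
      (branch Var.nz
        (block [set .root (Var.w + 1), set .aff 1])
        (block [set .root 0, set .sign (.xor Var.g00 (.get .form (Var.rowW + Var.n)))]))
      (block [set .root (Var.w + 1), set .live 1]))
    nop,
  put .root Var.w Var.root,
  put .sign Var.w Var.sign,
  put .aff Var.w Var.aff,
  put .live Var.w Var.live,
  put .left Var.w Var.u,
  put .right Var.w Var.v,
  put .cl Var.w (.xor Var.g00 Var.g01),
  put .cr Var.w (.xor Var.g00 Var.g10)]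

/-- Compute the entry of the wire `w`. -/
def entry : Cmd := block [
  set .rowW (.get .row Var.w),
  branch (Var.n - Var.w)
    (block [set .kind 1, set .root 0, set .u 0, set .v 0, set .g00 0, set .g01 0, set .g10 0])
    (block [loadGate, addForms, classifyGate]),
  testForm,
  storeEntry]

/-- Compute the table of all wires. -/
def table : Cmd := rep .w (when (Var.wires - Var.w) entry)

/-- Looking up the truth table at bits shifted by the signs of the arguments gives the normalised
gate; `1 - lc` is the flipped bit. -/
theorem loadGate_spec (hs : Static N L s) (he : ∀ w' < s.reg .w,
      EncodesEntry N.n s (N.tab A w') w') (h1 : N.n ≤ s.reg .w) (h2 : s.reg .w < N.wires) :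
    (run L loadGate s).reg .u = (N.tab A (N.l (s.reg .w))).root ∧
    (run L loadGate s).reg .v = (N.tab A (N.r (s.reg .w))).root ∧
    (run L loadGate s).reg .g00 = (N.gate (N.tab A) (s.reg .w) 0 0).val ∧
    (run L loadGate s).reg .g01 = (N.gate (N.tab A) (s.reg .w) 0 1).val ∧
    (run L loadGate s).reg .g10 = (N.gate (N.tab A) (s.reg .w) 1 0).val ∧
    (run L loadGate s).reg .g11 = (N.gate (N.tab A) (s.reg .w) 1 1).val ∧
    (run L loadGate s).reg .rowU = ((N.tab A (N.l (s.reg .w))).root - 1) * (N.n + 1) ∧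
    (run L loadGate s).reg .rowV = ((N.tab A (N.r (s.reg .w))).root - 1) * (N.n + 1) := by
  set w := s.reg .w with hw
  have hl := N.l_lt w h1
  have hr := N.r_lt w h1
  have e7 : ∀ d : ℕ, d + d + d + d + d + d + d = 7 * d := fun d => by omega
  have hL := hs.wires_le
  have h3 := Net.root_le (N := N) (A := A) (N.l w)
  have h4 := Net.root_le (N := N) (A := A) (N.r w)
  simp [loadGate, ← hw, e7, hs.n, hs.left w h1 h2, hs.right w h1 h2, (he _ hl).root,
    (he _ hr).root, (he _ hl).sign, (he _ hr).sign, one_sub_val, hs.gate w h1 h2, Net.gate,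
    hs.row ((N.tab A (N.l w)).root - 1) (by omega), hs.row ((N.tab A (N.r w)).root - 1) (by omega)]

/-- Conditions are numbers, true when nonzero: `xor` tests inequality, addition is disjunction, `1 -
x` is negation. The rewriting turns the nested branches into those of `classify`. -/
theorem classifyGate_spec {g : ZMod 2 → ZMod 2 → ZMod 2} {u v : ℕ} {a b : Bool}
    (hu : s.reg .u = u) (hv : s.reg .v = v) (h00 : s.reg .g00 = (g 0 0).val)
    (h01 : s.reg .g01 = (g 0 1).val) (h10 : s.reg .g10 = (g 1 0).val)
    (h11 : s.reg .g11 = (g 1 1).val) (ha : s.arr .aff (u - 1) = a.toNat)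
    (hb : s.arr .aff (v - 1) = b.toNat) :
    (run L classifyGate s).reg .kind = (classify g u v (a && b)).1 ∧
    (run L classifyGate s).reg .root = (classify g u v (a && b)).2 := by
  have e : ∀ x y : ℕ, x - y + (y - x) = 0 ↔ x = y := by omega
  have e2 : ∀ x : Bool, 1 - x.toNat = 0 ↔ x = true := by decide
  have e3 : ∀ x y z t : ZMod 2, 1 - ((x + y).val + (z + t).val) = 0 ↔ ¬(x = y ∧ z = t) := by
    decide
  have e4 : ∀ x : ℕ, 1 - x = 0 ↔ x ≠ 0 := by omega
  simp only [classifyGate, run_block_cons, run_block_nil, run_set, run_branch, run_when,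
    Exp.eval_ofNat, Exp.eval_var, Exp.eval_add, Exp.eval_sub, Exp.eval_xor, Exp.eval_get,
    State.setReg_reg, State.setReg_arr, reduceCtorEq, if_false, hu, hv, h00, h01, h10,
    h11, ha, hb, val_xor, ne_eq, Nat.add_eq_zero_iff, e, e2, e3, e4, val_eq_zero_iff,
    add_eq_zero_iff', classify, ← not_or, and_assoc, Bool.and_eq_true, ite_not]
  split_ifs <;> exact ⟨rfl, rfl⟩

/-- `nz` adds the bits as natural numbers, not modulo two, so it vanishes only if all of them do. -/
theorem testForm_spec (hn : N.n ≤ L) (hs : s.reg .n = N.n) {w : ℕ} {φ : ℕ → ZMod 2}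
    (hw : s.reg .rowW = w * (N.n + 1))
    (hφ : ∀ j ≤ N.n, s.arr .form (w * (N.n + 1) + j) = (φ j).val) :
    (run L testForm s).reg .nz = 0 ↔ LinZero N.n φ := by
  have key := run_rep_of_invariant (L := L) (r := .j)
    (c := when (Var.n - Var.j) (set .nz (Var.nz + .get .form (Var.rowW + Var.j))))
    (s := s.setReg .nz 0) (fun k t => t.reg .n = N.n ∧ t.reg .rowW = s.reg .rowW ∧
      t.arr = s.arr ∧ (t.reg .nz = 0 ↔ ∀ j < min k N.n, φ j = 0))
    ⟨by simp [hs], by simp, rfl, by simp⟩ ?_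
  · rw [min_eq_right hn] at key
    exact key.2.2.2
  · rintro k - t ⟨h1, h2, h3, h4⟩
    rw [run_when]
    simp only [Exp.eval_sub, Exp.eval_var, State.setReg_reg, reduceCtorEq, if_false, if_true, h1]
    split_ifs with hk
    · refine ⟨by simp [h1], by simp [h2], by simp [h3], ?_⟩
      simp only [run_set, Exp.eval_add, Exp.eval_var, Exp.eval_get, State.setReg_reg, reduceCtorEq,
        if_false, if_true, State.setReg_arr, h2, h3, hw, hφ k (by omega), Nat.add_eq_zero_iff, h4,
        val_eq_zero_iff]
      rw [min_eq_left (by omega), min_eq_left (by omega)]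
      exact ⟨fun h j hj => (Nat.lt_succ_iff_lt_or_eq.mp hj).elim (h.1 j) fun e => e ▸ h.2,
        fun h => ⟨fun j hj => h j (by omega), h k (by omega)⟩⟩
    · refine ⟨by simp [h1], by simp [h2], by simp [h3], ?_⟩
      simp only [State.setReg_reg, reduceCtorEq, if_false, h4]
      rw [min_eq_right (by omega), min_eq_right (by omega)]

end Refuter


/-! ### Correctness of the stored table. -/

namespace Refuter

open Cmd

variable {N : Net} {A : ℕ → ℕ → ZMod 2} {L : ℕ} {s : State}

theorem storeEntry_spec {n w kind ρ u v : ℕ} {c d e : ZMod 2} {φ : ℕ → ZMod 2}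
    (hn : s.reg .n = n) (hw : s.reg .w = w) (hk : s.reg .kind = kind) (hk2 : kind ≤ 2)
    (hρ : s.reg .root = ρ) (hu : s.reg .u = u) (hv : s.reg .v = v) (h00 : s.reg .g00 = c.val)
    (h01 : s.reg .g01 = d.val) (h10 : s.reg .g10 = e.val) (hnz : s.reg .nz = 0 ↔ LinZero n φ)
    (hrow : s.reg .rowW = w * (n + 1))
    (hφ : ∀ j ≤ n, s.arr .form (w * (n + 1) + j) = (φ j).val) :
    EncodesEntry n (run L storeEntry s) (Net.finish n w kind ρ c φ u v (c + d) (c + e)) w ∧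
    ∀ a, ∀ i ≠ w, (run L storeEntry s).arr a i = s.arr a i := by
  have hf : ∀ j ≤ n, (run L storeEntry s).arr .form (w * (n + 1) + j) = (φ j).val := by
    intro j hj
    rw [run_arr_of_not_stores (by decide), hφ j hj]
  have e2 : 2 - kind = 0 ↔ kind = 2 := by omega
  refine ⟨⟨?_, ?_, ?_, ?_, ?_, ?_, ?_, ?_, hf⟩, ?_⟩
  case refine_9 =>
    intro a i hi
    by_cases h0 : kind = 0 <;> by_cases h2 : kind = 2 <;> by_cases hz : s.reg .nz = 0 <;>
    simp [storeEntry, run_branch, hw, hk, e2, h0, h2, hz, hi]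
  all_goals
    by_cases h0 : kind = 0
    · subst h0
      simp [storeEntry, run_branch, hw, hk, hρ, h00, h01, h10, hu, hv, val_xor, Net.finish]
    · by_cases h2 : kind = 2
      · subst h2
        simp [storeEntry, run_branch, hw, hk, h00, h01, h10, hu, hv, val_xor, Net.finish]
      · obtain rfl : kind = 1 := by omega
        by_cases hz : s.reg .nz = 0
        · have hz' := hnz.mp hz
          simp [storeEntry, run_branch, hw, hk, h00, h01, h10, hu, hv, val_xor, Net.finish, hz,
            hz', hrow, hn, hφ]
        · have hz' := mt hnz.mpr hz
          simp [storeEntry, run_branch, hw, hk, h00, h01, h10, hu, hv, val_xor, Net.finish, hz,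
            hz']

/-- Both source rows lie before the target row, so no overwritten cell is read and earlier rows
survive. -/
theorem addForms_spec {n w u v : ℕ} {φ χ : ℕ → ZMod 2} (hL : n < L) (hn : s.reg .n = n)
    (hw : s.reg .rowW = w * (n + 1)) (hu : s.reg .rowU = u * (n + 1)) (huw : u < w)
    (hv : s.reg .rowV = v * (n + 1)) (hvw : v < w)
    (hφ : ∀ j ≤ n, s.arr .form (u * (n + 1) + j) = (φ j).val)
    (hχ : ∀ j ≤ n, s.arr .form (v * (n + 1) + j) = (χ j).val) :
    (∀ j ≤ n, (run L addForms s).arr .form (w * (n + 1) + j) = (φ j + χ j).val) ∧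
    ∀ i < w, ∀ j ≤ n, (run L addForms s).arr .form (i * (n + 1) + j) =
      s.arr .form (i * (n + 1) + j) := by
  have lt : ∀ i < w, ∀ j ≤ n, i * (n + 1) + j < w * (n + 1) := by
    intro i hi j hj
    have : (i + 1) * (n + 1) ≤ w * (n + 1) := Nat.mul_le_mul_right _ hi
    rw [Nat.add_mul] at this
    omega
  have key := run_fill (L := L) (a := .form) (r := .rowW) (m := Var.n + 1)
    (e := .xor (.get .form (Var.rowU + Var.j)) (.get .form (Var.rowV + Var.j))) (s := s)
    (M := n + 1) (fun j => if j ≤ n then (φ j + χ j).val else 0) (by decide) (by omega)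
    (fun k t ht => by simp [ht.reg .n (by decide), hn])
    (fun k hk t ht => by
      have hk' : k ≤ n := by omega
      rw [if_pos hk']
      simp only [Exp.eval_xor, Exp.eval_get, Exp.eval_add, Exp.eval_var, ht.counter,
        ht.reg .rowU (by decide), ht.reg .rowV (by decide), hu, hv]
      rw [ht.cell _ (.inl (hw ▸ lt u huw k hk')), ht.cell _ (.inl (hw ▸ lt v hvw k hk')),
        hφ k hk', hχ k hk', val_xor])
  rw [hw] at key
  constructor
  · intro j hj
    rw [addForms, key, if_pos (by omega), Nat.add_sub_cancel_left, if_pos hj]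
  · intro i hi j hj
    rw [addForms, key, if_neg fun h => absurd h.1 (not_le.mpr (lt i hi j hj))]

/-- The entries of the first `k` wires are stored in memory. -/
structure EncodesTable (N : Net) (L : ℕ) (A : ℕ → ℕ → ZMod 2) (k : ℕ) (s : State) : Prop where
  static : Static N L s
  rows : EncodesRows N.n s A
  entry : ∀ w < k, EncodesEntry N.n s (N.tab A w) w

theorem _root_.AffineRefuter.EncodesEntry.of_eq {n w : ℕ} {s t : State} {e : Entry}
    (h : EncodesEntry n s e w)
    (h1 : ∀ a, a ≠ .form → t.arr a w = s.arr a w)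
    (h2 : ∀ j ≤ n, t.arr .form (w * (n + 1) + j) = s.arr .form (w * (n + 1) + j)) :
    EncodesEntry n t e w where
  root := by rw [h1 _ (by decide), h.root]
  sign := by rw [h1 _ (by decide), h.sign]
  aff := by rw [h1 _ (by decide), h.aff]
  live := by rw [h1 _ (by decide), h.live]
  left := by rw [h1 _ (by decide), h.left]
  right := by rw [h1 _ (by decide), h.right]
  cl := by rw [h1 _ (by decide), h.cl]
  cr := by rw [h1 _ (by decide), h.cr]
  form j hj := by rw [h2 j hj, h.form j hj]

theorem entry_spec {w : ℕ} (hw : s.reg .w = w) (hwN : w < N.wires)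
    (H : EncodesTable N L A w s) : EncodesTable N L A (w + 1) (run L entry s) := by
  have hL := H.static.wires_le
  -- the common final part
  have final : ∀ (t : State) (kind ρ u v : ℕ) (c d e : ZMod 2) (φ : ℕ → ZMod 2),
      EncodesTable N L A w t → kind ≤ 2 → t.reg .w = w → t.reg .kind = kind →
      t.reg .root = ρ → t.reg .u = u → t.reg .v = v → t.reg .g00 = c.val →
      t.reg .g01 = d.val → t.reg .g10 = e.val → t.reg .rowW = w * (N.n + 1) →
      (∀ j ≤ N.n, t.arr .form (w * (N.n + 1) + j) = (φ j).val) →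
      N.tab A w = Net.finish N.n w kind ρ c φ u v (c + d) (c + e) →
      EncodesTable N L A (w + 1) (run L storeEntry (run L testForm t)) := by
    intro t kind ρ u v c d e φ ht hk2 hw hk hρ hu hv h00 h01 h10 hrow hφ htab
    have hnz := testForm_spec (L := L) H.static.n_lt.le ht.static.n hrow hφ
    have harr : (run L testForm t).arr = t.arr := by
      funext a
      refine run_arr_of_not_stores ?_ t
      cases a <;> rfl
    obtain ⟨h1, h2⟩ := storeEntry_spec (L := L) (s := run L testForm t) (φ := φ)
      (ht.static.run (c := testForm) (by decide)).n
      ((run_reg_of_not_writes (by decide) _).trans hw)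
      ((run_reg_of_not_writes (by decide) _).trans hk) hk2
      ((run_reg_of_not_writes (by decide) _).trans hρ)
      ((run_reg_of_not_writes (by decide) _).trans hu)
      ((run_reg_of_not_writes (by decide) _).trans hv)
      ((run_reg_of_not_writes (by decide) _).trans h00)
      ((run_reg_of_not_writes (by decide) _).trans h01)
      ((run_reg_of_not_writes (by decide) _).trans h10) hnz
      ((run_reg_of_not_writes (by decide) _).trans hrow)
      (fun j hj => by rw [harr, hφ j hj])
    have hform : (run L storeEntry (run L testForm t)).arr .form = t.arr .form := by
      rw [run_arr_of_not_stores (by decide), harr]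
    refine ⟨(ht.static.run (by decide)).run (by decide), fun i hi j hj => ?_, fun w' hw' => ?_⟩
    · rw [hform, ht.rows i hi j hj]
    · rcases Nat.lt_succ_iff_lt_or_eq.mp hw' with h | rfl
      · exact (ht.entry w' h).of_eq (fun a _ => by rw [h2 a w' (by omega), harr])
          fun j _ => by rw [hform]
      · rw [htab]
        exact h1
  set s₁ := s.setReg .rowW (s.arr .row w) with hs₁
  have h₁ : EncodesTable N L A w s₁ :=
    ⟨H.static.of_eq rfl rfl rfl rfl rfl rfl rfl, H.rows,
      fun w' hw' => (H.entry w' hw').of_eq (fun _ _ => rfl) fun _ _ => rfl⟩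
  have hrow : s₁.reg .rowW = w * (N.n + 1) := H.static.row w (by omega)
  have hentry : run L entry s = run L storeEntry (run L testForm
      (if N.n - w ≠ 0 then (run L (block [set .kind 1, set .root 0, set .u 0, set .v 0, set .g00 0,
        set .g01 0, set .g10 0]) s₁) else
        run L classifyGate (run L addForms (run L loadGate s₁)))) := by
    have : Exp.eval s₁ (Var.n - Var.w) = N.n - w := by
      simp [hs₁, H.static.n, hw]
    rw [← this, hs₁, ← hw]
    rfl
  rw [hentry]
  split_ifs with hn
  · have hwn : w < N.n := by omega
    refine final _ 1 0 0 0 0 0 0 (A w) ?_ (by decide) (by simpa [hs₁] using hw) (by simp) (by simp)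
      (by simp) (by simp) (by simp) (by simp) (by simp) (by simpa using hrow)
      (fun j hj => H.rows w hwn j hj) (Net.tab_var hwn)
    exact ⟨h₁.static.run (by decide), h₁.rows,
      fun w' hw' => (h₁.entry w' hw').of_eq (fun _ _ => rfl) fun _ _ => rfl⟩
  · have hwn : N.n ≤ w := by omega
    have hw₁ : s₁.reg .w = w := by simpa [hs₁] using hw
    have hl := N.l_lt w hwn
    have hr := N.r_lt w hwn
    have hlr := Net.root_le (N := N) (A := A) (N.l w)
    have hrr := Net.root_le (N := N) (A := A) (N.r w)
    obtain ⟨l1, l2, l3, l4, l5, l6, l7, l8⟩ := loadGate_spec h₁.static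
      (fun w' h => h₁.entry w' (hw₁ ▸ h)) (hw₁ ▸ hwn) (hw₁ ▸ hwN)
    rw [hw₁] at l1 l2 l3 l4 l5 l6 l7 l8
    set s₂ := run L loadGate s₁ with hs₂
    have harr₂ : s₂.arr = s₁.arr := by
      funext a
      refine run_arr_of_not_stores ?_ s₁
      cases a <;> rfl
    have hrow₂ : s₂.reg .rowW = w * (N.n + 1) :=
      (run_reg_of_not_writes (by decide) _).trans hrow
    have st₂ : Static N L s₂ := h₁.static.run (by decide)
    -- For a constant argument the truncated subtraction points to wire 0. This is harmless: such a
    -- gate is classified as degenerate before the affine flags are consulted.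
    set x := (N.tab A (N.l w)).root - 1 with hx
    set y := (N.tab A (N.r w)).root - 1 with hy
    obtain ⟨f1, f2⟩ := addForms_spec (L := L) H.static.n_lt st₂.n hrow₂ l7
      (show x < w by omega) l8 (show y < w by omega)
      (fun j hj => by rw [harr₂]; exact (h₁.entry x (by omega)).form j hj)
      (fun j hj => by rw [harr₂]; exact (h₁.entry y (by omega)).form j hj)
    set s₃ := run L addForms s₂ with hs₃
    have hreg₃ : ∀ r ≠ Var.j, s₃.reg r = s₂.reg r := by
      intro r hr
      refine run_reg_of_not_writes ?_ s₂
      simpa [addForms, fill, writes, Cmd.when] using hr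
    have harr₃ : ∀ a ≠ Arr.form, s₃.arr a = s₁.arr a := by
      intro a ha
      rw [← harr₂]
      refine run_arr_of_not_stores ?_ s₂
      simpa [addForms, fill, stores, Cmd.when] using ha
    have h₃ : EncodesTable N L A w s₃ := by
      refine ⟨st₂.run (by decide), fun i hi j hj => ?_, fun w' hw' => ?_⟩
      · rw [f2 i (by omega) j hj, harr₂, h₁.rows i hi j hj]
      · exact (h₁.entry w' hw').of_eq (fun a ha => by rw [harr₃ a ha])
          fun j hj => by rw [f2 w' hw' j hj, harr₂]
    obtain ⟨c1, c2⟩ := classifyGate_spec (L := L) (s := s₃)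
      ((hreg₃ _ (by decide)).trans l1) ((hreg₃ _ (by decide)).trans l2)
      ((hreg₃ _ (by decide)).trans l3) ((hreg₃ _ (by decide)).trans l4)
      ((hreg₃ _ (by decide)).trans l5) ((hreg₃ _ (by decide)).trans l6)
      (h₃.entry x (by omega)).aff (h₃.entry y (by omega)).aff
    have keep : ∀ r, r ≠ .kind → r ≠ .root → (run L classifyGate s₃).reg r = s₃.reg r := by
      intro r h1 h2
      refine run_reg_of_not_writes ?_ s₃
      simp [classifyGate, block, writes, Cmd.when, h1, h2]
    have harr₄ : (run L classifyGate s₃).arr = s₃.arr := by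
      funext a
      refine run_arr_of_not_stores ?_ s₃
      cases a <;> rfl
    have hk2 : (N.cls A w).1 ≤ 2 := by
      by_cases h0 : (N.cls A w).1 = 0
      · omega
      · rcases (classify_gate h0).2.2.2.2.2 with h | h
        · exact h.1.le.trans (by decide)
        · exact h.1.le
    have k' : ∀ r, r ≠ .kind → r ≠ .root → r ≠ .j →
        (run L classifyGate s₃).reg r = s₂.reg r :=
      fun r h1 h2 h3 => (keep r h1 h2).trans (hreg₃ r h3)
    refine final _ _ _ _ _ _ _ _ _ ?_ hk2 ?_ c1 c2
      ((k' _ (by decide) (by decide) (by decide)).trans l1)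
      ((k' _ (by decide) (by decide) (by decide)).trans l2)
      ((k' _ (by decide) (by decide) (by decide)).trans l3)
      ((k' _ (by decide) (by decide) (by decide)).trans l4)
      ((k' _ (by decide) (by decide) (by decide)).trans l5)
      ((k' _ (by decide) (by decide) (by decide)).trans hrow₂)
      (fun j hj => by rw [harr₄]; exact f1 j hj) (Net.tab_gate hwn)
    · exact ⟨h₃.static.run (by decide), fun i hi j hj => by rw [harr₄, h₃.rows i hi j hj],
        fun w' hw' => (h₃.entry w' hw').of_eq (fun a _ => by rw [harr₄])
          fun j _ => by rw [harr₄]⟩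
    · rw [k' _ (by decide) (by decide) (by decide)]
      exact (run_reg_of_not_writes (by decide) _).trans hw₁

theorem table_spec (hs : Static N L s) (hA : EncodesRows N.n s A) :
    EncodesTable N L A N.wires (run L table s) := by
  have key := run_rep_of_invariant (L := L) (r := .w) (c := when (Var.wires - Var.w) entry)
    (s := s) (fun k t => EncodesTable N L A (min k N.wires) t)
    ⟨hs, hA, fun w hw => by omega⟩ ?_
  · rwa [min_eq_right hs.wires_le] at key
  · rintro k - t ht
    have ht' : EncodesTable N L A (min k N.wires) (t.setReg .w k) :=
      ⟨ht.static.of_eq rfl rfl rfl rfl rfl rfl rfl, ht.rows,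
        fun w' hw' => (ht.entry w' hw').of_eq (fun _ _ => rfl) fun _ _ => rfl⟩
    rw [run_when]
    simp only [Exp.eval_sub, Exp.eval_var, ht'.static.wires]
    simp only [State.setReg_reg, if_true]
    split_ifs with hk
    · rw [min_eq_left (by omega)] at ht' ⊢
      exact entry_spec (by simp) (by omega) ht'
    · rw [min_eq_right (by omega)] at ht' ⊢
      exact ht'

end Refuter


namespace Refuter

open Cmd

variable {N : Net} {A : ℕ → ℕ → ZMod 2} {L : ℕ} {s : State}

/-! ### The choice of a root and the substitution -/

/-- Mark the used roots; afterwards `sel` is `a + 1` for the first used live gate `a`, if any. -/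
def mark : Cmd := block [
  set .tmp 0,
  fill .mark .tmp Var.len 0,
  set .sel 0,
  set .val (.get .root Var.out),
  when Var.val (put .mark (Var.val - 1) 1),
  rep .i (when (Var.wires - Var.i) (block [
    set .w (Var.wires - 1 - Var.i),
    when (.get .mark Var.w) (when (.get .live Var.w) (block [
      put .mark (.get .left Var.w - 1) 1,
      put .mark (.get .right Var.w - 1) 1,
      set .sel (Var.w + 1)]))]))]

/-- Test whether the right argument of the gate `acc` has another reader. -/
def testReaders : Cmd := block [
  set .other 0,
  rep .w (when (Var.wires - Var.w) (when (.get .mark Var.w) (when (.get .live Var.w)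
    (when (.xor Var.w Var.acc)
      (when ((1 - .xor (.get .left Var.w) (.get .right Var.acc)) +
          (1 - .xor (.get .right Var.w) (.get .right Var.acc)))
        (set .other 1))))))]

/-- Choose the root `fix` to be fixed and its value `val`. -/
def choose : Cmd :=
  branch Var.sel
    (block [
      set .acc (Var.sel - 1),
      testReaders,
      branch Var.other
        (block [set .fix (.get .right Var.acc - 1), set .val (.get .cr Var.acc)])
        (block [set .fix (.get .left Var.acc - 1), set .val (.get .cl Var.acc)])])
    (block [set .fix (.get .root Var.out - 1), set .val 0])

/-- Choose a coordinate of the form of the root `fix`, and store the equation that fixes the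
root. -/
def equation : Cmd := block [
  set .rowU (.get .row Var.fix),
  rep .j (when (Var.n - Var.j) (when (.get .form (Var.rowU + Var.j)) (set .pivot Var.j))),
  set .tmp 0,
  fill .psi .tmp (Var.n + 1) (.get .form (Var.rowU + Var.j)),
  put .psi Var.n (.xor (.get .psi Var.n) Var.val)]

/-- Eliminate the coordinate `pivot`. -/
def eliminate : Cmd :=
  rep .i (when (Var.n - Var.i) (block [
    set .rowW (.get .row Var.i),
    when (.get .form (Var.rowW + Var.pivot))
      (fill .form .rowW (Var.n + 1)
        (Exp.xor (.get .form (Var.rowW + Var.j)) (.get .psi Var.j)))]))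

/-- One round. -/
def round : Cmd := block [
  table,
  when (.get .root Var.out) (block [mark, choose, equation, eliminate])]

/-- The used roots are marked. -/
structure Marked (N : Net) (A : ℕ → ℕ → ZMod 2) (s : State) : Prop where
  mark : ∀ c < N.wires, s.arr .mark c ≠ 0 ↔ N.Used A c
  sel : s.reg .sel = 0 ∧ (∀ b, N.Used A b → ¬(N.tab A b).live = true) ∨
    ∃ a, s.reg .sel = a + 1 ∧ N.Used A a ∧ (N.tab A a).live = true ∧
      ∀ b < a, N.Used A b → ¬(N.tab A b).live = true

theorem _root_.AffineRefuter.Net.Used.lt_wires {w : ℕ} (h : N.Used A w) : w < N.wires :=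
  h.le_out.trans_lt N.out_lt

theorem toNat_ne_zero (b : Bool) : b.toNat ≠ 0 ↔ b = true := by
  cases b <;> simp

/-- Readers have larger numbers than what they read, so one downward sweep is enough: a mark is
final when its wire is reached. Each used live gate overwrites `sel`, so the smallest one remains.
-/
theorem mark_spec (H : EncodesTable N L A N.wires s) : Marked N A (run L mark s) := by
  have hL := H.static.wires_le
  set s₁ := s.setReg .tmp 0 with hs₁
  have hclear := run_fill (L := L) (a := .mark) (r := .tmp) (m := Var.len) (e := 0) (s := s₁)
    (M := L) (fun _ => 0) (by decide) le_rfl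
    (fun k t ht => by simp [ht.reg .len (by decide), hs₁, H.static.len])
    (fun k hk t ht => by simp)
  set s₂ := run L (fill .mark .tmp Var.len 0) s₁ with hs₂
  have hreg₂ : ∀ r, r ≠ .j → r ≠ .tmp → s₂.reg r = s.reg r := by
    intro r hr hr'
    rw [hs₂, run_reg_of_not_writes (by simpa [fill, writes, Cmd.when] using hr), hs₁]
    simp [hr']
  have harr₂ : ∀ a ≠ Arr.mark, s₂.arr a = s.arr a := by
    intro a ha
    rw [hs₂, run_arr_of_not_stores (by simpa [fill, stores, Cmd.when] using ha), hs₁]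
    rfl
  set body := when (Var.wires - Var.i) (block [
    set .w (Var.wires - 1 - Var.i),
    when (.get .mark Var.w) (when (.get .live Var.w) (block [
      put .mark (.get .left Var.w - 1) 1,
      put .mark (.get .right Var.w - 1) 1,
      set .sel (Var.w + 1)]))]) with hbody
  set s₃ := run L (when Var.val (put .mark (Var.val - 1) 1))
    ((s₂.setReg .sel 0).setReg .val ((N.tab A N.out).root)) with hs₃
  have hrun : run L mark s = run L (rep .i body) s₃ := by
    have : s₂.arr .root (s₂.reg .out) = (N.tab A N.out).root := by
      rw [harr₂ _ (by decide), hreg₂ _ (by decide) (by decide), H.static.out,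
        (H.entry N.out N.out_lt).root]
    rw [hs₃, ← this]
    rfl
  have hwires₃ : s₃.reg .wires = N.wires := by
    rw [hs₃, run_reg_of_not_writes (by decide)]
    simp [hreg₂, H.static.wires]
  have hsel₃ : s₃.reg .sel = 0 := by
    rw [hs₃, run_reg_of_not_writes (by decide)]
    simp
  have harr₃ : ∀ a ≠ Arr.mark, s₃.arr a = s.arr a := by
    intro a ha
    rw [hs₃, run_arr_of_not_stores (by simpa [stores, Cmd.when] using ha)]
    exact harr₂ a ha
  have hmark₃ : ∀ c < N.wires, s₃.arr .mark c ≠ 0 ↔ (N.tab A N.out).root = c + 1 := by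
    intro c hc
    have h0 : s₂.arr .mark c = 0 := by
      rw [hclear, hs₁]
      simp [show c < L by omega]
    by_cases hr : (N.tab A N.out).root = 0
    · simp [hs₃, run_when, hr, h0]
    · by_cases hcr : c = (N.tab A N.out).root - 1
      · simp [hs₃, run_when, hr, hcr]
        omega
      · simp [hs₃, run_when, hr, hcr, h0]
        omega
  have key := run_rep_of_invariant (L := L) (r := .i) (c := body)
    (s := s₃) (fun k t => t.reg .wires = N.wires ∧ (∀ a ≠ Arr.mark, t.arr a = s.arr a) ∧
      (∀ c < N.wires, t.arr .mark c ≠ 0 ↔ ((N.tab A N.out).root = c + 1 ∨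
        ∃ b, N.wires - k ≤ b ∧ N.Used A b ∧ N.Reads A b c)) ∧
      (t.reg .sel = 0 ∧ (∀ b, N.wires - k ≤ b → N.Used A b → ¬(N.tab A b).live = true) ∨
      ∃ a, N.wires - k ≤ a ∧ t.reg .sel = a + 1 ∧ N.Used A a ∧ (N.tab A a).live = true ∧
      ∀ b < a, N.wires - k ≤ b → N.Used A b → ¬(N.tab A b).live = true))
    ⟨hwires₃, harr₃, fun c hc => by
        rw [hmark₃ c hc]
        refine ⟨.inl, fun h => h.resolve_right ?_⟩
        rintro ⟨b, h1, h2, -⟩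
        have := h2.lt_wires
        omega, .inl ⟨hsel₃, fun b h1 h2 => by
          have := h2.lt_wires
          omega⟩⟩ ?_
  · rw [hrun]
    obtain ⟨-, -, h1, h2⟩ := key
    rw [Nat.sub_eq_zero_of_le hL] at h1 h2
    refine ⟨fun c hc => ?_, ?_⟩
    · rw [h1 c hc]
      constructor
      · rintro (h | ⟨b, -, h3, h4⟩)
        · exact .out h
        · exact h3.reads h4
      · intro h
        rcases h.cases_out with h | ⟨b, h3, h4⟩
        · exact .inl h
        · exact .inr ⟨b, Nat.zero_le _, h3, h4⟩
    · rcases h2 with ⟨h3, h4⟩ | ⟨a, -, h3, h4, h5, h6⟩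
      · exact .inl ⟨h3, fun b => h4 b (Nat.zero_le _)⟩
      · exact .inr ⟨a, h3, h4, h5, fun b hb => h6 b hb (Nat.zero_le _)⟩
  · rintro k - t ⟨t1, t2, t3, t4⟩
    by_cases hk : k < N.wires
    · obtain ⟨w, hw⟩ : ∃ w, N.wires - k = w + 1 := ⟨N.wires - k - 1, by omega⟩
      have hw' : N.wires - (k + 1) = w := by omega
      have hw'' : N.wires - 1 - k = w := by omega
      have hwN : w < N.wires := by omega
      rw [hw] at t3 t4
      rw [hw']
      have hlive : t.arr .live w = (N.tab A w).live.toNat := by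
        rw [t2 _ (by decide), (H.entry w hwN).live]
      have hleft : t.arr .left w = (N.tab A w).u := by
        rw [t2 _ (by decide), (H.entry w hwN).left]
      have hright : t.arr .right w = (N.tab A w).v := by
        rw [t2 _ (by decide), (H.entry w hwN).right]
      have hmarkw : t.arr .mark w ≠ 0 ↔ N.Used A w := by
        rw [t3 w hwN]
        constructor
        · rintro (h | ⟨b, -, h3, h4⟩)
          · exact .out h
          · exact h3.reads h4
        · intro h
          rcases h.cases_out with h | ⟨b, h3, h4⟩
          · exact .inl h
          · exact .inr ⟨b, h4.lt, h3, h4⟩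
      by_cases hul : N.Used A w ∧ (N.tab A w).live = true
      · obtain ⟨hu, hl⟩ := hul
        have hm := hmarkw.mpr hu
        obtain ⟨x, y, hx, hy, hxy, rx, ry⟩ := Net.Reads.root_cases hl
        have hwn := (Net.live_iff.mp hl).1
        rw [Net.u_gate hwn, hx] at hleft
        rw [Net.v_gate hwn, hy] at hright
        have hrun' : run L body (t.setReg .i k) =
            (((((t.setReg .i k).setReg .w w).setArr .mark x 1).setArr .mark y 1).setReg .sel
              (w + 1)) := by
          simp [hbody, run_when, t1, hw, hw'', hm, hlive, hl, hleft, hright]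
        rw [hrun']
        refine ⟨by simpa using t1, fun a ha => ?_, fun c hc => ?_, ?_⟩
        · funext i
          simp [ha, t2]
        · have hreads : ∀ c, N.Reads A w c ↔ c = x ∨ c = y := by
            intro c
            constructor
            · rintro ⟨-, h | h⟩ <;> omega
            · rintro (rfl | rfl)
              · exact rx
              · exact ry
          have e : (((((t.setReg .i k).setReg .w w).setArr .mark x 1).setArr .mark y 1).setReg .sel
              (w + 1)).arr .mark c = if c = y then 1 else if c = x then 1 else t.arr .mark c := by
            simp
          rw [e]
          by_cases hcxy : c = x ∨ c = y
          · refine ⟨fun _ => .inr ⟨w, le_rfl, hu, (hreads c).mpr hcxy⟩, fun _ => ?_⟩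
            split_ifs <;> simp_all
          · rw [not_or] at hcxy
            rw [if_neg hcxy.2, if_neg hcxy.1, t3 c hc]
            refine or_congr_right ⟨?_, ?_⟩
            · rintro ⟨b, h1, h2⟩
              exact ⟨b, by omega, h2⟩
            · rintro ⟨b, h1, h2, h3⟩
              rcases Nat.lt_or_eq_of_le h1 with h | rfl
              · exact ⟨b, h, h2, h3⟩
              · rw [hreads] at h3
                tauto
        · exact .inr ⟨w, le_rfl, by simp, hu, hl, fun b h1 h2 => by omega⟩
      · have hrun' : run L body (t.setReg .i k) = ((t.setReg .i k).setReg .w w) := by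
          by_cases hm : t.arr .mark w = 0
          · simp [hbody, run_when, t1, hw, hw'', hm]
          · have hl : (N.tab A w).live = false := by
              simpa using fun h => hul ⟨hmarkw.mp hm, h⟩
            simp [hbody, run_when, t1, hw, hw'', hlive, hl]
        rw [hrun']
        refine ⟨by simpa using t1, t2, fun c hc => ?_, ?_⟩
        · rw [show ((t.setReg .i k).setReg .w w).arr .mark c = t.arr .mark c from rfl, t3 c hc]
          refine or_congr_right ⟨?_, ?_⟩
          · rintro ⟨b, h1, h2⟩
            exact ⟨b, by omega, h2⟩
          · rintro ⟨b, h1, h2, h3⟩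
            rcases Nat.lt_or_eq_of_le h1 with h | rfl
            · exact ⟨b, h, h2, h3⟩
            · exact absurd ⟨h2, h3.1⟩ hul
        · have e : ((t.setReg .i k).setReg .w w).reg .sel = t.reg .sel := by simp
          rw [e]
          have step : ∀ b, w ≤ b → N.Used A b → (N.tab A b).live = true → w + 1 ≤ b := by
            intro b h1 h2 h3
            rcases Nat.lt_or_eq_of_le h1 with h | rfl
            · exact h
            · exact absurd ⟨h2, h3⟩ hul
          rcases t4 with ⟨h3, h4⟩ | ⟨a, h2, h3, h4, h5, h6⟩
          · exact .inl ⟨h3, fun b h1 h2 hl => h4 b (step b h1 h2 hl) h2 hl⟩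
          · exact .inr ⟨a, by omega, h3, h4, h5,
              fun b h1 h2 h7 hl => h6 b h1 (step b h2 h7 hl) h7 hl⟩
    · have hrun' : run L body (t.setReg .i k) = t.setReg .i k := by
        have : N.wires - k = 0 := by omega
        simp [hbody, run_when, t1, this]
      rw [hrun', show N.wires - (k + 1) = N.wires - k by omega]
      exact ⟨by simpa using t1, t2, t3, by simpa using t4⟩

end Refuter


/-! ### Correctness of the choice, of the elimination and of a round. -/

namespace Refuter

open Cmd

variable {N : Net} {A : ℕ → ℕ → ZMod 2} {L : ℕ} {s : State}

/-- The command changes neither the table nor what is kept after the setup. -/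
def KeepsTable (c : Cmd) : Bool :=
  c.KeepsStatic && !(c.stores .root || c.stores .sign || c.stores .aff || c.stores .live ||
    c.stores .left || c.stores .right || c.stores .cl || c.stores .cr || c.stores .form)

theorem EncodesTable.run {k : ℕ} {c : Cmd} (h : EncodesTable N L A k s)
    (hc : KeepsTable c = true) : EncodesTable N L A k (run L c s) := by
  simp only [KeepsTable, Bool.and_eq_true, Bool.not_eq_true', Bool.or_eq_false_iff] at hc
  obtain ⟨h0, ⟨⟨⟨⟨⟨⟨⟨h1, h2⟩, h3⟩, h4⟩, h5⟩, h6⟩, h7⟩, h8⟩, h9⟩ := hc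
  refine ⟨h.static.run h0, fun i hi j hj => ?_, fun w hw => ?_⟩
  · rw [run_arr_of_not_stores h9, h.rows i hi j hj]
  · have e := h.entry w hw
    exact ⟨by rw [run_arr_of_not_stores h1, e.root], by rw [run_arr_of_not_stores h2, e.sign],
      by rw [run_arr_of_not_stores h3, e.aff], by rw [run_arr_of_not_stores h4, e.live],
      by rw [run_arr_of_not_stores h5, e.left], by rw [run_arr_of_not_stores h6, e.right],
      by rw [run_arr_of_not_stores h7, e.cl], by rw [run_arr_of_not_stores h8, e.cr],
      fun j hj => by rw [run_arr_of_not_stores h9, e.form j hj]⟩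

theorem EncodesTable.setReg {k : ℕ} (h : EncodesTable N L A k s) {r : Var} (x : ℕ)
    (hr : r ≠ .len ∧ r ≠ .n ∧ r ≠ .wires ∧ r ≠ .out ∧ r ≠ .base) :
    EncodesTable N L A k (s.setReg r x) :=
  ⟨h.static.of_eq (if_neg hr.1.symm) (if_neg hr.2.1.symm) (if_neg hr.2.2.1.symm)
    (if_neg hr.2.2.2.1.symm) (if_neg hr.2.2.2.2.symm) rfl rfl, h.rows,
    fun w hw => (h.entry w hw).of_eq (fun _ _ => rfl) fun _ _ => rfl⟩

theorem testReaders_spec (H : EncodesTable N L A N.wires s)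
    (hmark : ∀ c < N.wires, s.arr .mark c ≠ 0 ↔ N.Used A c) {a : ℕ} (ha : s.reg .acc = a)
    (haN : a < N.wires) : (run L testReaders s).reg .other ≠ 0 ↔
      ∃ b, b ≠ a ∧ N.Used A b ∧ (N.tab A b).live = true ∧
        ((N.tab A b).u = (N.tab A a).v ∨ (N.tab A b).v = (N.tab A a).v) := by
  set body := when (Var.wires - Var.w) (when (.get .mark Var.w) (when (.get .live Var.w)
    (when (.xor Var.w Var.acc)
      (when ((1 - .xor (.get .left Var.w) (.get .right Var.acc)) +
          (1 - .xor (.get .right Var.w) (.get .right Var.acc)))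
        (set .other 1))))) with hbody
  have e : ∀ x y : ℕ, x - y + (y - x) = 0 ↔ x = y := by omega
  have e1 : ∀ x : ℕ, 1 - x = 0 ↔ x ≠ 0 := by omega
  have key := run_rep_of_invariant (L := L) (r := .w) (c := body)
    (s := s.setReg .other 0) (fun k t => t.arr = s.arr ∧ t.reg .wires = N.wires ∧
      t.reg .acc = a ∧ (t.reg .other ≠ 0 ↔
      ∃ b, b < k ∧ b ≠ a ∧ N.Used A b ∧ (N.tab A b).live = true ∧
        ((N.tab A b).u = (N.tab A a).v ∨ (N.tab A b).v = (N.tab A a).v)))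
    ⟨rfl, by simp [H.static.wires], by simp [ha], by simp⟩ ?_
  · have hL := H.static.wires_le
    refine key.2.2.2.trans ⟨?_, ?_⟩
    · rintro ⟨b, -, h⟩
      exact ⟨b, h⟩
    · rintro ⟨b, h1, h2, h3⟩
      exact ⟨b, h2.lt_wires.trans_le hL, h1, h2, h3⟩
  · rintro k - t ⟨t1, t2, t3, t4⟩
    have step : ∀ P : ℕ → Prop, (∃ b, b < k + 1 ∧ P b) ↔ P k ∨ ∃ b, b < k ∧ P b := by
      intro P
      constructor
      · rintro ⟨b, h1, h2⟩
        rcases Nat.lt_succ_iff_lt_or_eq.mp h1 with h | rfl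
        · exact .inr ⟨b, h, h2⟩
        · exact .inl h2
      · rintro (h | ⟨b, h1, h2⟩)
        · exact ⟨k, by omega, h⟩
        · exact ⟨b, by omega, h2⟩
    rw [step]
    by_cases hP : k ≠ a ∧ N.Used A k ∧ (N.tab A k).live = true ∧
        ((N.tab A k).u = (N.tab A a).v ∨ (N.tab A k).v = (N.tab A a).v)
    · obtain ⟨h1, h2, h3, h4⟩ := hP
      have hk := h2.lt_wires
      have hk0 : N.wires - k ≠ 0 := by omega
      have hrun : run L body (t.setReg .w k) = (t.setReg .w k).setReg .other 1 := by
        simp only [hbody, run_when, Exp.eval_sub, Exp.eval_var, Exp.eval_add, Exp.eval_xor,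
          Exp.eval_get, Exp.eval_ofNat, State.setReg_reg, State.setReg_arr, if_true, reduceCtorEq,
          if_false, t1, t2, t3, (H.entry k hk).live, (H.entry k hk).left, (H.entry k hk).right,
          (H.entry a haN).right, ne_eq, e, h3, h1, hk0, Nat.add_eq_zero_iff, e1, not_and_or,
          not_not, h4, run_set]
        rw [if_pos (not_false), if_pos ((hmark k hk).mpr h2), if_pos (by decide), if_pos not_false]
      rw [hrun]
      refine ⟨t1, by simp [t2], by simp [t3], ?_⟩
      simp only [State.setReg_reg, if_true]
      exact ⟨fun _ => .inl ⟨h1, h2, h3, h4⟩, fun _ => one_ne_zero⟩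
    · have hrun : run L body (t.setReg .w k) = t.setReg .w k := by
        simp only [hbody, run_when, Exp.eval_sub, Exp.eval_var, Exp.eval_add, Exp.eval_xor,
          Exp.eval_get, Exp.eval_ofNat, State.setReg_reg, State.setReg_arr, if_true, reduceCtorEq,
          if_false, t1, t2, t3]
        split_ifs with h1 h2 h3 h4 h5 <;> try rfl
        have hk : k < N.wires := by omega
        rw [(H.entry k hk).left, (H.entry k hk).right, (H.entry a haN).right] at h5
        rw [(H.entry k hk).live] at h3
        refine absurd ⟨by omega, (hmark k hk).mp h2, (toNat_ne_zero _).mp h3, ?_⟩ hP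
        omega
      rw [hrun]
      refine ⟨t1, by simp [t2], by simp [t3], ?_⟩
      simp only [State.setReg_reg, reduceCtorEq, if_false]
      rw [t4]
      exact ⟨.inr, fun h => h.resolve_left hP⟩

theorem choose_spec (H : EncodesTable N L A N.wires s) (hM : Marked N A s)
    (hout : (N.tab A N.out).root ≠ 0) : ∃ x c, N.Choice A x c ∧
      (run L choose s).reg .fix = x ∧ (run L choose s).reg .val = c.val := by
  rcases hM.sel with ⟨h0, hlive⟩ | ⟨a, hsel, ha, hl, hmin⟩
  · obtain ⟨o, ho⟩ := Nat.exists_eq_succ_of_ne_zero hout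
    refine ⟨o, 0, .inl ⟨hlive, ho, rfl⟩, ?_⟩
    simp [choose, run_branch, h0, H.static.out, (H.entry N.out N.out_lt).root, ho]
  · have hn := (Net.live_iff.mp hl).1
    have haN := ha.lt_wires
    obtain ⟨x, y, hx, hy, hxy, rx, ry⟩ := Net.Reads.root_cases hl
    have hua := Net.u_gate (A := A) hn
    have hva := Net.v_gate (A := A) hn
    rw [hx] at hua
    rw [hy] at hva
    set s₁ := s.setReg .acc a with hs₁
    have H₁ : EncodesTable N L A N.wires s₁ := H.setReg a (by decide)
    have hother := testReaders_spec H₁ hM.mark (a := a) (by simp [hs₁]) haN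
    set s₂ := run L testReaders s₁ with hs₂
    have H₂ : EncodesTable N L A N.wires s₂ := H₁.run (by decide)
    have hacc : s₂.reg .acc = a := by
      rw [hs₂, run_reg_of_not_writes (by decide), hs₁]
      simp
    have hrun : run L choose s = run L (branch Var.other
        (block [set .fix (.get .right Var.acc - 1), set .val (.get .cr Var.acc)])
        (block [set .fix (.get .left Var.acc - 1), set .val (.get .cl Var.acc)])) s₂ := by
      have e : Exp.eval s (Var.sel - 1) = a := by simp [hsel]
      rw [hs₂, hs₁, ← e, choose, run_branch, if_pos (by simp [hsel])]
      rfl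
    rw [hrun]
    have hreads : ∀ b, N.Used A b ∧ (N.tab A b).live = true ∧
        ((N.tab A b).u = (N.tab A a).v ∨ (N.tab A b).v = (N.tab A a).v) ↔
        N.Used A b ∧ N.Reads A b y := by
      intro b
      refine and_congr_right fun _ => ⟨?_, ?_⟩
      · rintro ⟨h1, h2⟩
        have hb := (Net.live_iff.mp h1).1
        rw [Net.u_gate hb, Net.v_gate hb, hva] at h2
        exact ⟨h1, h2⟩
      · rintro ⟨h1, h2⟩
        have hb := (Net.live_iff.mp h1).1
        rw [Net.u_gate hb, Net.v_gate hb, hva]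
        exact ⟨h1, h2⟩
    simp only [hreads] at hother
    by_cases ho : s₂.reg .other ≠ 0
    · refine ⟨y, (N.tab A a).cr, .inr ⟨a, ha, hl, hmin, .inl ⟨hother.mp ho, hva, rfl⟩⟩, ?_⟩
      simp [run_branch, ho, hacc, (H₂.entry a haN).right, (H₂.entry a haN).cr, hva]
    · refine ⟨x, (N.tab A a).cl, .inr ⟨a, ha, hl, hmin, .inr ⟨?_, hua, rfl⟩⟩, ?_⟩
      · intro b z h1 h2 h3
        by_contra hba
        obtain rfl : y = z := by omega
        exact ho (hother.mpr ⟨b, hba, h1, h3⟩)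
      · rw [not_not] at ho
        simp [run_branch, ho, hacc, (H₂.entry a haN).left, (H₂.entry a haN).cl, hua]

theorem equation_spec (H : EncodesTable N L A N.wires s) {x : ℕ} {c : ZMod 2}
    (hx : s.reg .fix = x) (hc : s.reg .val = c.val) (hxN : x < N.wires)
    (hp : ∃ p < N.n, (N.tab A x).form p ≠ 0) :
    (run L equation s).reg .pivot < N.n ∧
    (N.tab A x).form ((run L equation s).reg .pivot) ≠ 0 ∧
    ∀ j ≤ N.n, (run L equation s).arr .psi j = (N.equation A x c j).val := by
  have hL := H.static.wires_le
  have hform := (H.entry x hxN).form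
  set s₁ := s.setReg .rowU (s.arr .row (s.reg .fix)) with hs₁
  have hrow : s₁.reg .rowU = x * (N.n + 1) := by
    rw [hs₁, hx, H.static.row x (by omega)]
    simp
  set body := when (Var.n - Var.j) (when (.get .form (Var.rowU + Var.j)) (set .pivot Var.j))
    with hbody
  have key := run_rep_of_invariant (L := L) (r := .j) (c := body) (s := s₁)
    (fun k t => t.arr = s.arr ∧ t.reg .n = N.n ∧ t.reg .rowU = x * (N.n + 1) ∧
      ((∃ p < min k N.n, (N.tab A x).form p ≠ 0) → t.reg .pivot < N.n ∧
        (N.tab A x).form (t.reg .pivot) ≠ 0))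
    ⟨rfl, by simp [hs₁, H.static.n], hrow, by rintro ⟨p, hp, -⟩; omega⟩ ?_
  · set s₂ := run L (rep .j body) s₁ with hs₂
    obtain ⟨k1, k2, k3, k4⟩ := key
    rw [min_eq_right H.static.n_lt.le] at k4
    obtain ⟨p1, p2⟩ := k4 hp
    have hval : s₂.reg .val = c.val := by
      rw [hs₂, run_reg_of_not_writes (by decide), hs₁]
      simpa using hc
    have hfill := run_fill (L := L) (a := .psi) (r := .tmp) (m := Var.n + 1)
      (e := .get .form (Var.rowU + Var.j)) (s := s₂.setReg .tmp 0) (M := N.n + 1)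
      (fun j => s.arr .form (x * (N.n + 1) + j)) (by decide) H.static.n_lt
      (fun k t ht => by simp [ht.reg .n (by decide), k2])
      (fun k hk t ht => by
        simp [ht.reg .rowU (by decide), ht.counter, ht.arr .form (by decide), k1, k3])
    set s₃ := run L (fill .psi .tmp (Var.n + 1) (.get .form (Var.rowU + Var.j)))
      (s₂.setReg .tmp 0) with hs₃
    have hrun : run L equation s =
        s₃.setArr .psi (s₃.reg .n) ((s₃.arr .psi (s₃.reg .n) - s₃.reg .val) +
          (s₃.reg .val - s₃.arr .psi (s₃.reg .n))) := rfl
    have hn₃ : s₃.reg .n = N.n := by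
      rw [hs₃, run_reg_of_not_writes (by decide)]
      simpa using k2
    have hval₃ : s₃.reg .val = c.val := by
      rw [hs₃, run_reg_of_not_writes (by decide)]
      simpa using hval
    have hpivot : (run L equation s).reg .pivot = s₂.reg .pivot := by
      rw [hrun, State.setArr_reg, hs₃, run_reg_of_not_writes (by decide)]
      simp
    have hpsi : ∀ j ≤ N.n, s₃.arr .psi j = ((N.tab A x).form j).val := by
      intro j hj
      rw [hfill, if_pos (by simp; omega), ← hform j hj]
      simp
    rw [hpivot]
    refine ⟨p1, p2, fun j hj => ?_⟩
    rw [hrun, State.setArr_arr, hn₃, hval₃, hpsi _ le_rfl, val_xor, Net.equation]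
    by_cases hjn : j = N.n
    · subst hjn
      simp
    · rw [if_neg fun h => hjn h.2, if_neg hjn, hpsi j hj]
  · rintro k - t ⟨t1, t2, t3, t4⟩
    by_cases hk : k < N.n
    · have hk0 : N.n - k ≠ 0 := by omega
      have hk1 : Exp.eval (t.setReg .j k) (.get .form (Var.rowU + Var.j)) =
          ((N.tab A x).form k).val := by
        rw [← hform k hk.le]
        simp [t1, t3]
      by_cases hz : (N.tab A x).form k = 0
      · have hrun : run L body (t.setReg .j k) = t.setReg .j k := by
          rw [hbody, run_when, run_when, hk1, hz]
          simp
        rw [hrun]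
        refine ⟨t1, by simp [t2], by simp [t3], ?_⟩
        rintro ⟨p, h1, h2⟩
        have : p ≠ k := fun h => h2 (h ▸ hz)
        simpa using t4 ⟨p, by omega, h2⟩
      · have hrun : run L body (t.setReg .j k) = (t.setReg .j k).setReg .pivot k := by
          rw [hbody, run_when, run_when, hk1, if_pos (by simpa [t2] using hk0),
            if_pos (by rwa [ne_eq, val_eq_zero_iff])]
          simp
        rw [hrun]
        exact ⟨t1, by simp [t2], by simp [t3], fun _ => by simpa using ⟨hk, hz⟩⟩
    · have hrun : run L body (t.setReg .j k) = t.setReg .j k := by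
        have : N.n - k = 0 := by omega
        simp [hbody, run_when, t2, this]
      rw [hrun]
      refine ⟨t1, by simp [t2], by simp [t3], ?_⟩
      rintro ⟨p, h1, h2⟩
      simpa using t4 ⟨p, by omega, h2⟩

/-- Over two elements, elimination adds the equation to a row or leaves it alone, depending on the
pivot coefficient, which is tested before the row is overwritten. Only rows of variables change; the
rest of the table is recomputed at the start of the next round. -/
theorem eliminate_spec (hs : Static N L s) (hA : EncodesRows N.n s A) {p : ℕ}
    {ψ : ℕ → ZMod 2} (hp : s.reg .pivot = p) (hpn : p < N.n)
    (hψ : ∀ j ≤ N.n, s.arr .psi j = (ψ j).val) :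
    EncodesRows N.n (run L eliminate s) fun i => Net.elim p ψ (A i) := by
  set body := when (Var.n - Var.i) (block [
    set .rowW (.get .row Var.i),
    when (.get .form (Var.rowW + Var.pivot))
      (fill .form .rowW (Var.n + 1)
        (Exp.xor (.get .form (Var.rowW + Var.j)) (.get .psi Var.j)))]) with hbody
  have key := run_rep_of_invariant (L := L) (r := .i) (c := body) (s := s)
    (fun k t => Static N L t ∧ t.reg .pivot = p ∧ t.arr .psi = s.arr .psi ∧
      ∀ i < N.n, ∀ j ≤ N.n, t.arr .form (i * (N.n + 1) + j) =
        ((if i < k then Net.elim p ψ (A i) j else A i j) : ZMod 2).val)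
    ⟨hs, hp, rfl, fun i hi j hj => by rw [if_neg (by omega), hA i hi j hj]⟩ ?_
  · intro i hi j hj
    have := key.2.2.2 i hi j hj
    rwa [if_pos (hi.trans hs.n_lt)] at this
  · rintro k hkL t ⟨t1, t2, t3, t4⟩
    refine ⟨?_, ?_, ?_, ?_⟩
    · exact (t1.of_eq (t := t.setReg .i k) rfl rfl rfl rfl rfl rfl rfl).run (by decide)
    · rw [run_reg_of_not_writes (by decide)]
      simpa using t2
    · rw [run_arr_of_not_stores (by decide)]
      exact t3
    · intro i hi j hj
      by_cases hk : k < N.n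
      · set t₁ := (t.setReg .i k).setReg .rowW (t.arr .row k) with ht₁
        have hrow : t₁.reg .rowW = k * (N.n + 1) := by
          rw [ht₁, t1.row k hkL]
          simp
        have hpiv : Exp.eval t₁ (.get .form (Var.rowW + Var.pivot)) = (A k p).val := by
          have := t4 k hk p hpn.le
          rw [if_neg (lt_irrefl k)] at this
          rw [← this]
          simp only [Exp.eval_get, Exp.eval_add, Exp.eval_var, hrow]
          simp [ht₁, t2]
        have hrun : run L body (t.setReg .i k) = if (A k p).val ≠ 0 then
            run L (fill .form .rowW (Var.n + 1)
              (Exp.xor (.get .form (Var.rowW + Var.j)) (.get .psi Var.j))) t₁ else t₁ := by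
          rw [← hpiv, ht₁, hbody, run_when, if_pos (by
            have : N.n - k ≠ 0 := by omega
            simpa [t1.n] using this)]
          simp [run_when]
        rw [hrun]
        by_cases hz : A k p = 0
        · rw [hz, if_neg (by decide)]
          have := t4 i hi j hj
          rw [ht₁, State.setReg_arr, State.setReg_arr, this]
          by_cases hik : i = k
          · subst hik
            simp [Net.elim, hz]
          · by_cases h : i < k
            · rw [if_pos h, if_pos (by omega)]
            · rw [if_neg h, if_neg (by omega)]
        · have h1 := (ZMod.two_cases (A k p)).resolve_left hz
          rw [if_pos (by rwa [ne_eq, val_eq_zero_iff]),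
            run_fill (M := N.n + 1) (fun j => if j ≤ N.n then (A k j + ψ j).val else 0)
              (by decide) hs.n_lt
              (fun k' t' ht' => by simp [ht'.reg .n (by decide), ht₁, t1.n])
              (fun k' hk' t' ht' => by
                have hk'' : k' ≤ N.n := by omega
                have h2 := t4 k hk k' hk''
                rw [if_neg (lt_irrefl k)] at h2
                have h3 : t'.arr .form (k * (N.n + 1) + k') = (A k k').val := by
                  rw [ht'.cell _ (.inr (by rw [hrow])), ← h2]
                  rfl
                have h4 : t'.arr .psi k' = (ψ k').val := by
                  rw [ht'.arr .psi (by decide), ← hψ k' hk'', ← t3]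
                  rfl
                rw [if_pos hk'', Exp.eval_xor]
                simp only [Exp.eval_get, Exp.eval_add, Exp.eval_var, ht'.counter,
                  ht'.reg .rowW (by decide), hrow, h3, h4, val_xor]),
            hrow]
          by_cases hik : i = k
          · subst hik
            rw [if_pos (by omega), Nat.add_sub_cancel_left, if_pos hj,
              if_pos (Nat.lt_succ_self _), Net.elim, h1, one_mul]
          · rw [if_neg fun h => hik ((cell_mem_row (by omega)).mp ⟨h.1, by omega⟩)]
            have := t4 i hi j hj
            rw [ht₁, State.setReg_arr, State.setReg_arr, this]
            by_cases h : i < k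
            · rw [if_pos h, if_pos (by omega)]
            · rw [if_neg h, if_neg (by omega)]
      · have hrun : run L body (t.setReg .i k) = t.setReg .i k := by
          have : N.n - k = 0 := by omega
          simp [hbody, run_when, t1.n, this]
        have := t4 i hi j hj
        rw [if_pos (by omega)] at this
        rw [hrun, State.setReg_arr, this, if_pos (by omega)]

/-- What holds after `k` rounds. -/
structure Ready (N : Net) (P : Prop) (d L k : ℕ) (s : State) : Prop where
  static : Static N L s
  exists_rows : ∃ A, EncodesRows N.n s A ∧ N.Invariant P d k A

/-- Once the output is constant a round only recomputes the table, and `Invariant.mono` lets the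
round counter advance. -/
theorem round_spec {P : Prop} {d k : ℕ} (H : Ready N P d L k s) :
    Ready N P d L (k + 1) (run L round s) := by
  obtain ⟨hs, A, hA, hI⟩ := H
  refine ⟨hs.run (by decide), ?_⟩
  have h₁ := table_spec hs hA
  set s₁ := run L table s with hs₁
  have hroot : Exp.eval s₁ (.get .root Var.out) = (N.tab A N.out).root := by
    simp [h₁.static.out, (h₁.entry N.out N.out_lt).root]
  have hrun : run L round s = if (N.tab A N.out).root ≠ 0 then
      run L eliminate (run L equation (run L choose (run L mark s₁))) else s₁ := by
    rw [← hroot]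
    rfl
  rw [hrun]
  split_ifs with hout
  · have hM := mark_spec h₁
    have h₂ : EncodesTable N L A N.wires (run L mark s₁) := h₁.run (by decide)
    obtain ⟨x, c, hC, hx, hc⟩ := choose_spec h₂ hM hout
    have h₃ : EncodesTable N L A N.wires (run L choose (run L mark s₁)) := h₂.run (by decide)
    have hxN : x < N.wires := by
      rcases hC with ⟨-, h, -⟩ | ⟨a, ha, hl, -, ⟨-, h, -⟩ | ⟨-, h, -⟩⟩
      · exact (Net.Used.out h).lt_wires
      · rw [Net.v_gate (Net.live_iff.mp hl).1] at h
        exact (ha.reads ⟨hl, .inr h⟩).lt_wires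
      · rw [Net.u_gate (Net.live_iff.mp hl).1] at h
        exact (ha.reads ⟨hl, .inl h⟩).lt_wires
    obtain ⟨p1, p2, hψ⟩ := equation_spec h₃ hx hc hxN hC.exists_pivot
    have h₄ : EncodesTable N L A N.wires (run L equation (run L choose (run L mark s₁))) :=
      h₃.run (by decide)
    exact ⟨_, eliminate_spec h₄.static h₄.rows rfl p1 hψ,
      hI.next hout hC p1 p2 fun i _ j _ => rfl⟩
  · exact ⟨A, h₁.rows, hI.mono (not_not.mp hout) _⟩

end Refuter


namespace Refuter

open Cmd

variable {n L : ℕ} {s : State}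

/-! ### Reading the input -/

/-- Count the ones from the position `acc` of the input on. -/
def countOnes (r : Var) : Cmd := block [
  set r 0,
  set .other 0,
  rep .i (when (1 - Var.other) (branch (.get .input (Var.acc + Var.i))
    (set r (r + 1)) (set .other 1)))]

/-- The flag `other` is raised at the first zero and freezes the count for the remaining iterations.
-/
theorem countOnes_spec {r : Var} {m : ℕ} (h1 : r ≠ .other) (h2 : r ≠ .i) (h3 : r ≠ .acc)
    (hm : m < L) (hone : ∀ i < m, s.arr .input (s.reg .acc + i) ≠ 0)
    (hzero : s.arr .input (s.reg .acc + m) = 0) : (run L (countOnes r) s).reg r = m := by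
  rw [countOnes, run_block_cons, run_block_cons, run_block_cons, run_block_nil]
  have key := run_rep_of_invariant (L := L) (r := .i)
    (c := when (1 - Var.other) (branch (.get .input (Var.acc + Var.i))
      (set r (r + 1)) (set .other 1)))
    (s := run L (set .other 0) (run L (set r 0) s))
    (fun k t => t.reg r = min k m ∧ t.reg .other = (if m < k then 1 else 0) ∧
      t.reg .acc = s.reg .acc ∧ t.arr .input = s.arr .input)
    (by simp [h1, h3.symm]) ?_
  · rw [key.1, min_eq_right hm.le]
  · rintro k - t ⟨e1, e2, e3, e4⟩
    simp only [run_when, run_branch, run_set, Exp.eval_sub, Exp.eval_ofNat, Exp.eval_var,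
      Exp.eval_get, Exp.eval_add, State.setReg_reg, State.setReg_arr, e2, e3, e4, if_true,
      reduceCtorEq, if_false]
    rcases lt_trichotomy k m with hk | rfl | hk
    · have := hone k hk
      simp [this, hk.not_gt, h1.symm, h2, h3.symm, e1, e2, e3, e4]
      omega
    · simp [hzero, h1, h2, e1, e3, e4]
    · simp [hk, h2, e1, e2, e3, e4]
      omega

/-- Read the header of the circuit from the position `acc` of the input on. -/
def readCircuit : Cmd := block [
  set .gates (.get .input Var.acc),
  set .out (.get .input (Var.acc + 1)),
  set .base (Var.acc + 2),
  set .wires (Var.n + Var.gates)]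

/-- Read an input that consists of `n` in unary and a circuit; the dimension is not bounded. -/
def readInput : Cmd := block [
  set .acc 0,
  countOnes .n,
  set .dmax Var.n,
  set .acc (Var.n + 1),
  readCircuit]

/-- Read an input that consists of `n` in unary, the dimension in unary, and a circuit. -/
def readExactInput : Cmd := block [
  set .acc 0,
  countOnes .n,
  set .acc (Var.n + 1),
  countOnes .dmax,
  set .acc (Var.acc + Var.dmax + 1),
  readCircuit]

/-- The input has been read. -/
structure HasRead (C : Circuit n) (m L : ℕ) (s : State) : Prop where
  len : s.reg .len = L
  outLen : s.reg .outLen = 0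
  vars : s.reg .n = n
  dmax : s.reg .dmax = m
  out : s.reg .out = C.output
  wires : s.reg .wires = n + C.gates.length
  gate : ∀ k < C.gates.length, ∀ t < 7,
    s.arr .input (s.reg .base + 7 * k + t) = (C.gate k).encode.getD t 0

theorem getD_flatMap_encode (gs : List Gate) {k t : ℕ} (hk : k < gs.length) (ht : t < 7) :
    (gs.flatMap Gate.encode).getD (7 * k + t) 0 =
      (gs.getD k (.const 0)).encode.getD t 0 := by
  induction gs generalizing k with
  | nil => simp at hk
  | cons g gs ih =>
    have hlen : g.encode.length = 7 := by rw [Gate.encode_eq]; rfl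
    rw [List.flatMap_cons]
    cases k with
    | zero => rw [List.getD_append _ _ _ _ (by omega), Nat.mul_zero, Nat.zero_add,
        List.getD_cons_zero]
    | succ k =>
      rw [List.getD_append_right _ _ _ _ (by omega), hlen,
        show 7 * (k + 1) + t - 7 = 7 * k + t by omega, List.getD_cons_succ,
        ih (by simpa using hk)]

theorem length_encode (C : Circuit n) : C.encode.length = 2 + 7 * C.gates.length := by
  have (gs : List Gate) : (gs.flatMap Gate.encode).length = 7 * gs.length := by
    induction gs with
    | nil => rfl
    | cons g gs ih =>
      rw [List.flatMap_cons, List.length_append, ih, Gate.encode_eq]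
      simp only [List.length_cons, List.length_nil]
      omega
  rw [Circuit.encode, List.length_cons, List.length_cons, this]
  omega

theorem length_unary (k : ℕ) : (unary k).length = k + 1 := by simp [unary]

theorem getD_unary {k i : ℕ} (p q : List ℕ) (hi : i < k) :
    (p ++ unary k ++ q).getD (p.length + i) 0 = 1 := by
  rw [List.append_assoc, List.getD_append_right _ _ _ _ (by omega), Nat.add_sub_cancel_left,
    List.getD_append _ _ _ _ (by rw [length_unary]; omega), unary,
    List.getD_append _ _ _ _ (by simpa using hi), List.getD_replicate _ hi]

theorem getD_unary_self {k : ℕ} (p q : List ℕ) : (p ++ unary k ++ q).getD (p.length + k) 0 = 0 := by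
  rw [List.append_assoc, List.getD_append_right _ _ _ _ (by omega), Nat.add_sub_cancel_left,
    List.getD_append _ _ _ _ (by rw [length_unary]; omega), unary,
    List.getD_append_right _ _ _ _ (by simp)]
  simp

theorem readCircuit_spec {C : Circuit n} {m : ℕ} (p : List ℕ)
    (hin : ∀ i, s.arr .input i = (p ++ C.encode).getD i 0)
    (hlen : s.reg .len = L) (hout : s.reg .outLen = 0) (hn : s.reg .n = n)
    (hm : s.reg .dmax = m) (hacc : s.reg .acc = p.length) :
    HasRead C m L (run L readCircuit s) := by
  have h (i : ℕ) : s.arr .input (p.length + i) = C.encode.getD i 0 := by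
    rw [hin]
    exact (List.getD_append_right _ _ _ _ (by omega)).trans (by rw [Nat.add_sub_cancel_left])
  have h0 := h 0
  rw [Nat.add_zero] at h0
  refine ⟨?_, ?_, ?_, ?_, ?_, ?_, fun k hk t ht => ?_⟩
  · simp [readCircuit, hlen]
  · simp [readCircuit, hout]
  · simp [readCircuit, hn]
  · simp [readCircuit, hm]
  · simp [readCircuit, hacc, h, Circuit.encode]
  · simp [readCircuit, hacc, h0, hn, Circuit.encode]
  · have e1 : (run L readCircuit s).arr .input = s.arr .input :=
      run_arr_of_not_stores (by decide) s
    have e2 : (run L readCircuit s).reg .base = p.length + 2 := by simp [readCircuit, hacc]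
    rw [e1, e2, show p.length + 2 + 7 * k + t = p.length + ((7 * k + t) + 1 + 1) by omega, h,
      Circuit.encode, List.getD_cons_succ, List.getD_cons_succ, getD_flatMap_encode _ hk ht]
    rfl

theorem readInput_spec (C : Circuit n) (hL : L = (unary n ++ C.encode).length) :
    HasRead C n L (run L readInput (.init (unary n ++ C.encode))) := by
  set w := unary n ++ C.encode with hw
  have hnL : n < L := by
    rw [hL, hw, List.length_append, length_unary]
    omega
  rw [readInput, run_block_cons, run_block_cons, run_block_cons, run_block_cons, run_block_cons,
    run_block_nil]
  set s₁ := run L (set .acc 0) (State.init w) with hs₁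
  have hin (i : ℕ) : s₁.arr .input i = w.getD i 0 := rfl
  have hacc₁ : s₁.reg .acc = 0 := rfl
  have hcount : (run L (countOnes .n) s₁).reg .n = n :=
    countOnes_spec (by decide) (by decide) (by decide) hnL
      (fun i hi => by
        have := getD_unary [] C.encode hi
        simp only [List.nil_append, List.length_nil, Nat.zero_add] at this
        rw [hacc₁, Nat.zero_add, hin, hw, this]
        decide)
      (by
        have := getD_unary_self (k := n) [] C.encode
        simp only [List.nil_append, List.length_nil, Nat.zero_add] at this
        rw [hacc₁, Nat.zero_add, hin, hw, this])
  refine readCircuit_spec (unary n) ?_ ?_ ?_ ?_ ?_ ?_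
  · intro i
    rw [← hw, ← hin]
    exact congrFun (run_arr_of_not_stores (c := countOnes .n) (by decide) s₁) i
  · simp only [run_set, State.setReg_reg, reduceCtorEq, if_false]
    rw [run_reg_of_not_writes (by decide), hs₁, hL]
    rfl
  · simp only [run_set, State.setReg_reg, reduceCtorEq, if_false]
    rw [run_reg_of_not_writes (by decide), hs₁]
    rfl
  · simp [hcount]
  · simp [hcount]
  · simp [hcount, length_unary]

theorem readExactInput_spec (C : Circuit n) (d : ℕ)
    (hL : L = (unary n ++ unary d ++ C.encode).length) :
    HasRead C d L (run L readExactInput (.init (unary n ++ unary d ++ C.encode))) := by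
  set w := unary n ++ unary d ++ C.encode with hw
  have hnL : n + d < L := by
    rw [hL, hw, List.length_append, List.length_append, length_unary, length_unary]
    omega
  rw [readExactInput, run_block_cons, run_block_cons, run_block_cons, run_block_cons, run_block_cons,
    run_block_cons, run_block_nil]
  set s₁ := run L (set .acc 0) (State.init w) with hs₁
  have hin (i : ℕ) : s₁.arr .input i = w.getD i 0 := rfl
  have hacc₁ : s₁.reg .acc = 0 := rfl
  have hcount : (run L (countOnes .n) s₁).reg .n = n :=
    countOnes_spec (by decide) (by decide) (by decide) (by omega)
      (fun i hi => by
        have := getD_unary [] (unary d ++ C.encode) hi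
        simp only [List.nil_append, List.length_nil, Nat.zero_add, ← List.append_assoc] at this
        rw [hacc₁, Nat.zero_add, hin, hw, this]
        decide)
      (by
        have := getD_unary_self (k := n) [] (unary d ++ C.encode)
        simp only [List.nil_append, List.length_nil, Nat.zero_add, ← List.append_assoc] at this
        rw [hacc₁, Nat.zero_add, hin, hw, this])
  set s₂ := run L (set .acc (Var.n + 1)) (run L (countOnes .n) s₁) with hs₂
  have hin₂ (i : ℕ) : s₂.arr .input i = w.getD i 0 := by
    rw [← hin]
    exact congrFun (run_arr_of_not_stores (c := countOnes .n) (by decide) s₁) i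
  have hacc : s₂.reg .acc = (unary n).length := by simp [hs₂, hcount, length_unary]
  have hcount₂ : (run L (countOnes .dmax) s₂).reg .dmax = d :=
    countOnes_spec (by decide) (by decide) (by decide) (by omega)
      (fun i hi => by
        rw [hin₂, hacc, hw, getD_unary _ _ hi]
        decide)
      (by rw [hin₂, hacc, hw, getD_unary_self])
  have hacc₂ : (run L (countOnes .dmax) s₂).reg .acc = n + 1 := by
    rw [run_reg_of_not_writes (by decide), hacc, length_unary]
  refine readCircuit_spec (unary n ++ unary d) ?_ ?_ ?_ ?_ ?_ ?_
  · intro i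
    rw [← hw, ← hin₂]
    exact congrFun (run_arr_of_not_stores (c := countOnes .dmax) (by decide) s₂) i
  · simp only [run_set, State.setReg_reg, reduceCtorEq, if_false]
    rw [run_reg_of_not_writes (by decide), hs₂, run_set, State.setReg_reg, if_neg (by decide),
      run_reg_of_not_writes (by decide), hs₁, hL]
    rfl
  · simp only [run_set, State.setReg_reg, reduceCtorEq, if_false]
    rw [run_reg_of_not_writes (by decide), hs₂, run_set, State.setReg_reg, if_neg (by decide),
      run_reg_of_not_writes (by decide), hs₁]
    rfl
  · simp only [run_set, State.setReg_reg, reduceCtorEq, if_false]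
    rw [run_reg_of_not_writes (by decide), hs₂, run_set, State.setReg_reg, if_neg (by decide),
      hcount]
  · simp [hcount₂]
  · simp [hcount₂, hacc₂, length_unary]
    omega

/-! ### The start -/

/-- Compute the positions of the rows. -/
def layout : Cmd := block [
  set .acc 0,
  rep .w (block [put .row Var.w Var.acc, set .acc (Var.acc + (Var.n + 1))])]

/-- Store the forms of the free variables. -/
def initRows : Cmd :=
  rep .i (when (Var.n - Var.i) (block [
    set .rowW (.get .row Var.i),
    fill .form .rowW (Var.n + 1) (1 - .xor Var.i Var.j)]))

/-- The machine cannot multiply, so the multiples of `n + 1` are accumulated by addition. -/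
theorem layout_spec (w : ℕ) (hw : w < L) :
    (run L layout s).arr .row w = w * (s.reg .n + 1) := by
  rw [layout, run_block_cons, run_block_cons, run_block_nil]
  have key := run_rep_of_invariant (L := L) (r := .w)
    (c := block [put .row Var.w Var.acc, set .acc (Var.acc + (Var.n + 1))])
    (s := run L (set .acc 0) s)
    (fun k t => t.reg .acc = k * (s.reg .n + 1) ∧ t.reg .n = s.reg .n ∧
      ∀ w < k, t.arr .row w = w * (s.reg .n + 1))
    (by simp) ?_
  · exact key.2.2 w hw
  · rintro k - t ⟨e1, e2, e3⟩
    refine ⟨by simp [e1, e2]; ring, by simp [e2], fun w hw => ?_⟩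
    by_cases hwk : w = k
    · simp [hwk, e1]
    · simp [hwk, e3 w (by omega)]

theorem HasRead.static {C : Circuit n} {m : ℕ} (h : HasRead C m L s) (hn : 0 < n)
    (hL : n + 1 + C.gates.length ≤ L) : Static (C.net hn) L (run L layout s) := by
  have e1 : (run L layout s).arr .input = s.arr .input := run_arr_of_not_stores (by decide) s
  have e2 : (run L layout s).reg .base = s.reg .base := run_reg_of_not_writes (by decide) s
  have hgate : ∀ w, n ≤ w → w < n + C.gates.length → ∀ t < 7,
      (run L layout s).arr .input ((run L layout s).reg .base + 7 * (w - n) + t) =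
        (C.gate (w - n)).encode.getD t 0 := fun w h1 h2 t ht => by
    rw [e1, e2, h.gate _ (by omega) _ ht]
  refine ⟨hn, ?_, ?_, ?_, ?_, ?_, ?_, fun w hw => ?_, fun w h1 h2 b c => ?_, fun w h1 h2 => ?_,
    fun w h1 h2 => ?_⟩
  · change n < L
    omega
  · change n + C.gates.length ≤ L
    omega
  · rw [run_reg_of_not_writes (by decide), h.len]
  · rw [run_reg_of_not_writes (by decide), h.vars]
    rfl
  · rw [run_reg_of_not_writes (by decide), h.wires]
    rfl
  · rw [run_reg_of_not_writes (by decide), h.out]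
    rfl
  · rw [layout_spec w hw, h.vars]
    rfl
  · have hb := ZMod.val_lt b
    have hc := ZMod.val_lt c
    -- In a block of seven numbers the tag has offset 0 and the truth table value at `(b, c)` has
    -- offset `1 + 2b + c`.
    have := hgate w h1 h2 (1 + b.val + b.val + c.val) (by omega)
    rw [Gate.encode_eq, ← Nat.add_assoc, ← Nat.add_assoc, ← Nat.add_assoc] at this
    refine Eq.trans this ?_
    change _ = ((C.gate (w - n)).fn b c).val
    rcases ZMod.two_cases b with rfl | rfl <;> rcases ZMod.two_cases c with rfl | rfl <;> rfl
  · have := hgate w h1 h2 5 (by omega)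
    rw [Gate.encode_eq] at this
    exact this
  · have := hgate w h1 h2 6 (by omega)
    rw [Gate.encode_eq] at this
    exact this

/-- On natural numbers `xor` is the distance, so `1 - xor` is the Kronecker delta; the constant
terms vanish because `i < n`. -/
theorem initRows_spec {N : Net} (hs : Static N L s) :
    EncodesRows N.n (run L initRows s) Net.start := by
  set body := when (Var.n - Var.i) (block [
    set .rowW (.get .row Var.i),
    fill .form .rowW (Var.n + 1) (1 - .xor Var.i Var.j)]) with hbody
  have key := run_rep_of_invariant (L := L) (r := .i) (c := body) (s := s)
    (fun k t => Static N L t ∧ ∀ i < min k N.n, ∀ j ≤ N.n,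
      t.arr .form (i * (N.n + 1) + j) = (Net.start i j).val)
    ⟨hs, by simp⟩ ?_
  · intro i hi j hj
    exact key.2 i (lt_min (hi.trans hs.n_lt) hi) j hj
  · rintro k hk t ⟨t1, t2⟩
    have t1' : Static N L (t.setReg .i k) := t1.of_eq rfl rfl rfl rfl rfl rfl rfl
    refine ⟨t1'.run (by decide), fun i hi j hj => ?_⟩
    by_cases hkn : k < N.n
    · have hrun : run L body (t.setReg .i k) =
          run L (fill .form .rowW (Var.n + 1) (1 - .xor Var.i Var.j))
            ((t.setReg .i k).setReg .rowW (k * (N.n + 1))) := by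
        have h0 : N.n - k ≠ 0 := by omega
        simp [hbody, run_when, t1.n, h0, t1.row k hk]
      have hrow : ((t.setReg .i k).setReg .rowW (k * (N.n + 1))).reg .rowW = k * (N.n + 1) := by
        simp
      rw [hrun, run_fill (M := N.n + 1) (fun j => (Net.start k j).val) (by decide) hs.n_lt
        (fun k' t' ht' => by simp [ht'.reg .n (by decide), t1.n])
        (fun k' hk' t' ht' => by
          have : t'.reg .i = k := by simp [ht'.reg .i (by decide)]
          rw [Exp.eval_sub, Exp.eval_xor]
          simp only [Exp.eval_ofNat, Exp.eval_var, ht'.counter, this, Net.start]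
          split_ifs with h
          · subst h
            simp [ZMod.val_one]
          · rw [ZMod.val_zero]
            omega), hrow]
      by_cases hik : i = k
      · subst hik
        rw [if_pos (by omega), Nat.add_sub_cancel_left]
      · rw [if_neg fun h => hik ((cell_mem_row (by omega)).mp ⟨h.1, by omega⟩)]
        simp only [State.setReg_arr]
        exact t2 i (by omega) j hj
    · have hrun : run L body (t.setReg .i k) = t.setReg .i k := by
        have : N.n - k = 0 := by omega
        simp [hbody, run_when, t1.n, this]
      rw [hrun, State.setReg_arr]
      exact t2 i (by omega) j hj

/-- All rounds. -/
def rounds : Cmd := rep .stage round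

theorem rounds_spec {N : Net} {P : Prop} {d : ℕ} (h : Ready N P d L 0 s) :
    Ready N P d L L (run L rounds s) := by
  refine run_rep_of_invariant (fun k t => Ready N P d L k t) h fun k _ t ht => ?_
  obtain ⟨h1, A, h2, h3⟩ := ht
  exact round_spec ⟨h1.of_eq rfl rfl rfl rfl rfl rfl rfl, A, h2, h3⟩

end Refuter


namespace Refuter

open Cmd

variable {n L : ℕ} {s : State} {A : ℕ → ℕ → ZMod 2}

/-! ### Printing -/

/-- Print `n` values of an expression that depends on `j`. -/
def emit (e : Exp) : Cmd := block [
  fill .output .outLen Var.n e,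
  set .outLen (Var.outLen + Var.n)]

/-- Print the column `k`. -/
def emitColumn : Cmd := block [
  emit (.get .form (.get .row Var.j + Var.k)),
  set .dim (Var.dim + 1)]

/-- Print the description of the affine subspace. -/
def printAll : Cmd := block [
  set .dim 0,
  set .outLen 1,
  emit (.get .form (.get .row Var.j + Var.n)),
  rep .k (when (Var.n - Var.k) (when (Var.dmax - Var.dim)
    (when (.get .form (.get .row Var.k + Var.k)) emitColumn))),
  put .output 0 Var.dim]

/-- The list `l` has been printed after the first number. -/
structure Printed (l : List ℕ) (s : State) : Prop where
  outLen : s.reg .outLen = 1 + l.length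
  output : ∀ c < l.length, s.arr .output (1 + c) = l.getD c 0

theorem Printed.print {l : List ℕ} (h : Printed l s) : s.print = s.arr .output 0 :: l := by
  rw [State.print, h.outLen, Nat.add_comm, List.range_succ_eq_map, List.map_cons, List.map_map]
  congr 1
  refine List.ext_getElem (by simp) fun c h1 h2 => ?_
  have := h.output c h2
  rw [List.getD_eq_getElem _ _ h2] at this
  simp [← this, Nat.add_comm]

theorem emit_spec {e : Exp} {l : List ℕ} (h : Printed l s) (hn : s.reg .n = n) (hL : n ≤ L)
    (f : ℕ → ℕ) (hf : ∀ j < n, ∀ t, Filling .output (s.reg .outLen) j s t → e.eval t = f j) :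
    Printed (l ++ (List.range n).map f) (run L (emit e) s) := by
  have h1 : (run L (fill .output .outLen Var.n e) s).reg .outLen = s.reg .outLen :=
    run_reg_of_not_writes (by simp [fill, when, writes]) s
  have h2 : (run L (fill .output .outLen Var.n e) s).reg .n = s.reg .n :=
    run_reg_of_not_writes (by simp [fill, when, writes]) s
  refine ⟨?_, fun c hc => ?_⟩
  · simp [emit, h1, h2, h.outLen, hn]
    omega
  · rw [List.length_append, List.length_map, List.length_range] at hc
    rw [emit, run_block_cons, run_block_cons, run_block_nil, run_set, State.setReg_arr,
      run_fill f (by decide) hL (fun k t ht => by simp [ht.reg .n (by decide), hn]) hf, h.outLen]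
    by_cases hcl : c < l.length
    · rw [if_neg (by omega), h.output c hcl, List.getD_append _ _ _ _ hcl]
    · rw [if_pos (by omega), List.getD_append_right _ _ _ _ (by omega),
        List.getD_eq_getElem _ _ (by simp; omega), List.getElem_map, List.getElem_range]
      congr 1
      omega

/-- The coordinates below `k` that occur, but at most `m` of them. -/
def columns (A : ℕ → ℕ → ZMod 2) (m k : ℕ) : List ℕ :=
  ((List.range k).filter fun p => A p p ≠ 0).take m

theorem nodup_columns (m k : ℕ) : (columns A m k).Nodup :=
  (List.take_sublist _ _).nodup (List.nodup_range.filter _)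

theorem mem_columns {m k p : ℕ} (h : p ∈ columns A m k) : p < k ∧ A p p ≠ 0 := by
  simpa using List.mem_of_mem_take h

theorem length_columns (m k : ℕ) : (columns A m k).length = min m (Net.dim k A) := by
  rw [columns, List.length_take]
  rfl

theorem columns_succ (m k : ℕ) : columns A m (k + 1) =
    if A k k ≠ 0 ∧ (columns A m k).length < m then columns A m k ++ [k] else columns A m k := by
  rw [columns, columns, List.range_succ, List.filter_append, List.take_append, List.length_take]
  set l := (List.range k).filter fun p => A p p ≠ 0
  by_cases h : A k k = 0
  · simp [h]
  · rw [List.filter_cons_of_pos (by simpa using h), List.filter_nil]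
    simp only [ne_eq, h, not_false_eq_true, true_and]
    split_ifs with h'
    · rw [List.take_of_length_le (l := [k])]
      simp
      omega
    · rw [Nat.sub_eq_zero_of_le (by omega)]
      simp

/-- The numbers that are printed after the dimension. -/
def body (n : ℕ) (A : ℕ → ℕ → ZMod 2) (cols : List ℕ) : List ℕ :=
  (List.range n).map (fun i => (A i n).val) ++
    cols.flatMap fun p => (List.range n).map fun i => (A i p).val

theorem body_append (n : ℕ) (A : ℕ → ℕ → ZMod 2) (cols : List ℕ) (k : ℕ) :
    body n A (cols ++ [k]) = body n A cols ++ (List.range n).map fun i => (A i k).val := by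
  simp [body]

theorem length_body (n : ℕ) (A : ℕ → ℕ → ZMod 2) (cols : List ℕ) :
    (body n A cols).length = n + n * cols.length := by
  induction cols using List.reverseRecOn with
  | nil => simp [body]
  | append_singleton cols k ih =>
    rw [body_append, List.length_append, ih]
    simp
    ring

/-- Output starts at cell 1; cell 0 is reserved for the dimension, which is written last, when the
number of printed columns is known. -/
theorem printAll_spec {N : Net} {m : ℕ} (hs : Static N L s) (hA : EncodesRows N.n s A)
    (hm : s.reg .dmax = m) : (run L printAll s).print =
      (columns A m N.n).length :: body N.n A (columns A m N.n) := by
  rw [printAll, run_block_cons, run_block_cons, run_block_cons, run_block_cons, run_block_cons,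
    run_block_nil]
  have hcell : ∀ (t : State) (j c : ℕ), t.arr .row = s.arr .row → t.arr .form = s.arr .form →
      j < N.n → c ≤ N.n → t.arr .form (t.arr .row j + c) = (A j c).val := by
    intro t j c h1 h2 hj hc
    rw [h1, h2, hs.row j (hj.trans hs.n_lt), hA j hj c hc]
  set s₁ := run L (set .outLen 1) (run L (set .dim 0) s) with hs₁
  have p₁ : Printed [] s₁ := ⟨by simp [hs₁], by simp⟩
  have n₁ : s₁.reg .n = N.n := by simp [hs₁, hs.n]
  have p₂ := emit_spec p₁ n₁ hs.n_lt.le (e := .get .form (.get .row Var.j + Var.n))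
    (fun i => (A i N.n).val) fun j hj t ht => by
      have h1 : t.reg .n = N.n := by rw [ht.reg .n (by decide), n₁]
      simp only [Exp.eval_get, Exp.eval_add, Exp.eval_var, ht.counter, h1]
      exact hcell t j N.n (ht.arr .row (by decide)) (ht.arr .form (by decide)) hj le_rfl
  set s₂ := run L (emit (.get .form (.get .row Var.j + Var.n))) s₁ with hs₂
  set step := when (Var.n - Var.k) (when (Var.dmax - Var.dim)
    (when (.get .form (.get .row Var.k + Var.k)) emitColumn)) with hstep
  have key := run_rep_of_invariant (L := L) (r := .k) (c := step) (s := s₂)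
    (fun k t => t.reg .n = N.n ∧ t.reg .dmax = m ∧ t.arr .row = s.arr .row ∧
      t.arr .form = s.arr .form ∧ t.reg .dim = (columns A m (min k N.n)).length ∧
      Printed (body N.n A (columns A m (min k N.n))) t) ?_ ?_
  · set s₃ := run L (rep .k step) s₂ with hs₃
    obtain ⟨-, -, -, -, h5, h6⟩ := key
    rw [min_eq_right hs.n_lt.le] at h5 h6
    have h7 : Printed (body N.n A (columns A m N.n)) (run L (put .output 0 Var.dim) s₃) :=
      ⟨h6.outLen, fun c hc => by simp [h6.output c hc]⟩
    rw [h7.print]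
    simp [h5]
  · refine ⟨?_, ?_, ?_, ?_, ?_, ?_⟩
    · rw [hs₂, run_reg_of_not_writes (by decide), n₁]
    · rw [hs₂, run_reg_of_not_writes (by decide), hs₁]
      simpa using hm
    · rw [hs₂, run_arr_of_not_stores (by decide), hs₁]
      rfl
    · rw [hs₂, run_arr_of_not_stores (by decide), hs₁]
      rfl
    · rw [hs₂, run_reg_of_not_writes (by decide), hs₁]
      simp [columns]
    · simpa [columns, body] using p₂
  · rintro k hk t ⟨t1, t2, t3, t4, t5, t6⟩
    refine ⟨?_, ?_, ?_, ?_, ?_⟩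
    · rw [run_reg_of_not_writes (by decide)]
      simpa using t1
    · rw [run_reg_of_not_writes (by decide)]
      simpa using t2
    · rw [run_arr_of_not_stores (by decide)]
      exact t3
    · rw [run_arr_of_not_stores (by decide)]
      exact t4
    have t6' : Printed (body N.n A (columns A m (min k N.n))) (t.setReg .k k) :=
      ⟨by simpa using t6.outLen, t6.output⟩
    have hrun : run L step (t.setReg .k k) =
        if k < N.n ∧ (columns A m (min k N.n)).length < m ∧ A k k ≠ 0 then
          run L emitColumn (t.setReg .k k) else t.setReg .k k := by
      by_cases hkn : k < N.n
      · have h1 : Exp.eval (t.setReg .k k) (.get .form (.get .row Var.k + Var.k)) =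
            (A k k).val := by
          simpa using hcell t k k t3 t4 hkn hkn.le
        rw [hstep, run_when, if_pos (by simpa [t1] using by omega), run_when, run_when, h1]
        by_cases hd : (columns A m (min k N.n)).length < m <;> by_cases hz : A k k = 0 <;>
          simp [t2, t5, hkn, Nat.sub_eq_zero_iff_le, hd, hz]
      · have : N.n - k = 0 := by omega
        simp [hstep, run_when, t1, this, hkn]
    rw [hrun]
    by_cases hkn : k < N.n
    · rw [min_eq_left hkn.le] at t5 t6' ⊢
      rw [min_eq_left (Nat.succ_le_of_lt hkn), columns_succ]
      by_cases hc : (columns A m k).length < m ∧ A k k ≠ 0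
      · rw [if_pos ⟨hkn, hc⟩, if_pos hc.symm, body_append]
        have p := emit_spec (L := L) t6' (by simpa using t1) hs.n_lt.le
          (e := .get .form (.get .row Var.j + Var.k)) (fun i => (A i k).val) fun j hj u hu => by
            have h1 : u.reg .k = k := by simp [hu.reg .k (by decide)]
            simp only [Exp.eval_get, Exp.eval_add, Exp.eval_var, hu.counter, h1]
            exact hcell u j k ((hu.arr .row (by decide)).trans t3)
              ((hu.arr .form (by decide)).trans t4) hj hkn.le
        refine ⟨?_, p.outLen, p.output⟩
        rw [emitColumn, run_block_cons, run_block_cons, run_block_nil, run_set, Exp.eval_add,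
          Exp.eval_var, State.setReg_reg, if_pos rfl, run_reg_of_not_writes (by decide)]
        simp [t5]
      · rw [if_neg fun h => hc h.2, if_neg fun h => hc h.symm]
        exact ⟨by simpa using t5, t6'⟩
    · rw [if_neg fun h => hkn h.1, min_eq_right (by omega)]
      rw [min_eq_right (by omega)] at t5 t6'
      exact ⟨by simpa using t5, t6'⟩

/-! ### The refuter -/

/-- The work after the input has been read. -/
def solve : Cmd := when Var.n (block [layout, initRows, rounds, printAll])

/-- Here `e` is the dimension that the rounds leave and `m` caps the number of printed columns. The
length bound holds for circuits of any size, because the resource bound must. -/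
theorem solve_spec {C : Circuit n} {m d : ℕ} (h : HasRead C m L s)
    (hL : n + 1 + C.gates.length ≤ L) :
    (run L solve s).print.length ≤ 1 + (L + L * L) ∧
    ((C.size : ℤ) < 3 * (n : ℤ) - 4 * (d : ℤ) → ∃ D : AffineDescription n,
      (run L solve s).print = D.encode ∧ (∃ e, d ≤ e ∧ e ≤ n ∧ D.dim = min m e) ∧
        C.ConstantOn D.toSet) := by
  -- Without variables no circuit satisfies the size bound, so printing nothing is correct.
  rcases Nat.eq_zero_or_pos n with rfl | hn
  · have hrun : run L solve s = s := by simp [solve, run_when, h.vars]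
    have hprint : s.print = [] := by simp [State.print, h.outLen]
    rw [hrun, hprint]
    exact ⟨by simp, fun h => by omega⟩
  · have hrun : run L solve s =
        run L printAll (run L rounds (run L initRows (run L layout s))) := by
      simp [solve, run_when, h.vars, hn.ne']
    have h1 := h.static hn hL
    have h2 : Ready (C.net hn) ((C.size : ℤ) < 3 * (n : ℤ) - 4 * (d : ℤ)) d L 0
        (run L initRows (run L layout s)) :=
      ⟨h1.run (by decide), _, initRows_spec h1, Net.invariant_start fun hP => by
        -- The measure is at most `n + size`, so a size below `3n - 4d` gives the initial inequality
        -- with `4n`.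
        have := C.card_used_le hn Net.start
        change _ < 4 * n
        omega⟩
    obtain ⟨h3, A, h4, h5⟩ := rounds_spec h2
    have hm : (run L rounds (run L initRows (run L layout s))).reg .dmax = m := by
      rw [run_reg_of_not_writes (by decide), run_reg_of_not_writes (by decide),
        run_reg_of_not_writes (by decide), h.dmax]
    have hnL : n ≤ L := by omega
    have hred : Net.Reduced n A := h5.reduced
    obtain ⟨h6, h7⟩ := h5.final hnL
    have hd : Net.dim n A ≤ n := by
      rw [Net.dim]
      exact (Finset.card_filter_le _ _).trans (Finset.card_range n).le
    have hlen := length_columns (A := A) m n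
    have hprint : (run L solve s).print = (columns A m n).length :: body n A (columns A m n) := by
      rw [hrun]
      exact printAll_spec h3 h4 hm
    refine ⟨?_, fun hP => ⟨describe hred (columns A m n) (nodup_columns m n)
      fun p hp => mem_columns hp, ?_, ⟨Net.dim n A, h7 hP, hd, hlen⟩,
      describe_constantOn C hn hred _ _ _ h6⟩⟩
    · rw [hprint, List.length_cons, length_body, Nat.add_comm]
      have h8 : n * (columns A m n).length ≤ L * L := Nat.mul_le_mul hnL (by omega)
      omega
    · rw [hprint, describe_encode]
      rfl

/-- A bound for the number of steps and of printed numbers. -/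
noncomputable def bound (c : Cmd) : Polynomial ℕ :=
  c.cost + (1 + (Polynomial.X + Polynomial.X * Polynomial.X))

theorem exists_prints (c : Cmd) (hc : c.writes .len = false) (w : List ℕ)
    (hw : (run w.length c (.init w)).print.length ≤ 1 + (w.length + w.length * w.length)) :
    ∃ t, (c.compile 64).Prints w (run w.length c (.init w)).print t ∧
      t + (run w.length c (.init w)).print.length ≤ (bound c).eval (bitLength w) := by
  obtain ⟨t, h1, h2⟩ := prints_compile c hc w
  refine ⟨t, h1, le_trans ?_ (eval_mono_of_nat _ (length_le_bitLength w))⟩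
  simp only [bound, Polynomial.eval_add, Polynomial.eval_mul, Polynomial.eval_X,
    Polynomial.eval_one]
  omega

/-- The cap is `n`, which no dimension exceeds, so all columns are printed. The program never needs
to know `d`, which occurs only in the analysis. -/
theorem isAffineRefuter (d : ℕ → ℕ) : IsAffineRefuter d
    (fun n => 3 * (n : ℤ) - 4 * (d n : ℤ)) ((Cmd.seq readInput solve).compile 64) := by
  refine ⟨bound (.seq readInput solve), fun n C => ?_⟩
  obtain ⟨h1, h2⟩ := solve_spec (d := d n) (readInput_spec C rfl) (by
    rw [List.length_append, length_unary, length_encode]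
    omega)
  obtain ⟨t, h3, h4⟩ := exists_prints (.seq readInput solve) (by decide) _ h1
  refine ⟨_, t, h3, h4, fun hC => ?_⟩
  obtain ⟨D, h5, ⟨e, h6, h7, h8⟩, h9⟩ := h2 hC
  exact ⟨D, h5, by omega, h9⟩

/-- The cap is `d n`, which the dimension reached is not below, so exactly `d n` columns are
printed. -/
theorem isExactAffineRefuter (d : ℕ → ℕ) : IsExactAffineRefuter d
    (fun n => 3 * (n : ℤ) - 4 * (d n : ℤ)) ((Cmd.seq readExactInput solve).compile 64) := by
  refine ⟨bound (.seq readExactInput solve), fun n C => ?_⟩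
  obtain ⟨h1, h2⟩ := solve_spec (d := d n) (readExactInput_spec C (d n) rfl) (by
    rw [List.length_append, List.length_append, length_unary, length_unary, length_encode]
    omega)
  obtain ⟨t, h3, h4⟩ := exists_prints (.seq readExactInput solve) (by decide) _ h1
  refine ⟨_, t, h3, h4, fun hC => ?_⟩
  obtain ⟨D, h5, ⟨e, h6, h7, h8⟩, h9⟩ := h2 hC
  exact ⟨D, h5, by omega, h9⟩

end Refuter

end AffineRefuter

theorem mainTheorem2 (d : ℕ → ℕ) :
    (∃ P : AffineRefuter.Program,
      AffineRefuter.IsAffineRefuter d (fun n => 3 * (n : ℤ) - 4 * (d n : ℤ)) P) ∧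
    (∃ P : AffineRefuter.Program,
      AffineRefuter.IsExactAffineRefuter d (fun n => 3 * (n : ℤ) - 4 * (d n : ℤ)) P) :=
  ⟨⟨_, AffineRefuter.Refuter.isAffineRefuter d⟩,
    ⟨_, AffineRefuter.Refuter.isExactAffineRefuter d⟩⟩
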